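/- Let $k$ be a commutative ring, let $A$ and $U$ be (unital associative, not necessarily commutative) $k$-algebras, and let $U$ be a left bialgebroid ($\times_A$-bialgebra) over $A$, with structure map $\eta:A\otimes_k A^{op}\to U$, source $s(a)=\eta(a\otimes 1)$, target $t(a)=\eta(1\otimes a)$, coproduct $\Delta:U\to U_{\triangleleft}\otimes_A{}_{\triangleright}U$, $u\mapsto u_{(1)}\otimes_A u_{(2)}$, and counit $\varepsilon:U\to A$. Here $a\triangleright u=s(a)u$ and $u\triangleleft a=t(a)u$ are the left and right $A$-actions on $U$; every left $U$-module $N$ is an $A$-bimodule through $a\triangleright n=s(a)n$ and $n\triangleleft a=t(a)n$. Let $N$ be a braided commutative Yetter-Drinfel'd algebra over $U$. That is, $N$ is a $k$-algebra which is a left $U$-module and a left $U$-comodule with coaction $n\mapsto n_{(-1)}\otimes_A n_{(0)}$, such that the $A$-bimodule structures induced by action and coaction coincide and * $N$ is an $A$-ring for this bimodule structure, a left $U$-module algebra ($u(nn')=(u_{(1)}n)(u_{(2)}n')$, $u1_N=\varepsilon(u)\triangleright 1_N$) and a left $U$-comodule algebra ($1_N\mapsto 1_U\otimes_A 1_N$,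 $nn'\mapsto n_{(-1)}n'_{(-1)}\otimes_A n_{(0)}n'_{(0)}$); * $(u_{(1)}n)_{(-1)}u_{(2)}\otimes_A(u_{(1)}n)_{(0)}=u_{(1)}n_{(-1)}\otimes_A u_{(2)}n_{(0)}$ for all $u\in U$, $n\in N$; * $nn'=(n_{(-1)}n')\,n_{(0)}$ for all $n,n'\in N$. Put $C^p_{co}(U,N)=({}_{\triangleright}U_{\triangleleft})^{\otimes_A p}\otimes_A N$, write $(u^1,\dots,u^p,n)$ for its elementary tensors, and let $\beta=\sum_{i=0}^{p+1}(-1)^i\delta_i:C^p_{co}(U,N)\to C^{p+1}_{co}(U,N)$, where $\delta_0(u^1,\dots,u^p,n)=(1,u^1,\dots,u^p,n)$, $\delta_i$ applies $\Delta$ to $u^i$ for $1\le i\le p$, and $\delta_{p+1}$ applies the coaction to $n$. Let $H^\bullet_{co}(U,N)$ be the cohomology of $(C^\bullet_{co}(U,N),\beta)$. **Theorem.** (i) There are well-defined $k$-bilinear maps $\circ_i:C^p_{co}(U,N)\times C^q_{co}(U,N)\to C^{p+q-1}_{co}(U,N)$, given for $1\le i\le p$ by $$(u^1,\dots,u^p,n)\circ_i(v^1,\dots,v^q,n')=\bigl(u^1,\dots,u^{i-1},\,u^i_{(1)}v^1,\dots,u^i_{(q)}v^q,\,(u^i_{(q+1)}n')_{(-p+i)}u^{i+1},\dots,(u^i_{(q+1)}n')_{(-1)}u^p,\,(u^i_{(q+1)}n')_{(0)}\,n\bigr)$$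 and equal to zero if $i>p$ or $p=0$, and with $$\mu=(1_U,1_U,1_N)\in C^2_{co}(U,N),\qquad \mathbb 1=(1_U,1_N)\in C^1_{co}(U,N),\qquad e=1_N\in C^0_{co}(U,N)$$ they make $C^\bullet_{co}(U,N)$ an operad with multiplication, i.e. for $\varphi,\psi,\chi$ of degrees $p,q,r$, $1\le i\le p$ and $j\ge 1$, $$(\varphi\circ_i\psi)\circ_j\chi=\begin{cases}(\varphi\circ_j\chi)\circ_{i+r-1}\psi & j<i,\\ \varphi\circ_i(\psi\circ_{j-i+1}\chi)& i\le j<q+i,\\ (\varphi\circ_{j-q+1}\chi)\circ_i\psi & j\ge q+i,\end{cases}$$ $\varphi\circ_i\mathbb 1=\varphi$ and $\mathbb 1\circ_1\varphi=\varphi$, $\mu\circ_1\mu=\mu\circ_2\mu$, and $\mu\circ_1e=\mu\circ_2e=\mathbb 1$. (ii) With $|n|=n-1$, put $$\varphi\,\bar\circ\,\psi=(-1)^{|p||q|}\sum_{i=1}^p(-1)^{|q||i|}\varphi\circ_i\psi,\qquad \{\varphi,\psi\}=\varphi\,\bar\circ\,\psi-(-1)^{|p||q|}\psi\,\bar\circ\,\varphi,\qquad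 \varphi\smallsmile\psi=(\mu\circ_1\varphi)\circ_{p+1}\psi.$$ Then $\beta\varphi=\{\mu,\varphi\}$, and $\smallsmile$ and $\{\cdot,\cdot\}$ induce on $H^\bullet_{co}(U,N)$ the structure of a Gerstenhaber algebra with unit the class of $e$: an associative unital product with $\alpha\smallsmile\alpha'=(-1)^{pq}\alpha'\smallsmile\alpha$ for $\alpha,\alpha'$ of degrees $p,q$, and a graded Lie bracket on the desuspension (antisymmetry and Jacobi identity with $\{\alpha,\alpha\}=0$ for $|p|$ even and $\{\alpha,\{\alpha,\alpha\}\}=0$ for $|p|$ odd, $p$ the degree of $\alpha$; so of degree $-1$ on $H^\bullet_{co}(U,N)$, and zero on $H^0\times H^0$) with $\{\gamma,\alpha\smallsmile\alpha'\}=\{\gamma,\alpha\}\smallsmile\alpha'+(-1)^{|r|q}\alpha\smallsmile\{\gamma,\alpha'\}$ for $\gamma,\alpha$ of degrees $r,q$. (iii) If $U_{\triangleleft}$ is flat as a right $A$-module, let $\operatorname{Cotor}^\bullet_U(A,N)$ be the right derived functors of the cotensor product $A\,\square_U-$ on left $U$-comodules ($A$ being a right comodule by $a\mapsto 1\otimes_A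 t(a)$), evaluated at $N$: an injective resolution $N\to I^\bullet$ of left $U$-comodules exists, and $\operatorname{Cotor}^n_U(A,N)=H^n(A\,\square_U I^\bullet)$. Then the canonical maps $H^n_{co}(U,N)\to\operatorname{Cotor}^n_U(A,N)$, $[z]\mapsto[1\otimes_A f(1\otimes_A z)]$, where $f$ is any morphism under $N$ from the cobar resolution $U\otimes_A C^\bullet_{co}(U,N)$ of $N$ to $I^\bullet$, are $k$-linear isomorphisms, and through them $\operatorname{Cotor}^\bullet_U(A,N)$ is a Gerstenhaber algebra. -/

import Mathlib

open scoped TensorProduct DirectSum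

universe v u w

namespace BialgebroidCohomology

noncomputable section

/-! # Left modules over the base algebra and the functor `U ⊗_A -`

`k` is a commutative ring, `A` and `U` are (possibly noncommutative) `k`-algebras, and
`η : A ⊗ Aᵒᵖ → U` is a morphism of `k`-algebras with source map `s` and target map `t`. -/

/-- A left module over the `k`-algebra `A`, with its induced `k`-module structure. -/
structure LeftMod (k : Type v) (A : Type u) [CommRing k] [Ring A] [Algebra k A] where
  carrier : Type u
  [addCommGroup : AddCommGroup carrier]
  [moduleBase : Module k carrier]
  [moduleAlg : Module A carrier]
  [tower : IsScalarTower k A carrier]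

attribute [instance] LeftMod.addCommGroup LeftMod.moduleBase LeftMod.moduleAlg LeftMod.tower

instance {k : Type v} {A : Type u} [CommRing k] [Ring A] [Algebra k A] :
    CoeSort (LeftMod k A) (Type u) := ⟨LeftMod.carrier⟩

section Tensor

variable {k : Type v} {A U : Type u} [CommRing k] [Ring A] [Algebra k A] [Ring U] [Algebra k U]
variable (η : A ⊗[k] Aᵐᵒᵖ →ₐ[k] U)

/-- The source map `s(a) = η(a ⊗ 1)`, a morphism of algebras. -/
def src : A →ₐ[k] U := η.comp Algebra.TensorProduct.includeLeft

/-- The target map `t(a) = η(1 ⊗ a)`, a morphism of algebras on the opposite of `A`. -/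
def tgtOp : Aᵐᵒᵖ →ₐ[k] U := η.comp Algebra.TensorProduct.includeRight

/-- The target map as a function on `A`. -/
def tgt (a : A) : U := tgtOp η (MulOpposite.op a)

/-- A left `U`-module seen as a left `A`-module through the source map: `a ▷ n = s(a) n`. -/
def ofAction (N : Type u) [AddCommGroup N] [Module k N] [Module U N] [IsScalarTower k U N] :
    LeftMod k A :=
  letI : Module A N := Module.compHom N (src η).toRingHom
  { carrier := N
    tower := ⟨fun c a n => by
      change src η (c • a) • n = c • (src η a • n)
      rw [map_smul, smul_assoc]⟩ }

/-- `U` itself with the left `A`-action `a ▷ u = s(a) u`. -/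
def regularMod : LeftMod k A := ofAction η U

/-- The relations `(u ◁ a) ⊗ x = u ⊗ (a x)`, where `u ◁ a = t(a) u`. -/
def tensRel (X : LeftMod k A) : Submodule k (U ⊗[k] X) :=
  Submodule.span k {w | ∃ (a : A) (u : U) (x : X), w = (tgt η a * u) ⊗ₜ[k] x - u ⊗ₜ[k] (a • x)}

/-- Left multiplication by `s(a)` on the first factor of `U ⊗_k X`. -/
def preAct (X : LeftMod k A) : A →ₐ[k] Module.End k (U ⊗[k] X) :=
  ((Module.End.rTensorAlgHom k U X).comp (Algebra.lmul k U)).comp (src η)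

lemma src_mul_tgt (a b : A) : src η a * tgt η b = tgt η b * src η a := by
  simp [src, tgt, tgtOp, ← map_mul]

lemma preAct_tmul (X : LeftMod k A) (a : A) (u : U) (x : X) :
    preAct η X a (u ⊗ₜ[k] x) = (src η a * u) ⊗ₜ[k] x := by
  rfl

lemma preAct_le (X : LeftMod k A) (a : A) :
    tensRel η X ≤ (tensRel η X).comap (preAct η X a) := by
  refine Submodule.span_le.2 ?_
  rintro _ ⟨b, u, x, rfl⟩
  refine Submodule.subset_span ⟨b, src η a * u, x, ?_⟩
  rw [map_sub, preAct_tmul, preAct_tmul, ← mul_assoc, ← mul_assoc, src_mul_tgt]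

/-- The induced left `A`-action on the quotient. -/
def tensAct (X : LeftMod k A) : A →+* Module.End k ((U ⊗[k] X) ⧸ tensRel η X) where
  toFun a := (tensRel η X).mapQ (tensRel η X) (preAct η X a) (preAct_le η X a)
  map_one' := by ext; simp
  map_mul' a b := by ext; simp
  map_zero' := by ext; simp
  map_add' a b := by ext; simp

/-- The tensor product `U_◁ ⊗_A X` over the noncommutative ring `A`, a left `A`-module through
`a (u ⊗ x) = s(a) u ⊗ x`. -/
def tens (X : LeftMod k A) : LeftMod k A :=
  letI : Module A ((U ⊗[k] X) ⧸ tensRel η X) := Module.compHom _ (tensAct η X)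
  { carrier := (U ⊗[k] X) ⧸ tensRel η X
    tower := ⟨fun c a w => by
      change tensAct η X (c • a) w = c • (tensAct η X a w)
      obtain ⟨w, rfl⟩ := (tensRel η X).mkQ_surjective w
      change (tensRel η X).mkQ (preAct η X (c • a) w) = c • (tensRel η X).mkQ (preAct η X a w)
      rw [map_smul, LinearMap.smul_apply, map_smul]⟩ }

/-- The elementary tensor `u ⊗ x` in `U ⊗_A X`. -/
def tmul (X : LeftMod k A) : U →ₗ[k] X →ₗ[k] tens η X :=
  (TensorProduct.mk k U X).compr₂ (tensRel η X).mkQ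

variable {η}

lemma smul_tmul (X : LeftMod k A) (a : A) (u : U) (x : X) :
    a • tmul η X u x = tmul η X (src η a * u) x := by
  change (tensRel η X).mkQ (preAct η X a (u ⊗ₜ[k] x)) = _
  rw [preAct_tmul]; rfl

lemma tgt_mul_tmul (X : LeftMod k A) (a : A) (u : U) (x : X) :
    tmul η X (tgt η a * u) x = tmul η X u (a • x) :=
  (Submodule.Quotient.eq _).2 (Submodule.subset_span ⟨a, u, x, rfl⟩)

lemma tens_induction {X : LeftMod k A} {P : tens η X → Prop}
    (ht : ∀ u x, P (tmul η X u x)) (ha : ∀ z z', P z → P z' → P (z + z')) (w : tens η X) :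
    P w := by
  obtain ⟨w, rfl⟩ := (tensRel η X).mkQ_surjective w
  induction w using TensorProduct.induction_on with
  | zero =>
    have h := ht 0 0
    rw [map_zero] at h
    rw [map_zero]
    exact h
  | tmul u x => exact ht u x
  | add z z' h h' => rw [map_add]; exact ha _ _ h h'

/-- The `A`-linear map on `U ⊗_A X` induced by an `A`-balanced map, `A`-linear in the first
variable. -/
def tensLift {X Y : LeftMod k A} (f : U →ₗ[k] X →ₗ[k] Y)
    (hbal : ∀ a u x, f (tgt η a * u) x = f u (a • x))
    (hlin : ∀ a u x, f (src η a * u) x = a • f u x) : tens η X →ₗ[A] Y :=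
  let g : tens η X →ₗ[k] Y := (tensRel η X).liftQ (TensorProduct.lift f) (by
    refine Submodule.span_le.2 ?_
    rintro _ ⟨a, u, x, rfl⟩
    simp [hbal])
  have hg : ∀ u x, g (tmul η X u x) = f u x := fun u x => by
    change TensorProduct.lift f (u ⊗ₜ[k] x) = _
    simp
  { toFun := g
    map_add' := g.map_add
    map_smul' := fun a w => by
      induction w using tens_induction with
      | ht u x => rw [smul_tmul, hg, hg, hlin]; rfl
      | ha z z' h h' => rw [smul_add, map_add, map_add, smul_add, h, h'] }

lemma tensLift_tmul {X Y : LeftMod k A} (f : U →ₗ[k] X →ₗ[k] Y) (hbal) (hlin) (u : U) (x : X) :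
    tensLift (η := η) f hbal hlin (tmul η X u x) = f u x := by
  change TensorProduct.lift f (u ⊗ₜ[k] x) = _
  simp

/-- Functoriality: `id_U ⊗ f`. -/
def tensMap {X Y : LeftMod k A} (f : X →ₗ[A] Y) : tens η X →ₗ[A] tens η Y :=
  tensLift ((tmul η Y).compl₂ (f.restrictScalars k))
    (fun a u x => by simp [tgt_mul_tmul])
    (fun a u x => by simp [smul_tmul])

lemma tensMap_tmul {X Y : LeftMod k A} (f : X →ₗ[A] Y) (u : U) (x : X) :
    tensMap f (tmul η X u x) = tmul η Y u (f x) := by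
  exact tensLift_tmul _ _ _ u x

variable (η) in
/-- For fixed `x`, the left `A`-linear map `U → U ⊗_A X`, `u ↦ u ⊗ x`. -/
def tmulRight (X : LeftMod k A) (x : X) : regularMod η →ₗ[A] tens η X where
  toFun u := tmul η X (show U from u) x
  map_add' u u' := by
    change tmul η X ((show U from u) + (show U from u')) x = _
    rw [map_add]; rfl
  map_smul' a u := (smul_tmul X a (show U from u) x).symm

/-- `w = ∑ᵢ uᵢ ⊗ xᵢ` in `U ⊗_A X`; used to spell out Sweedler notation. -/
def IsRep {X : LeftMod k A} (w : tens η X) {r : ℕ} (x : Fin r → U) (y : Fin r → X) : Prop :=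
  w = ∑ i, tmul η X (x i) (y i)

end Tensor

/-! # Left bialgebroids -/

/-- A left bialgebroid (`×_A`-bialgebra) structure on the `k`-algebra `U` over the `k`-algebra `A`.
The four `A`-actions on `U` are `a ▷ u = s(a) u`, `u ◁ a = t(a) u`, `a ▸ u = u t(a)` and
`u ◂ a = u s(a)`. Identities in Sweedler notation are required for all representatives. -/
structure LeftBialgebroid (k : Type v) (A U : Type u) [CommRing k] [Ring A] [Algebra k A]
    [Ring U] [Algebra k U] where
  η : A ⊗[k] Aᵐᵒᵖ →ₐ[k] U
  /-- The coproduct `U → U_◁ ⊗_A ▷U`, left `A`-linear: `Δ(s(a) u) = s(a) u₍₁₎ ⊗ u₍₂₎`. -/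
  comul : regularMod η →ₗ[A] tens η (regularMod η)
  counit : U →ₗ[k] A
  /-- Right `A`-linearity: `Δ(t(a) u) = u₍₁₎ ⊗ t(a) u₍₂₎`. -/
  comul_tgt : ∀ (a : A) (u : U) {r : ℕ} (x y : Fin r → U), IsRep (comul u) x y →
    IsRep (comul (tgt η a * u)) x (fun i => tgt η a * y i)
  counit_src : ∀ (a : A) (u : U), counit (src η a * u) = a * counit u
  counit_tgt : ∀ (a : A) (u : U), counit (tgt η a * u) = counit u * a
  /-- Coassociativity: `(Δ ⊗ id) Δ(u) = (id ⊗ Δ) Δ(u)`. -/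
  coassoc : ∀ (u : U) {r : ℕ} (x y : Fin r → U), IsRep (comul u) x y →
    ∑ i, tensMap (tmulRight η (regularMod η) (y i)) (comul (x i)) = tensMap comul (comul u)
  /-- Counitality: `s(ε(u₍₁₎)) u₍₂₎ = u`. -/
  counit_comul_left : ∀ (u : U) {r : ℕ} (x y : Fin r → U), IsRep (comul u) x y →
    ∑ i, src η (counit (x i)) * y i = u
  /-- Counitality: `t(ε(u₍₂₎)) u₍₁₎ = u`. -/
  counit_comul_right : ∀ (u : U) {r : ℕ} (x y : Fin r → U), IsRep (comul u) x y →
    ∑ i, tgt η (counit (y i)) * x i = u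
  /-- `Δ` takes values in the Sweedler-Takeuchi product:
  `u₍₁₎ t(a) ⊗ u₍₂₎ = u₍₁₎ ⊗ u₍₂₎ s(a)`. -/
  takeuchi : ∀ (a : A) (u : U) {r : ℕ} (x y : Fin r → U), IsRep (comul u) x y →
    ∑ i, tmul η (regularMod η) (x i * tgt η a) (y i) =
      ∑ i, tmul η (regularMod η) (x i) (y i * src η a)
  comul_one : comul (1 : U) = tmul η (regularMod η) (1 : U) (1 : U)
  /-- `Δ(u v) = u₍₁₎ v₍₁₎ ⊗ u₍₂₎ v₍₂₎`. -/
  comul_mul : ∀ (u v : U) {r r' : ℕ} (x y : Fin r → U) (x' y' : Fin r' → U),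
    IsRep (comul u) x y → IsRep (comul v) x' y' →
    comul (u * v) = ∑ i, ∑ j, tmul η (regularMod η) (x i * x' j) (y i * y' j)
  counit_one : counit 1 = 1
  counit_mul_src : ∀ u v : U, counit (u * src η (counit v)) = counit (u * v)
  counit_mul_tgt : ∀ u v : U, counit (u * tgt η (counit v)) = counit (u * v)

section Bialgebroid

variable {k : Type v} {A U : Type u} [CommRing k] [Ring A] [Algebra k A] [Ring U] [Algebra k U]

lemma exists_rep {η : A ⊗[k] Aᵐᵒᵖ →ₐ[k] U} {X : LeftMod k A} (w : tens η X) :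
    ∃ (r : ℕ) (x : Fin r → U) (y : Fin r → X), IsRep w x y := by
  induction w using tens_induction with
  | ht u x => exact ⟨1, fun _ => u, fun _ => x, by simp [IsRep]⟩
  | ha z z' h h' =>
    obtain ⟨r, x, y, rfl⟩ := h
    obtain ⟨r', x', y', rfl⟩ := h'
    exact ⟨r + r', Fin.append x x', Fin.append y y', by simp [IsRep, Fin.sum_univ_add]⟩

namespace LeftBialgebroid

variable (B : LeftBialgebroid k A U)

/-- `Δ ⊗ id : U ⊗_A X → U ⊗_A (U ⊗_A X)`, `u ⊗ x ↦ u₍₁₎ ⊗ (u₍₂₎ ⊗ x)`. -/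
def comulTens (X : LeftMod k A) : tens B.η X →ₗ[A] tens B.η (tens B.η X) :=
  tensLift
    (LinearMap.mk₂ k (fun u x => tensMap (tmulRight B.η X x) (B.comul u))
      (fun u u' x => by
        change tensMap _ (B.comul ((show regularMod B.η from u) + (show regularMod B.η from u'))) = _
        rw [map_add, map_add])
      (fun c u x => by
        change tensMap _ (B.comul (c • (show regularMod B.η from u))) = _
        rw [LinearMap.map_smul_of_tower, LinearMap.map_smul_of_tower])
      (fun u x x' => by
        induction B.comul u using tens_induction with
        | ht v y =>
          rw [tensMap_tmul, tensMap_tmul, tensMap_tmul, ← map_add]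
          exact congrArg _ (map_add (tmul B.η X (show U from y)) x x')
        | ha z z' h h' => rw [map_add, map_add, map_add, h, h']; abel)
      (fun c u x => by
        induction B.comul u using tens_induction with
        | ht v y =>
          rw [tensMap_tmul, tensMap_tmul, ← map_smul]
          exact congrArg _ (map_smul (tmul B.η X (show U from y)) c x)
        | ha z z' h h' => rw [map_add, map_add, h, h', smul_add]))
    (fun a u x => by
      obtain ⟨r, y, z, h⟩ := exists_rep (B.comul u)
      have h' := B.comul_tgt a u y z h
      change tensMap (tmulRight B.η X x) (B.comul (tgt B.η a * u : U)) =
        tensMap (tmulRight B.η X (a • x)) (B.comul u)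
      unfold IsRep at h h'
      refine (congrArg _ h').trans (Eq.trans ?_ (congrArg _ h.symm))
      refine (map_sum _ _ _).trans (Eq.trans ?_ (map_sum _ _ _).symm)
      refine Finset.sum_congr rfl fun i _ => ?_
      refine (tensMap_tmul _ _ _).trans (Eq.trans ?_ (tensMap_tmul _ _ _).symm)
      exact congrArg _ (tgt_mul_tmul (U := U) X a (z i) x))
    (fun a u x => by
      change tensMap (tmulRight B.η X x) (B.comul (a • (show regularMod B.η from u))) = _
      rw [map_smul, map_smul]; rfl)

lemma comulTens_tmul (X : LeftMod k A) (u : U) (x : X) :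
    B.comulTens X (tmul B.η X u x) = tensMap (tmulRight B.η X x) (B.comul u) := by
  rw [comulTens, tensLift_tmul]; rfl

/-- `U_◁` is flat as a right `A`-module: `U_◁ ⊗_A -` preserves injectivity of maps of
left `A`-modules. -/
def IsFlatRight : Prop :=
  ∀ (X Y : LeftMod k A) (f : X →ₗ[A] Y), Function.Injective f →
    Function.Injective (tensMap (η := B.η) f)

end LeftBialgebroid

/-! # Left comodules and the coring cochain complex -/

/-- A left comodule over a left bialgebroid: a left `A`-module `M` with a left `A`-linear,
coassociative and counital coaction `M → U_◁ ⊗_A M`, `m ↦ m₍₋₁₎ ⊗ m₍₀₎`. -/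
structure LeftComodule (B : LeftBialgebroid k A U) where
  toMod : LeftMod k A
  coact : toMod →ₗ[A] tens B.η toMod
  coassoc : ∀ m, B.comulTens toMod (coact m) = tensMap coact (coact m)
  counit_coact : ∀ m {r : ℕ} (x : Fin r → U) (y : Fin r → toMod), IsRep (coact m) x y →
    ∑ i, B.counit (x i) • y i = m

variable {B : LeftBialgebroid k A U}

/-- `U` as a left comodule over itself, with coaction `Δ`. -/
def regularComodule (B : LeftBialgebroid k A U) : LeftComodule B where
  toMod := regularMod B.η
  coact := B.comul
  coassoc u := by
    obtain ⟨r, x, y, h⟩ := exists_rep (B.comul u)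
    rw [← B.coassoc u x y h]
    conv_lhs => rw [h]
    rw [map_sum]
    exact Finset.sum_congr rfl fun i _ => B.comulTens_tmul _ _ _
  counit_coact u _ x y h := B.counit_comul_left u x y h

/-- The cochain space `U^{⊗_A n} ⊗_A X`. -/
def cochain (η : A ⊗[k] Aᵐᵒᵖ →ₐ[k] U) (X : LeftMod k A) : ℕ → LeftMod k A
  | 0 => X
  | n + 1 => tens η (cochain η X n)

/-- The elementary tensor `(u¹, …, uⁿ, m)` in `U^{⊗_A n} ⊗_A X`, where `uʲ⁺¹ = u j`; only the first
`n` entries of the sequence `u` matter. -/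
def elem (η : A ⊗[k] Aᵐᵒᵖ →ₐ[k] U) (X : LeftMod k A) : (n : ℕ) → (ℕ → U) → X → cochain η X n
  | 0, _, m => m
  | n + 1, u, m => tmul η (cochain η X n) (u 0) (elem η X n (fun j => u (j + 1)) m)

namespace LeftComodule

variable (M : LeftComodule B)

/-- The cochain space `Cⁿ_co(U, M)`. -/
abbrev C (n : ℕ) : LeftMod k A := cochain B.η M.toMod n

/-- The cofaces `δ_{j+1} : Cⁿ → Cⁿ⁺¹` for `0 ≤ j ≤ n`: the coproduct applied to `uʲ⁺¹` if
`j + 1 ≤ n`, and the coaction applied to `m` if `j = n`. -/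
def cofaceSucc : (n j : ℕ) → (M.C n →ₗ[A] M.C (n + 1))
  | 0, _ => M.coact
  | n + 1, 0 => B.comulTens (M.C n)
  | n + 1, j + 1 => tensMap (cofaceSucc n j)

/-- All cofaces `δ_i : Cⁿ → Cⁿ⁺¹`, `0 ≤ i ≤ n + 1`, where `δ₀(z) = 1 ⊗ z`. -/
def coface (n : ℕ) : ℕ → (M.C n →ₗ[k] M.C (n + 1))
  | 0 => tmul B.η (M.C n) 1
  | j + 1 => (M.cofaceSucc n j).restrictScalars k

/-- The coboundary `β = ∑_{i=0}^{n+1} (-1)ⁱ δ_i`. -/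
def diff (n : ℕ) : M.C n →ₗ[k] M.C (n + 1) :=
  ∑ i ∈ Finset.range (n + 2), (-1 : k) ^ i • M.coface n i

/-- The `n`-cocycles. -/
def cocycles (n : ℕ) : Submodule k (M.C n) := LinearMap.ker (M.diff n)

/-- The `n`-coboundaries. -/
def coboundaries : (n : ℕ) → Submodule k (M.C n)
  | 0 => ⊥
  | n + 1 => LinearMap.range (M.diff n)

/-- The coring cohomology `Hⁿ_co(U, M)`. -/
abbrev H (n : ℕ) : Type u := M.cocycles n ⧸ (M.coboundaries n).submoduleOf (M.cocycles n)

/-- The cohomology class of a cocycle. -/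
def cls (n : ℕ) (z : M.C n) (hz : z ∈ M.cocycles n) : M.H n := Submodule.Quotient.mk ⟨z, hz⟩

/-- The iterated coaction `m ↦ m₍₋ᵣ₎ ⊗ ⋯ ⊗ m₍₋₁₎ ⊗ m₍₀₎`. For `M = U` with coaction `Δ` this is
the iterated coproduct `u ↦ u₍₁₎ ⊗ ⋯ ⊗ u₍ᵣ₊₁₎`. -/
def iterCoact : (r : ℕ) → (M.toMod →ₗ[A] M.C r)
  | 0 => LinearMap.id
  | r + 1 => (tensMap (iterCoact r)).comp M.coact

end LeftComodule

/-! # Yetter-Drinfeld algebras -/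

/-- A Yetter-Drinfeld algebra over a left bialgebroid on a `k`-algebra `N` with a `k`-linear left
`U`-action: `N` is an `A`-ring with respect to `a ▷ n = s(a) n`, `n ◁ a = t(a) n`, a left `U`-module
algebra and a left `U`-comodule algebra, and action and coaction satisfy the Yetter-Drinfeld
condition. -/
structure YetterDrinfeldAlgebra (B : LeftBialgebroid k A U) (N : Type u) [Ring N] [Algebra k N]
    [Module U N] [IsScalarTower k U N] where
  coact : ofAction B.η N →ₗ[A] tens B.η (ofAction B.η N)
  coassoc : ∀ n, B.comulTens (ofAction B.η N) (coact n) = tensMap coact (coact n)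
  counit_coact : ∀ (n : N) {r : ℕ} (x : Fin r → U) (y : Fin r → N), IsRep (coact n) x y →
    ∑ i, src B.η (B.counit (x i)) • y i = n
  /-- The right `A`-action `n ◁ a = t(a) n` is the one induced by the coaction,
  `n a = ε(n₍₋₁₎ t(a)) n₍₀₎`. -/
  right_action : ∀ (a : A) (n : N) {r : ℕ} (x : Fin r → U) (y : Fin r → N), IsRep (coact n) x y →
    tgt B.η a • n = ∑ i, src B.η (B.counit (x i * tgt B.η a)) • y i
  src_smul_mul : ∀ (a : A) (m n : N), (src B.η a • m) * n = src B.η a • (m * n)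
  mul_tgt_smul : ∀ (a : A) (m n : N), m * (tgt B.η a • n) = tgt B.η a • (m * n)
  balanced : ∀ (a : A) (m n : N), m * (src B.η a • n) = (tgt B.η a • m) * n
  src_smul_one : ∀ a : A, src B.η a • (1 : N) = tgt B.η a • (1 : N)
  /-- `u (m n) = (u₍₁₎ m) (u₍₂₎ n)`. -/
  smul_mul : ∀ (u : U) (m n : N) {r : ℕ} (x y : Fin r → U), IsRep (B.comul u) x y →
    u • (m * n) = ∑ i, (x i • m) * (y i • n)
  smul_one : ∀ u : U, u • (1 : N) = src B.η (B.counit u) • (1 : N)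
  coact_one : coact (1 : N) = tmul B.η (ofAction B.η N) 1 (1 : N)
  /-- `Δ_N(m n) = m₍₋₁₎ n₍₋₁₎ ⊗ m₍₀₎ n₍₀₎`. -/
  coact_mul : ∀ (m n : N) {r r' : ℕ} (x : Fin r → U) (y : Fin r → N) (x' : Fin r' → U)
    (y' : Fin r' → N), IsRep (coact m) x y → IsRep (coact n) x' y' →
    coact (m * n) = ∑ i, ∑ j, tmul B.η (ofAction B.η N) (x i * x' j) (y i * y' j)
  /-- `(u₍₁₎ n)₍₋₁₎ u₍₂₎ ⊗ (u₍₁₎ n)₍₀₎ = u₍₁₎ n₍₋₁₎ ⊗ u₍₂₎ n₍₀₎`. -/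
  yetter_drinfeld : ∀ (u : U) (n : N) {r r' : ℕ} (x y : Fin r → U) (z : Fin r' → U)
    (n₀ : Fin r' → N) (l : Fin r → ℕ) (p : ∀ i, Fin (l i) → U) (q : ∀ i, Fin (l i) → N),
    IsRep (B.comul u) x y → IsRep (coact n) z n₀ →
    (∀ i, IsRep (coact (x i • n)) (p i) (q i)) →
    ∑ i, ∑ j, tmul B.η (ofAction B.η N) (p i j * y i) (q i j) =
      ∑ i, ∑ j, tmul B.η (ofAction B.η N) (x i * z j) (y i • n₀ j)

namespace YetterDrinfeldAlgebra

variable {N : Type u} [Ring N] [Algebra k N] [Module U N] [IsScalarTower k U N]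

/-- The underlying left comodule. -/
def toComodule (Y : YetterDrinfeldAlgebra B N) : LeftComodule B where
  toMod := ofAction B.η N
  coact := Y.coact
  coassoc := Y.coassoc
  counit_coact m _ x y h := Y.counit_coact m x y h

/-- Braided commutativity: `m n = (m₍₋₁₎ n) m₍₀₎`. -/
def IsBraidedCommutative (Y : YetterDrinfeldAlgebra B N) : Prop :=
  ∀ (m n : N) {r : ℕ} (x : Fin r → U) (y : Fin r → N), IsRep (Y.coact m) x y →
    m * n = ∑ i, (x i • n) * y i

/-- The elementary tensor `(u¹, …, uⁿ, m)` in `Cⁿ_co(U, N)`, where `uʲ⁺¹ = u j`. -/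
def tuple (Y : YetterDrinfeldAlgebra B N) (n : ℕ) (u : ℕ → U) (m : N) : Y.toComodule.C n :=
  elem B.η (ofAction B.η N) n u m

end YetterDrinfeldAlgebra

end Bialgebroid

/-! # Operads with multiplication and Gerstenhaber algebras -/

section Operad

variable {k : Type v} [CommRing k]

/-- A nonsymmetric operad of `k`-modules with partial compositions
`∘_i : O(p) ⊗ O(q) → O(p + q - 1)`; the index `n` with `p + q = n + 1` stands for `p + q - 1`. -/
structure Operad (k : Type v) [CommRing k] (O : ℕ → Type w) [∀ n, AddCommGroup (O n)]
    [∀ n, Module k (O n)] where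
  one : O 1
  circ : ∀ {p q n : ℕ} (_ : p + q = n + 1) (_ : ℕ), O p →ₗ[k] O q →ₗ[k] O n
  circ_eq_zero : ∀ {p q n : ℕ} (h : p + q = n + 1) (i : ℕ) (x : O p) (y : O q),
    p < i ∨ p = 0 → circ h i x y = 0
  /-- `(x ∘_i y) ∘_j z = (x ∘_j z) ∘_{i+r-1} y` for `j < i`. -/
  circ_circ_lt : ∀ {p q r n m l : ℕ} (h₁ : p + q = n + 1) (h₂ : n + r = m + 1)
    (h₃ : p + r = l + 1) (h₄ : l + q = m + 1) (i j : ℕ) (x : O p) (y : O q) (z : O r),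
    1 ≤ i → i ≤ p → 1 ≤ j → j < i →
    circ h₂ j (circ h₁ i x y) z = circ h₄ (i + r - 1) (circ h₃ j x z) y
  /-- `(x ∘_i y) ∘_j z = x ∘_i (y ∘_{j-i+1} z)` for `i ≤ j < q + i`. -/
  circ_circ_mid : ∀ {p q r n m l : ℕ} (h₁ : p + q = n + 1) (h₂ : n + r = m + 1)
    (h₃ : q + r = l + 1) (h₄ : p + l = m + 1) (i j : ℕ) (x : O p) (y : O q) (z : O r),
    1 ≤ i → i ≤ p → i ≤ j → j < q + i →
    circ h₂ j (circ h₁ i x y) z = circ h₄ i x (circ h₃ (j - i + 1) y z)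
  /-- `(x ∘_i y) ∘_j z = (x ∘_{j-q+1} z) ∘_i y` for `j ≥ q + i`. -/
  circ_circ_ge : ∀ {p q r n m l : ℕ} (h₁ : p + q = n + 1) (h₂ : n + r = m + 1)
    (h₃ : p + r = l + 1) (h₄ : l + q = m + 1) (i j : ℕ) (x : O p) (y : O q) (z : O r),
    1 ≤ i → i ≤ p → q + i ≤ j →
    circ h₂ j (circ h₁ i x y) z = circ h₄ i (circ h₃ (j + 1 - q) x z) y
  circ_one : ∀ {p : ℕ} (h : p + 1 = p + 1) (i : ℕ) (x : O p), 1 ≤ i → i ≤ p → circ h i x one = x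
  one_circ : ∀ {p : ℕ} (h : 1 + p = p + 1) (x : O p), circ h 1 one x = x

/-- An operad with multiplication `μ ∈ O(2)` and unit `e ∈ O(0)`. -/
structure OperadWithMul (k : Type v) [CommRing k] (O : ℕ → Type w) [∀ n, AddCommGroup (O n)]
    [∀ n, Module k (O n)] extends Operad k O where
  mul : O 2
  unit : O 0
  mul_assoc : circ (p := 2) (q := 2) (n := 3) rfl 1 mul mul =
    circ (p := 2) (q := 2) (n := 3) rfl 2 mul mul
  mul_unit_left : circ (p := 2) (q := 0) (n := 1) rfl 1 mul unit = one
  mul_unit_right : circ (p := 2) (q := 0) (n := 1) rfl 2 mul unit = one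

namespace OperadWithMul

variable {O : ℕ → Type w} [∀ n, AddCommGroup (O n)] [∀ n, Module k (O n)] (P : OperadWithMul k O)

/-- `x ∘̄ y = (-1)^{|p||q|} ∑_{i=1}^p (-1)^{|q||i|} x ∘_i y` with `|n| = n - 1`; the exponents are
written with `n + 1`, which has the same parity. -/
def circBar {p q n : ℕ} (h : p + q = n + 1) (x : O p) (y : O q) : O n :=
  (-1 : k) ^ ((p + 1) * (q + 1)) •
    ∑ i ∈ Finset.Icc 1 p, (-1 : k) ^ ((q + 1) * (i + 1)) • P.circ h i x y

/-- The bracket `{x, y} = x ∘̄ y - (-1)^{|p||q|} y ∘̄ x`. -/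
def bracket {p q n : ℕ} (h : p + q = n + 1) (x : O p) (y : O q) : O n :=
  P.circBar h x y - (-1 : k) ^ ((p + 1) * (q + 1)) • P.circBar ((Nat.add_comm q p).trans h) y x

/-- The cup product `x ⌣ y = (μ ∘₁ x) ∘_{p+1} y`. -/
def cup {p q : ℕ} (x : O p) (y : O q) : O (p + q) :=
  P.circ (n := p + q) (by omega) (p + 1) (P.circ (n := p + 1) (by omega) 1 P.mul x) y

end OperadWithMul

/-- A Gerstenhaber algebra structure on `V = ⨁_{p ≥ 0} Vᵖ`: a unital graded commutative product and
a graded Lie bracket of degree `-1` (`V^{-1} = 0`) satisfying the graded Leibniz rule. Signs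
`(-1)^{|p||q|}` with `|n| = n - 1` are written with `n + 1`. -/
structure GerstenhaberAlgebra (k : Type v) [CommRing k] (V : ℕ → Type w)
    [∀ n, AddCommGroup (V n)] [∀ n, Module k (V n)] where
  one : V 0
  mul : (⨁ n, V n) →ₗ[k] (⨁ n, V n) →ₗ[k] ⨁ n, V n
  bracket : (⨁ n, V n) →ₗ[k] (⨁ n, V n) →ₗ[k] ⨁ n, V n
  mul_deg : ∀ (p q : ℕ) (a : V p) (b : V q), ∃ c : V (p + q),
    mul (DirectSum.lof k ℕ V p a) (DirectSum.lof k ℕ V q b) = DirectSum.lof k ℕ V (p + q) c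
  bracket_deg : ∀ (p q n : ℕ) (_ : p + q = n + 1) (a : V p) (b : V q), ∃ c : V n,
    bracket (DirectSum.lof k ℕ V p a) (DirectSum.lof k ℕ V q b) = DirectSum.lof k ℕ V n c
  bracket_deg_zero : ∀ a b : V 0,
    bracket (DirectSum.lof k ℕ V 0 a) (DirectSum.lof k ℕ V 0 b) = 0
  one_mul : ∀ x, mul (DirectSum.lof k ℕ V 0 one) x = x
  mul_one : ∀ x, mul x (DirectSum.lof k ℕ V 0 one) = x
  mul_assoc : ∀ x y z, mul (mul x y) z = mul x (mul y z)
  mul_comm : ∀ (p q : ℕ) (a : V p) (b : V q),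
    mul (DirectSum.lof k ℕ V p a) (DirectSum.lof k ℕ V q b) =
      (-1 : k) ^ (p * q) • mul (DirectSum.lof k ℕ V q b) (DirectSum.lof k ℕ V p a)
  bracket_antisymm : ∀ (p q : ℕ) (a : V p) (b : V q),
    bracket (DirectSum.lof k ℕ V p a) (DirectSum.lof k ℕ V q b) =
      -((-1 : k) ^ ((p + 1) * (q + 1)) •
        bracket (DirectSum.lof k ℕ V q b) (DirectSum.lof k ℕ V p a))
  /-- Part of a graded Lie bracket when `2` is not invertible. -/
  bracket_self : ∀ (p : ℕ) (_ : Odd p) (a : V p),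
    bracket (DirectSum.lof k ℕ V p a) (DirectSum.lof k ℕ V p a) = 0
  /-- Part of a graded Lie bracket when `3` is not invertible. -/
  bracket_bracket_self : ∀ (p : ℕ) (_ : Even p) (a : V p),
    bracket (DirectSum.lof k ℕ V p a)
      (bracket (DirectSum.lof k ℕ V p a) (DirectSum.lof k ℕ V p a)) = 0
  jacobi : ∀ (p q r : ℕ) (a : V p) (b : V q) (c : V r),
    bracket (DirectSum.lof k ℕ V p a)
        (bracket (DirectSum.lof k ℕ V q b) (DirectSum.lof k ℕ V r c)) =
      bracket (bracket (DirectSum.lof k ℕ V p a) (DirectSum.lof k ℕ V q b))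
          (DirectSum.lof k ℕ V r c) +
        (-1 : k) ^ ((p + 1) * (q + 1)) • bracket (DirectSum.lof k ℕ V q b)
          (bracket (DirectSum.lof k ℕ V p a) (DirectSum.lof k ℕ V r c))
  leibniz : ∀ (p q r : ℕ) (c : V p) (a : V q) (b : V r),
    bracket (DirectSum.lof k ℕ V p c)
        (mul (DirectSum.lof k ℕ V q a) (DirectSum.lof k ℕ V r b)) =
      mul (bracket (DirectSum.lof k ℕ V p c) (DirectSum.lof k ℕ V q a))
          (DirectSum.lof k ℕ V r b) +
        (-1 : k) ^ ((p + 1) * q) • mul (DirectSum.lof k ℕ V q a)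
          (bracket (DirectSum.lof k ℕ V p c) (DirectSum.lof k ℕ V r b))

/-- A family of linear isomorphisms `Vⁿ ≃ Wⁿ` is an isomorphism of Gerstenhaber algebras. -/
structure IsGerstenhaberIso {V W : ℕ → Type w} [∀ n, AddCommGroup (V n)] [∀ n, Module k (V n)]
    [∀ n, AddCommGroup (W n)] [∀ n, Module k (W n)] (G : GerstenhaberAlgebra k V)
    (G' : GerstenhaberAlgebra k W) (φ : ∀ n, V n ≃ₗ[k] W n) : Prop where
  map_one : φ 0 G.one = G'.one
  map_mul : ∀ x y, DirectSum.lmap (fun n => (φ n).toLinearMap) (G.mul x y) =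
    G'.mul (DirectSum.lmap (fun n => (φ n).toLinearMap) x)
      (DirectSum.lmap (fun n => (φ n).toLinearMap) y)
  map_bracket : ∀ x y, DirectSum.lmap (fun n => (φ n).toLinearMap) (G.bracket x y) =
    G'.bracket (DirectSum.lmap (fun n => (φ n).toLinearMap) x)
      (DirectSum.lmap (fun n => (φ n).toLinearMap) y)

end Operad

/-! # The operad structure on the coring cochain complex -/

section Structure

variable {k : Type v} {A U : Type u} [CommRing k] [Ring A] [Algebra k A] [Ring U] [Algebra k U]
variable {B : LeftBialgebroid k A U}

/-- The `U`-entries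
`(u¹, …, uⁱ⁻¹, x₁ v¹, …, x_q v^q, a₁ uⁱ⁺¹, …, a_{p-i} uᵖ)`; all sequences are indexed from `0`. -/
def insertWord (i q : ℕ) (u x v a : ℕ → U) : ℕ → U := fun j =>
  if j < i - 1 then u j
  else if j < i - 1 + q then x (j - (i - 1)) * v (j - (i - 1))
  else a (j - (i - 1) - q) * u (j + 1 - q)

variable {N : Type u} [Ring N] [Algebra k N] [Module U N] [IsScalarTower k U N]

/-- The partial compositions `∘_i`, `1 ≤ i ≤ p`, of an operad structure on `C_co(U, N)` are the
insertions
`(u¹, …, uᵖ, m) ∘_i (v¹, …, v^q, m')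
  = (u¹, …, uⁱ⁻¹, uⁱ₍₁₎ v¹, …, uⁱ₍q₎ v^q, (uⁱ₍q+1₎ m')₍₋ₚ₊ᵢ₎ uⁱ⁺¹, …, (uⁱ₍q+1₎ m')₍₋₁₎ uᵖ,
      (uⁱ₍q+1₎ m')₍₀₎ m)`,
for all ways of writing the iterated coproduct of `uⁱ` as `∑ₛ xₛ ⊗ yₛ` with `xₛ` of length `q`, and
the iterated coaction of `yₛ m'` as `∑ⱼ aₛⱼ ⊗ bₛⱼ` with `aₛⱼ` of length `p - i`. -/
def IsInsertion (Y : YetterDrinfeldAlgebra B N) (P : Operad k (fun n => Y.toComodule.C n)) : Prop :=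
  ∀ {p q n : ℕ} (h : p + q = n + 1) (i : ℕ) (_ : 1 ≤ i) (_ : i ≤ p)
    (u v : ℕ → U) (m m' : N)
    (r : ℕ) (x : Fin r → ℕ → U) (y : Fin r → U)
    (_ : (regularComodule B).iterCoact q (u (i - 1)) =
      ∑ s, elem B.η (regularMod B.η) q (x s) (y s))
    (l : Fin r → ℕ) (a : ∀ s, Fin (l s) → ℕ → U) (b : ∀ s, Fin (l s) → N)
    (_ : ∀ s, Y.toComodule.iterCoact (p - i) (y s • m') =
      ∑ j, Y.tuple (p - i) (a s j) (b s j)),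
    P.circ h i (Y.tuple p u m) (Y.tuple q v m') =
      ∑ s, ∑ j, Y.tuple n (insertWord i q u (x s) v (a s j)) (b s j * m)

/-- A Gerstenhaber algebra structure on the coring cohomology is the one induced by an operad with
multiplication on the cochains: unit, product and bracket of classes of cocycles are the classes of
the unit, the cup product and the bracket of these cocycles. -/
structure IsInducedBy (M : LeftComodule B) (P : OperadWithMul k (fun n => M.C n))
    (G : GerstenhaberAlgebra k M.H) : Prop where
  one : ∃ he : P.unit ∈ M.cocycles 0, G.one = M.cls 0 P.unit he
  mul : ∀ (p q : ℕ) (x : M.C p) (y : M.C q) (hx : x ∈ M.cocycles p) (hy : y ∈ M.cocycles q),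
    ∃ hz : P.cup x y ∈ M.cocycles (p + q),
      G.mul (DirectSum.lof k ℕ M.H p (M.cls p x hx)) (DirectSum.lof k ℕ M.H q (M.cls q y hy)) =
        DirectSum.lof k ℕ M.H (p + q) (M.cls (p + q) (P.cup x y) hz)
  bracket : ∀ (p q n : ℕ) (h : p + q = n + 1) (x : M.C p) (y : M.C q) (hx : x ∈ M.cocycles p)
    (hy : y ∈ M.cocycles q), ∃ hz : P.bracket h x y ∈ M.cocycles n,
      G.bracket (DirectSum.lof k ℕ M.H p (M.cls p x hx))
          (DirectSum.lof k ℕ M.H q (M.cls q y hy)) =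
        DirectSum.lof k ℕ M.H n (M.cls n (P.bracket h x y) hz)

end Structure

/-! # Cotor -/

section Cotor

variable {k : Type v} {A U : Type u} [CommRing k] [Ring A] [Algebra k A] [Ring U] [Algebra k U]
variable {B : LeftBialgebroid k A U}

/-- A morphism of left comodules. -/
structure ComoduleHom (M M' : LeftComodule B) where
  toLin : M.toMod →ₗ[A] M'.toMod
  comm : ∀ m, M'.coact (toLin m) = tensMap toLin (M.coact m)

/-- An injective left comodule: morphisms into it extend along injective morphisms. -/
def LeftComodule.IsInjective (I : LeftComodule B) : Prop :=
  ∀ (X X' : LeftComodule B) (i : ComoduleHom X X') (g : ComoduleHom X I),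
    Function.Injective i.toLin → ∃ g' : ComoduleHom X' I, ∀ x, g'.toLin (i.toLin x) = g.toLin x

/-- An injective resolution `0 → M → I⁰ → I¹ → ⋯` in the category of left comodules. -/
structure InjectiveResolution (M : LeftComodule B) where
  I : ℕ → LeftComodule B
  d : ∀ n, ComoduleHom (I n) (I (n + 1))
  aug : ComoduleHom M (I 0)
  injective : ∀ n, (I n).IsInjective
  aug_injective : Function.Injective aug.toLin
  exact_zero : Function.Exact aug.toLin (d 0).toLin
  exact_succ : ∀ n, Function.Exact (d n).toLin (d (n + 1)).toLin

/-- The relations `a' a ⊗ x = a' ⊗ a x` in `A ⊗_k X`. -/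
def baseRel (X : LeftMod k A) : Submodule k (A ⊗[k] X) :=
  Submodule.span k {w | ∃ (a' a : A) (x : X), w = (a' * a) ⊗ₜ[k] x - a' ⊗ₜ[k] (a • x)}

/-- The tensor product `A ⊗_A X`. -/
def BaseTens (X : LeftMod k A) : Type u := (A ⊗[k] X) ⧸ baseRel X

instance (X : LeftMod k A) : AddCommGroup (BaseTens X) :=
  inferInstanceAs (AddCommGroup ((A ⊗[k] X) ⧸ baseRel X))

instance (X : LeftMod k A) : Module k (BaseTens X) :=
  inferInstanceAs (Module k ((A ⊗[k] X) ⧸ baseRel X))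

/-- The elementary tensor `a ⊗ x` in `A ⊗_A X`. -/
def baseMk (X : LeftMod k A) : A →ₗ[k] X →ₗ[k] BaseTens X :=
  (TensorProduct.mk k A X).compr₂ (baseRel X).mkQ

lemma baseMk_mul (X : LeftMod k A) (a' a : A) (x : X) :
    baseMk X (a' * a) x = baseMk X a' (a • x) :=
  (Submodule.Quotient.eq _).2 (Submodule.subset_span ⟨a', a, x, rfl⟩)

/-- The map on `A ⊗_A X` induced by an `A`-balanced map. -/
def baseLift {Y : Type u} [AddCommGroup Y] [Module k Y] (X : LeftMod k A)
    (f : A →ₗ[k] X →ₗ[k] Y) (hf : ∀ a' a x, f (a' * a) x = f a' (a • x)) : BaseTens X →ₗ[k] Y :=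
  (baseRel X).liftQ (TensorProduct.lift f) (by
    refine Submodule.span_le.2 ?_
    rintro _ ⟨a', a, x, rfl⟩
    simp [hf])

/-- `id_A ⊗ f : A ⊗_A X → A ⊗_A X'`. -/
def baseMap {X X' : LeftMod k A} (f : X →ₗ[A] X') : BaseTens X →ₗ[k] BaseTens X' :=
  baseLift X ((baseMk X').compl₂ (f.restrictScalars k)) (fun a' a x => by simp [baseMk_mul])

/-- The canonical right coaction `A → A ⊗_A U ≅ U`, `a ↦ 1 ⊗ t(a)`, tensored with `X`:
the map `A ⊗_A X → A ⊗_A (U ⊗_A X)`, `a ⊗ x ↦ 1 ⊗ (t(a) ⊗ x)`. -/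
def baseCoact (η : A ⊗[k] Aᵐᵒᵖ →ₐ[k] U) (X : LeftMod k A) : BaseTens X →ₗ[k] BaseTens (tens η X) :=
  baseLift X
    (((tmul η X).compr₂ (baseMk (tens η X) 1)).comp
      ((tgtOp η).toLinearMap.comp (MulOpposite.opLinearEquiv k).toLinearMap))
    (fun a' a x => by
      change baseMk (tens η X) 1 (tmul η X (tgtOp η (MulOpposite.op (a' * a))) x) =
        baseMk (tens η X) 1 (tmul η X (tgtOp η (MulOpposite.op a')) (a • x))
      rw [MulOpposite.op_mul, map_mul]
      exact congrArg _ (tgt_mul_tmul X a _ x))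

/-- The cotensor product `A □_U M`: the equaliser of `ρ_A ⊗ id` and `id ⊗ Δ_M` in `A ⊗_A M`. -/
def cotensor (M : LeftComodule B) : Submodule k (BaseTens M.toMod) :=
  LinearMap.eqLocus (baseCoact B.η M.toMod) (baseMap M.coact)

namespace InjectiveResolution

variable {M : LeftComodule B} (R : InjectiveResolution M)

/-- The `n`-cocycles of the complex `A □_U I`. -/
def cocycles (n : ℕ) : Submodule k (BaseTens (R.I n).toMod) :=
  cotensor (R.I n) ⊓ LinearMap.ker (baseMap (R.d n).toLin)

/-- The `n`-coboundaries of the complex `A □_U I`. -/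
def coboundaries : (n : ℕ) → Submodule k (BaseTens (R.I n).toMod)
  | 0 => ⊥
  | n + 1 => (cotensor (R.I n)).map (baseMap (R.d n).toLin)

/-- `Cotorⁿ_U(A, M)`, the `n`-th right derived functor of `A □_U -`, computed by the injective
resolution: the `n`-th cohomology of `A □_U I`. -/
abbrev Cotor (n : ℕ) : Type u := R.cocycles n ⧸ (R.coboundaries n).submoduleOf (R.cocycles n)

/-- A morphism of complexes of comodules, under `M`, from the cobar resolution
`M → U ⊗_A M → U ⊗_A U ⊗_A M → ⋯` to the injective resolution. The cobar resolution has the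
comodule `U ⊗_A Cⁿ_co(U, M) = Cⁿ⁺¹_co(U, M)` with coaction `Δ ⊗ id` in degree `n`, differential
`z ↦ 1 ⊗ z - β(z) = ∑_{i=1}^{n+2} (-1)^{i-1} δ_i(z)` and augmentation `Δ_M`. -/
structure Comparison where
  f : ∀ n, M.C (n + 1) →ₗ[A] (R.I n).toMod
  colinear : ∀ n (z : M.C (n + 1)), (R.I n).coact (f n z) = tensMap (f n) (B.comulTens (M.C n) z)
  aug : ∀ m, f 0 (M.coact m) = R.aug.toLin m
  comm : ∀ n (z : M.C (n + 1)),
    (R.d n).toLin (f n z) = f (n + 1) (M.coface (n + 1) 0 z - M.diff (n + 1) z)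

/-- A family of isomorphisms `Hⁿ_co(U, M) ≅ Cotorⁿ_U(A, M)` is the canonical one: a comparison
morphism `f` from the cobar resolution exists, and for every one of them the class of a cocycle `z`
is sent to the class of `1 ⊗ f(1 ⊗ z)`. -/
def IsCanonical (φ : ∀ n, M.H n ≃ₗ[k] R.Cotor n) : Prop :=
  Nonempty R.Comparison ∧
  ∀ (F : R.Comparison) (n : ℕ) (z : M.C n) (hz : z ∈ M.cocycles n),
    ∃ hw : baseMk (R.I n).toMod 1 (F.f n (M.coface n 0 z)) ∈ R.cocycles n,
      φ n (M.cls n z hz) = Submodule.Quotient.mk ⟨_, hw⟩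

end InjectiveResolution

end Cotor

end

end BialgebroidCohomology

open BialgebroidCohomology

-- The direct sum `Tot` of all cochain spaces is additively spanned by iterated tensors built from
-- `base n` (n in N) and `cons u φ` = u ⊗ φ. Operations are defined, and identities proved, by
-- recursion on this presentation. `exists_rec` is the recursion principle: values on N and a rule
-- for u ⊗ φ determine a map, as soon as they respect t(a)u ⊗ φ = u ⊗ aφ. Both U and N act
-- diagonally on `Tot`.
--
-- Operad. Let φ ⌣ ψ be concatenation, the coefficient of φ acting diagonally on ψ; this makes `Tot`
-- an associative algebra. Insertions are then given by (u ⊗ φ) ∘₁ ψ = (uψ) ⌣ φ and (u ⊗ φ) ∘_{i+1}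
-- ψ = u ⊗ (φ ∘_i ψ) for i ≥ 1. Two facts carry the axioms. `Tot` is a U-module algebra
-- (`uAct_cup`), which is the Yetter-Drinfeld condition via `uAct_nAct`; and (n₍₋₁₎φ) ⌣ (n₍₀₎ψ) =
-- n(φ ⌣ ψ) (`cup_braided`), which is braided commutativity. They say that U and N act on φ ∘_i ψ
-- through φ alone (`uAct_ins`, `ins_nAct`). Hence inserting into a product φ ⌣ ψ means inserting
-- into φ or into ψ (`ins_cup_left`, `ins_cup_right`), and the operad axioms follow by induction on
-- the outermost cochain.
--
-- Gerstenhaber algebra. For a sign ε, the sum `pre ε φ ψ` = Σ ε^{i-1} φ ∘_i ψ is a skew derivation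
-- of the cup product in φ (`pre_cup`) and satisfies a graded pre-Lie identity (`pre_pre`); the
-- bracket is its graded commutator, whence Jacobi. With id = (1,1) and μ = id ⌣ id one has, for φ
-- of degree p, βφ = id ⌣ φ - (-1)^p φ ⌣ id - `pre (-1) φ μ` = {μ, φ}, so β is a derivation of both
-- operations. On cocycles, φ ⌣ ψ and ±ψ ⌣ φ differ by the boundary of a multiple of `pre φ ψ`, and
-- the failure of {γ, ·} to be a derivation of the cup product is the boundary of a multiple of
-- `brace γ α β`, the signed sum of simultaneous insertions of α and β into γ.
--
-- Cotor. In the double complex Cᵖ(U, I^q) the q-direction is exact because U is flat, and the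
-- p-direction because the coaction of an injective comodule splits, which contracts its cochain
-- complex. Chasing through the grid identifies the cohomology of N on one edge with that of A □ I
-- on the other. For a comparison morphism f the elements id^{⊗p} ⊗ f_q∂ of a cocycle form a
-- staircase through the grid, which computes the isomorphism and shows that the formula holds for
-- every f.

attribute [reducible] BialgebroidCohomology.cochain BialgebroidCohomology.regularMod
attribute [reducible] BialgebroidCohomology.ofAction BialgebroidCohomology.regularComodule
attribute [reducible] BialgebroidCohomology.YetterDrinfeldAlgebra.toComodule

namespace BialgebroidCohomology

noncomputable section

/-! # Balanced maps and the functor `U ⊗_A -` -/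

section TensorLemmas

variable {k : Type v} {A U : Type u} [CommRing k] [Ring A] [Algebra k A] [Ring U] [Algebra k U]
variable {η : A ⊗[k] Aᵐᵒᵖ →ₐ[k] U}

/-- The `k`-linear map on `U ⊗_A X` induced by an `A`-balanced map. -/
def tensLiftK {X : LeftMod k A} {P : Type w} [AddCommGroup P] [Module k P]
    (f : U →ₗ[k] X →ₗ[k] P) (hbal : ∀ a u x, f (tgt η a * u) x = f u (a • x)) :
    tens η X →ₗ[k] P :=
  (tensRel η X).liftQ (TensorProduct.lift f) (by
    refine Submodule.span_le.2 ?_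
    rintro _ ⟨a, u, x, rfl⟩
    simp [hbal])

lemma tensLiftK_tmul {X : LeftMod k A} {P : Type w} [AddCommGroup P] [Module k P]
    (f : U →ₗ[k] X →ₗ[k] P) (hbal) (u : U) (x : X) :
    tensLiftK (η := η) f hbal (tmul η X u x) = f u x := by
  change TensorProduct.lift f (u ⊗ₜ[k] x) = _
  simp

/-- Additive maps on `U ⊗_A X` agreeing on elementary tensors are equal. -/
lemma tens_hom_ext {X : LeftMod k A} {P F G : Type*} [AddCommGroup P]
    [FunLike F (tens η X) P] [AddMonoidHomClass F (tens η X) P]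
    [FunLike G (tens η X) P] [AddMonoidHomClass G (tens η X) P]
    (f : F) (g : G) (h : ∀ u x, f (tmul η X u x) = g (tmul η X u x)) (z : tens η X) :
    f z = g z := by
  induction z using tens_induction with
  | ht u x => exact h u x
  | ha z z' h h' => rw [map_add, map_add, h, h']

lemma tensMap_rep {X Y : LeftMod k A} (f : X →ₗ[A] Y) {w : tens η X} {r : ℕ} {x : Fin r → U}
    {y : Fin r → X} (h : IsRep w x y) : IsRep (tensMap f w) x (fun i => f (y i)) := by
  unfold IsRep at *
  subst h
  rw [map_sum]
  exact Finset.sum_congr rfl fun i _ => tensMap_tmul ..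

lemma tensMap_id {X : LeftMod k A} (z : tens η X) : tensMap LinearMap.id z = z :=
  tens_hom_ext (tensMap LinearMap.id) (LinearMap.id : tens η X →ₗ[A] tens η X)
    (fun u x => tensMap_tmul _ u x) z

lemma tensMap_comp {X Y Z : LeftMod k A} (g : Y →ₗ[A] Z) (f : X →ₗ[A] Y) (z : tens η X) :
    tensMap (g.comp f) z = tensMap g (tensMap f z) :=
  tens_hom_ext (tensMap (g.comp f)) ((tensMap g).comp (tensMap f))
    (fun u x => by simp [tensMap_tmul]) z

lemma tensMap_add {X Y : LeftMod k A} (f g : X →ₗ[A] Y) (z : tens η X) :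
    tensMap (f + g) z = tensMap f z + tensMap g z :=
  tens_hom_ext (tensMap (f + g)) (tensMap f + tensMap g)
    (fun u x => by simp [tensMap_tmul]) z

lemma tensMap_sub {X Y : LeftMod k A} (f g : X →ₗ[A] Y) (z : tens η X) :
    tensMap (f - g) z = tensMap f z - tensMap g z :=
  tens_hom_ext (tensMap (f - g)) (tensMap f - tensMap g)
    (fun u x => by simp [tensMap_tmul]) z

lemma tensMap_zero {X Y : LeftMod k A} (z : tens η X) :
    tensMap (0 : X →ₗ[A] Y) z = 0 :=
  tens_hom_ext (tensMap (0 : X →ₗ[A] Y)) (0 : tens η X →ₗ[A] tens η Y)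
    (fun u x => by simp [tensMap_tmul]) z

lemma tensMap_sum {X Y : LeftMod k A} {ι : Type*} (s : Finset ι) (f : ι → X →ₗ[A] Y)
    (z : tens η X) : tensMap (∑ i ∈ s, f i) z = ∑ i ∈ s, tensMap (f i) z := by
  classical
  induction s using Finset.induction_on with
  | empty => simp [tensMap_zero]
  | insert i s hi ih => rw [Finset.sum_insert hi, Finset.sum_insert hi, tensMap_add, ih]

lemma tensMap_zsmul {X Y : LeftMod k A} (c : ℤ) (f : X →ₗ[A] Y) (z : tens η X) :
    tensMap (c • f) z = c • tensMap f z :=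
  tens_hom_ext (tensMap (c • f)) (c • tensMap f)
    (fun u x => by simp [tensMap_tmul]) z

end TensorLemmas

/-! ### The cobar complex: β = δ₀ - ∂ and β² = 0. -/

section Cobar

variable {k : Type v} {A U : Type u} [CommRing k] [Ring A] [Algebra k A] [Ring U] [Algebra k U]
variable {B : LeftBialgebroid k A U}

namespace LeftBialgebroid

variable (B)

lemma comulTens_rep (X : LeftMod k A) {u : U} (z : X) {r : ℕ} {x y : Fin r → U}
    (h : IsRep (B.comul u) x y) :
    B.comulTens X (tmul B.η X u z) = ∑ i, tmul B.η (tens B.η X) (x i) (tmul B.η X (y i) z) := by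
  rw [comulTens_tmul]
  exact tensMap_rep _ h

lemma comulTens_natural {X Y : LeftMod k A} (f : X →ₗ[A] Y) (z : tens B.η X) :
    B.comulTens Y (tensMap f z) = tensMap (tensMap f) (B.comulTens X z) := by
  refine tens_hom_ext ((B.comulTens Y).comp (tensMap f)) ((tensMap (tensMap f)).comp
    (B.comulTens X)) (fun u x => ?_) z
  obtain ⟨r, y, y', h⟩ := exists_rep (B.comul u)
  simp only [LinearMap.comp_apply, tensMap_tmul]
  rw [B.comulTens_rep Y _ h, B.comulTens_rep X _ h, map_sum]
  simp only [tensMap_tmul]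

/-- Coassociativity of the cofree comodule `U ⊗_A X`. -/
lemma comulTens_comulTens (X : LeftMod k A) (z : tens B.η X) :
    B.comulTens (tens B.η X) (B.comulTens X z) = tensMap (B.comulTens X) (B.comulTens X z) := by
  refine tens_hom_ext ((B.comulTens (tens B.η X)).comp (B.comulTens X))
    ((tensMap (B.comulTens X)).comp (B.comulTens X)) (fun u z => ?_) z
  obtain ⟨r, x, y, h⟩ := exists_rep (B.comul u)
  -- Coassociativity of Δ lives in U ⊗ U ⊗ U; applying id ⊗ id ⊗ (· ⊗ z) moves it to U ⊗ U ⊗ (U ⊗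
  -- X).
  have key := congrArg (tensMap (tensMap (tmulRight B.η X z))) (B.coassoc u x y h)
  simp only [LinearMap.comp_apply]
  rw [B.comulTens_rep X z h, map_sum, map_sum]
  rw [map_sum] at key
  calc _ = ∑ i, tensMap (tensMap (tmulRight B.η X z))
        (tensMap (tmulRight B.η (regularMod B.η) (y i)) (B.comul (x i))) := by
        refine Finset.sum_congr rfl fun i _ => ?_
        rw [comulTens_tmul, ← tensMap_comp]
        congr 2
    _ = _ := key
    _ = _ := by
        rw [← tensMap_comp, (tensMap_rep _ h : _ = _)]
        refine Finset.sum_congr rfl fun i _ => ?_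
        rw [tensMap_tmul, comulTens_tmul]
        rfl

/-- The `A`-linear map `ε ⊗ id : U ⊗_A X → X`. -/
def counitTens (X : LeftMod k A) : tens B.η X →ₗ[A] X :=
  tensLift
    (((Algebra.lsmul k k X.carrier : A →ₐ[k] Module.End k X.carrier).toLinearMap).comp B.counit)
    (fun a u x => by
      change B.counit (tgt B.η a * u) • x = B.counit u • a • x
      rw [B.counit_tgt, mul_smul])
    (fun a u x => by
      change B.counit (src B.η a * u) • x = a • B.counit u • x
      rw [B.counit_src, mul_smul])

lemma counitTens_tmul (X : LeftMod k A) (u : U) (x : X) :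
    B.counitTens X (tmul B.η X u x) = B.counit u • x := by
  exact tensLift_tmul _ _ _ u x

lemma counitTens_natural {X Y : LeftMod k A} (f : X →ₗ[A] Y) (z : tens B.η X) :
    B.counitTens Y (tensMap f z) = f (B.counitTens X z) :=
  tens_hom_ext ((B.counitTens Y).comp (tensMap f)) (f.comp (B.counitTens X))
    (fun u x => by simp [tensMap_tmul, counitTens_tmul]) z

lemma counitTens_comulTens (X : LeftMod k A) (z : tens B.η X) :
    B.counitTens (tens B.η X) (B.comulTens X z) = z := by
  refine tens_hom_ext ((B.counitTens (tens B.η X)).comp (B.comulTens X))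
    (LinearMap.id : tens B.η X →ₗ[A] tens B.η X) (fun u z => ?_) z
  obtain ⟨r, x, y, h⟩ := exists_rep (B.comul u)
  simp only [LinearMap.comp_apply, LinearMap.id_apply]
  rw [B.comulTens_rep X z h, map_sum]
  simp only [counitTens_tmul, smul_tmul]
  conv_rhs => rw [← B.counit_comul_left u x y h]
  rw [map_sum, LinearMap.sum_apply]

/-- The scalar ε(u₍₂₎) crosses the balanced tensor as t(ε(u₍₂₎)), so this is the right counit law,
just as the previous lemma is the left one. -/
lemma tensMap_counitTens_comulTens (X : LeftMod k A) (z : tens B.η X) :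
    tensMap (B.counitTens X) (B.comulTens X z) = z := by
  refine tens_hom_ext ((tensMap (B.counitTens X)).comp (B.comulTens X))
    (LinearMap.id : tens B.η X →ₗ[A] tens B.η X) (fun u z => ?_) z
  obtain ⟨r, x, y, h⟩ := exists_rep (B.comul u)
  simp only [LinearMap.comp_apply, LinearMap.id_apply]
  rw [B.comulTens_rep X z h, map_sum]
  simp only [tensMap_tmul, counitTens_tmul, ← tgt_mul_tmul]
  conv_rhs => rw [← B.counit_comul_right u x y h]
  rw [map_sum, LinearMap.sum_apply]

end LeftBialgebroid

namespace LeftComodule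

variable (M : LeftComodule B)

lemma counitTens_coact (m : M.toMod) : B.counitTens M.toMod (M.coact m) = m := by
  obtain ⟨r, x, y, h⟩ := exists_rep (M.coact m)
  conv_lhs => rw [(h : _ = _)]
  rw [map_sum]
  simp only [B.counitTens_tmul]
  exact M.counit_coact m x y h

/-- The `A`-linear part `∑_{j=0}^n (-1)ʲ δ_{j+1}` of the coboundary, so that `β = δ₀ - ∂`. -/
def cobar : (n : ℕ) → (M.C n →ₗ[A] M.C (n + 1))
  | 0 => M.coact
  | n + 1 => B.comulTens (M.C n) - tensMap (cobar n)

/-- In the recursion ∂ = Δ ⊗ id - id ⊗ ∂ the first term is the coface on the leading factor; the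
second shifts all other cofaces by one place, hence the sign. -/
lemma cobar_eq_sum (n : ℕ) (z : M.C n) :
    M.cobar n z = ∑ j ∈ Finset.range (n + 1), (-1 : ℤ) ^ j • M.cofaceSucc n j z := by
  induction n with
  | zero => simp [cobar, cofaceSucc]
  | succ n ih =>
    have ih' : M.cobar n = ∑ j ∈ Finset.range (n + 1), (-1 : ℤ) ^ j • M.cofaceSucc n j := by
      ext z; simp [ih]
    rw [Finset.sum_range_succ', cobar, ih', LinearMap.sub_apply, tensMap_sum]
    simp only [tensMap_zsmul, cofaceSucc, pow_zero, one_smul, pow_succ, mul_neg, mul_one, neg_smul,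
      Finset.sum_neg_distrib]
    abel

/-- The coboundary carries its signs in k, the recursion for ∂ carries them in ℤ. -/
lemma neg_one_pow_smul_eq {P : Type*} [AddCommGroup P] [Module k P] (n : ℕ) (x : P) :
    (-1 : k) ^ n • x = (-1 : ℤ) ^ n • x := by
  rcases Nat.even_or_odd n with h | h <;> simp [h.neg_one_pow]

lemma diff_apply (n : ℕ) (z : M.C n) :
    M.diff n z = tmul B.η (M.C n) 1 z - M.cobar n z := by
  rw [diff, LinearMap.sum_apply, Finset.sum_range_succ', cobar_eq_sum, sub_eq_neg_add,
    ← Finset.sum_neg_distrib]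
  congr 1
  · refine Finset.sum_congr rfl fun j _ => ?_
    rw [LinearMap.smul_apply, neg_one_pow_smul_eq, pow_succ, mul_neg_one, neg_smul]
    rfl
  · rw [pow_zero, one_smul]
    rfl

lemma cobar_succ_apply (n : ℕ) (z : M.C (n + 1)) :
    M.cobar (n + 1) z = B.comulTens (M.C n) z - tensMap (M.cobar n) z := rfl

/-- Expanding both recursions, the terms with two coproducts cancel by coassociativity of the cofree
comodule, the mixed ones by naturality of Δ ⊗ id, and the remaining one vanishes by induction. -/
lemma cobar_cobar (n : ℕ) (z : M.C n) : M.cobar (n + 1) (M.cobar n z) = 0 := by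
  induction n with
  | zero =>
    rw [cobar_succ_apply]
    exact sub_eq_zero.2 (M.coassoc z)
  | succ n ih =>
    have ih' : (M.cobar (n + 1)).comp (M.cobar n) = 0 := by ext z; exact ih z
    have h1 : tensMap (η := B.η) (M.cobar (n + 1)) (tensMap (M.cobar n) z) = 0 := by
      rw [← tensMap_comp, ih', tensMap_zero]
    rw [cobar_succ_apply, cobar_succ_apply, map_sub, map_sub, h1]
    have h2 := B.comulTens_natural (M.cobar n) z
    have h3 := B.comulTens_comulTens (M.C n) z
    have h4 : tensMap (η := B.η) (M.cobar (n + 1)) (B.comulTens (M.C n) z) =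
        tensMap (B.comulTens (M.C n)) (B.comulTens (M.C n) z) -
          tensMap (tensMap (M.cobar n)) (B.comulTens (M.C n) z) := by
      rw [cobar, tensMap_sub]
    erw [h2, h3, h4]
    abel

/-- Because Δ(1) = 1 ⊗ 1, prepending 1 turns β into ∂; together with ∂² = 0 this gives β² = 0. -/
lemma cobar_one_tmul (n : ℕ) (z : M.C n) :
    M.cobar (n + 1) (tmul B.η (M.C n) 1 z) = tmul B.η (M.C (n + 1)) 1 (M.diff n z) := by
  rw [cobar_succ_apply, tensMap_tmul, diff_apply, map_sub, B.comulTens_tmul]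
  congr 1
  refine (congrArg _ B.comul_one).trans ?_
  exact tensMap_tmul ..

lemma diff_diff (n : ℕ) (z : M.C n) : M.diff (n + 1) (M.diff n z) = 0 := by
  have h := M.cobar_one_tmul n z
  rw [diff_apply (n := n + 1), ← h, ← map_sub, diff_apply, sub_sub_cancel, cobar_cobar]

end LeftComodule

end Cobar

end

end BialgebroidCohomology

namespace BialgebroidCohomology

noncomputable section

/-! # Comodule algebras and their modules -/

section ComoduleAlgebra

variable {k : Type v} {A U : Type u} [CommRing k] [Ring A] [Algebra k A] [Ring U] [Algebra k U]

/-- A left comodule algebra over a left bialgebroid: a left comodule with a multiplication and a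
unit, such that the coaction is multiplicative with values in the Sweedler-Takeuchi product. Only
the part of the structure which is needed to tensor modules over it is recorded. -/
structure ComoduleAlgebra (B : LeftBialgebroid k A U) extends LeftComodule B where
  one : toMod
  mul : toMod →ₗ[k] toMod →ₗ[k] toMod
  takeuchi : ∀ (a : A) (z : toMod) {r : ℕ} (x : Fin r → U) (y : Fin r → toMod),
    IsRep (coact z) x y → ∑ i, tmul B.η toMod (x i * tgt B.η a) (y i) =
      ∑ i, tmul B.η toMod (x i) (mul (y i) (a • one))
  coact_one : coact one = tmul B.η toMod 1 one
  coact_mul : ∀ (z z' : toMod) {r r' : ℕ} (x : Fin r → U) (y : Fin r → toMod) (x' : Fin r' → U)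
    (y' : Fin r' → toMod), IsRep (coact z) x y → IsRep (coact z') x' y' →
    coact (mul z z') = ∑ i, ∑ j, tmul B.η toMod (x i * x' j) (mul (y i) (y' j))

variable {B : LeftBialgebroid k A U}

namespace ComoduleAlgebra

/-- A left module over a comodule algebra on a left `A`-module. -/
structure Action (Z : ComoduleAlgebra B) (X : LeftMod k A) where
  act : Z.toMod →ₗ[k] X →ₗ[k] X
  one_act : ∀ x, act Z.one x = x
  mul_act : ∀ z z' x, act (Z.mul z z') x = act z (act z' x)
  smul_act : ∀ (a : A) z x, act (a • z) x = a • act z x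

variable {Z : ComoduleAlgebra B} {X : LeftMod k A} (ρ : Z.Action X)

namespace Action

lemma act_smul (a : A) (z : Z.toMod) (x : X) : ρ.act (Z.mul z (a • Z.one)) x = ρ.act z (a • x) := by
  rw [ρ.mul_act, ρ.smul_act, ρ.one_act]

/-- The map `(v ⊗ z, u, x) ↦ v u ⊗ z x`. -/
def mulTens : tens B.η Z.toMod →ₗ[k] U →ₗ[k] X →ₗ[k] tens B.η X :=
  tensLiftK (LinearMap.mk₂ k (fun v z => (tmul B.η X).compl₁₂ (LinearMap.mulLeft k v) (ρ.act z))
      (fun v v' z => by ext u x; simp [add_mul])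
      (fun c v z => by ext u x; simp)
      (fun v z z' => by ext u x; simp)
      (fun c v z => by ext u x; simp))
    (fun a v z => by
      ext u x
      change tmul B.η X (tgt B.η a * v * u) (ρ.act z x) = tmul B.η X (v * u) (ρ.act (a • z) x)
      rw [mul_assoc, tgt_mul_tmul, ρ.smul_act])

lemma mulTens_tmul (v : U) (z : Z.toMod) (u : U) (x : X) :
    ρ.mulTens (tmul B.η Z.toMod v z) u x = tmul B.η X (v * u) (ρ.act z x) := by
  rw [mulTens, tensLiftK_tmul]; rfl

lemma mulTens_rep {w : tens B.η Z.toMod} {r : ℕ} {x : Fin r → U} {y : Fin r → Z.toMod}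
    (h : IsRep w x y) (u : U) (m : X) :
    ρ.mulTens w u m = ∑ i, tmul B.η X (x i * u) (ρ.act (y i) m) := by
  unfold IsRep at h
  subst h
  simp [mulTens_tmul]

lemma mulTens_smul (a : A) (w : tens B.η Z.toMod) (u : U) (x : X) :
    ρ.mulTens (a • w) u x = a • ρ.mulTens w u x := by
  obtain ⟨r, v, y, h⟩ := exists_rep w
  have h' : IsRep (a • w) (fun i => src B.η a * v i) y := by
    unfold IsRep at *
    subst h
    simp only [Finset.smul_sum, smul_tmul]
  rw [ρ.mulTens_rep h, ρ.mulTens_rep h', Finset.smul_sum]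
  simp only [smul_tmul, mul_assoc]

/-- Here the Takeuchi condition is indispensable: z₍₋₁₎t(a) ⊗ z₍₀₎ = z₍₋₁₎ ⊗ z₍₀₎(a·1), and
z₍₀₎(a·1) acts on x as z₍₀₎ acts on ax. Without it the diagonal action would not be defined over A.
-/
lemma mulTens_balanced (z : Z.toMod) (a : A) (u : U) (x : X) :
    ρ.mulTens (Z.coact z) (tgt B.η a * u) x = ρ.mulTens (Z.coact z) u (a • x) := by
  obtain ⟨r, v, y, h⟩ := exists_rep (Z.coact z)
  have key := congrArg (fun w => ρ.mulTens w u x) (Z.takeuchi a z v y h)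
  simp only [map_sum, LinearMap.sum_apply, mulTens_tmul, ρ.act_smul] at key
  rw [ρ.mulTens_rep h, ρ.mulTens_rep h, ← key]
  simp only [mul_assoc]

/-- The action on `U ⊗_A X`: `z (u ⊗ x) = z₍₋₁₎ u ⊗ z₍₀₎ x`. -/
def tensActMap : Z.toMod →ₗ[k] tens B.η X →ₗ[k] tens B.η X where
  toFun z := tensLiftK (ρ.mulTens (Z.coact z)) (ρ.mulTens_balanced z)
  map_add' z z' := by
    ext w
    refine tens_hom_ext (tensLiftK _ _) (tensLiftK _ _ + tensLiftK _ _) (fun u x => ?_) w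
    simp [tensLiftK_tmul]
  map_smul' c z := by
    ext w
    refine tens_hom_ext (tensLiftK _ _) (c • tensLiftK _ _) (fun u x => ?_) w
    simp only [tensLiftK_tmul, LinearMap.smul_apply, LinearMap.map_smul_of_tower]

lemma tensActMap_tmul (z : Z.toMod) (u : U) (x : X) :
    ρ.tensActMap z (tmul B.η X u x) = ρ.mulTens (Z.coact z) u x :=
  tensLiftK_tmul _ (ρ.mulTens_balanced z) u x

lemma tensActMap_rep {z : Z.toMod} {r : ℕ} {v : Fin r → U} {y : Fin r → Z.toMod}
    (h : IsRep (Z.coact z) v y) (u : U) (x : X) :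
    ρ.tensActMap z (tmul B.η X u x) = ∑ i, tmul B.η X (v i * u) (ρ.act (y i) x) := by
  rw [tensActMap_tmul, ρ.mulTens_rep h]

/-- The tensor product of a module over a comodule algebra with `U`. -/
def tens : Z.Action (tens B.η X) where
  act := ρ.tensActMap
  one_act w := by
    refine tens_hom_ext (ρ.tensActMap Z.one) (LinearMap.id : _ →ₗ[k] _) (fun u x => ?_) w
    rw [tensActMap_tmul, Z.coact_one, mulTens_tmul, one_mul, ρ.one_act]; rfl
  mul_act z z' w := by
    refine tens_hom_ext (ρ.tensActMap (Z.mul z z')) (ρ.tensActMap z ∘ₗ ρ.tensActMap z')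
      (fun u x => ?_) w
    obtain ⟨r, v, y, h⟩ := exists_rep (Z.coact z)
    obtain ⟨r', v', y', h'⟩ := exists_rep (Z.coact z')
    rw [tensActMap_tmul, Z.coact_mul z z' v y v' y' h h', LinearMap.comp_apply,
      ρ.tensActMap_rep h', map_sum]
    simp only [map_sum, LinearMap.sum_apply, mulTens_tmul, ρ.tensActMap_rep h, mul_assoc,
      ρ.mul_act]
    exact Finset.sum_comm
  smul_act a z w := by
    refine tens_hom_ext (ρ.tensActMap (a • z))
      ((DistribSMul.toAddMonoidHom (BialgebroidCohomology.tens B.η X) a).comp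
        (ρ.tensActMap z).toAddMonoidHom)
      (fun u x => ?_) w
    simp only [tensActMap_tmul, map_smul, mulTens_smul]
    rw [← tensActMap_tmul]; rfl

lemma tens_act_rep {z : Z.toMod} {r : ℕ} {v : Fin r → U} {y : Fin r → Z.toMod}
    (h : IsRep (Z.coact z) v y) (u : U) (x : X) :
    ρ.tens.act z (tmul B.η X u x) = ∑ i, tmul B.η X (v i * u) (ρ.act (y i) x) :=
  ρ.tensActMap_rep h u x

/-- The action on the cochain spaces. -/
def cochain : (n : ℕ) → Z.Action (cochain B.η X n)
  | 0 => ρ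
  | n + 1 => (cochain n).tens

/-- The `A`-linear map `U^{⊗ q} ⊗ Z → U^{⊗ q} ⊗ X`,
`(u¹, …, u^q, z) ↦ (u¹ v¹, …, u^q v^q, z x)`. -/
def evalWord (x : X) : (q : ℕ) → (ℕ → U) →
    (BialgebroidCohomology.cochain B.η Z.toMod q →ₗ[A] BialgebroidCohomology.cochain B.η X q)
  | 0, _ =>
    { toFun := fun z => ρ.act z x
      map_add' := fun z z' => by rw [map_add, LinearMap.add_apply]
      map_smul' := fun a z => ρ.smul_act a z x }
  | q + 1, v => tensLift (X := BialgebroidCohomology.cochain B.η Z.toMod q)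
      (Y := BialgebroidCohomology.tens B.η (BialgebroidCohomology.cochain B.η X q))
      ((tmul B.η _).compl₁₂ (LinearMap.mulRight k (v 0))
        ((evalWord x q (fun j => v (j + 1))).restrictScalars k))
      (fun a u z => by simp [mul_assoc, tgt_mul_tmul])
      (fun a u z => by simp [mul_assoc, smul_tmul])

lemma evalWord_elem (x : X) (q : ℕ) (v u : ℕ → U) (z : Z.toMod) :
    ρ.evalWord x q v (elem B.η Z.toMod q u z) =
      elem B.η X q (fun j => u j * v j) (ρ.act z x) := by
  induction q generalizing v u with
  | zero => rfl
  | succ q ih =>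
    refine (tensLift_tmul _ _ _ _ _).trans ?_
    simp [ih, elem]

/-- Unfolding the diagonal action one tensor factor at a time produces the iterated coaction of z.
This is the bridge from the recursive definitions to the explicit insertion formula. -/
lemma cochain_act_elem (z : Z.toMod) (x : X) (q : ℕ) (v : ℕ → U) :
    (ρ.cochain q).act z (elem B.η X q v x) = ρ.evalWord x q v (Z.iterCoact q z) := by
  induction q generalizing v z with
  | zero => rfl
  | succ q ih =>
    obtain ⟨r, a, y, h⟩ := exists_rep (Z.coact z)
    refine ((ρ.cochain q).tens_act_rep h _ _).trans ?_
    rw [LeftComodule.iterCoact, LinearMap.comp_apply, (tensMap_rep _ h : _ = _), map_sum]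
    refine Finset.sum_congr rfl fun i _ => ?_
    refine Eq.trans ?_ (tensLift_tmul _ _ _ _ _).symm
    simp [ih]

end Action

end ComoduleAlgebra

/-- `U` as a comodule algebra. -/
abbrev regularComoduleAlgebra (B : LeftBialgebroid k A U) : ComoduleAlgebra B where
  toLeftComodule := regularComodule B
  one := (1 : U)
  mul := LinearMap.mul k U
  takeuchi a u _ x y h := by
    refine (B.takeuchi a u x y h).trans ?_
    refine Finset.sum_congr rfl fun i _ => ?_
    change tmul B.η _ (x i) ((y i : U) * src B.η a) = tmul B.η _ (x i) ((y i : U) * (src B.η a * 1))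
    rw [mul_one]
  coact_one := B.comul_one
  coact_mul u v _ _ x y x' y' h h' := B.comul_mul u v x y x' y' h h'

/-! ### Yetter-Drinfeld algebras as comodule algebras. -/

namespace YetterDrinfeldAlgebra

variable {N : Type u} [Ring N] [Algebra k N] [Module U N] [IsScalarTower k U N]

lemma comul_tgt_one (a : A) : IsRep (B.comul (tgt B.η a)) (fun _ : Fin 1 => 1)
    (fun _ => tgt B.η a) := by
  have h := B.comul_tgt a 1 (fun _ : Fin 1 => 1) (fun _ => 1) (by simp [IsRep, B.comul_one])
  simpa using h

/-- A Yetter-Drinfeld algebra as a comodule algebra. -/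
abbrev toComoduleAlgebra (Y : YetterDrinfeldAlgebra B N) : ComoduleAlgebra B where
  toLeftComodule := Y.toComodule
  one := (1 : N)
  mul := LinearMap.mul k N
  takeuchi a n r x y h := by
    -- As Δ(t(a)) = 1 ⊗ t(a), the Yetter-Drinfeld condition at u = t(a) reads n₍₋₁₎t(a) ⊗ n₍₀₎ =
    -- n₍₋₁₎ ⊗ t(a)n₍₀₎; the balancing of N over A rewrites t(a)n₍₀₎ as n₍₀₎(s(a)1).
    have key := Y.yetter_drinfeld (tgt B.η a) n _ _ x y (fun _ => r) (fun _ => x) (fun _ => y)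
      (comul_tgt_one a) h (fun _ => by rw [one_smul]; exact h)
    simp only [Finset.univ_unique, Finset.sum_singleton, one_mul] at key
    refine key.trans ?_
    refine Finset.sum_congr rfl fun i _ => ?_
    change _ = tmul B.η (ofAction B.η N) (x i) ((y i : N) * (src B.η a • (1 : N)))
    rw [Y.balanced, mul_one]
  coact_one := Y.coact_one
  coact_mul u v _ _ x y x' y' h h' := Y.coact_mul u v x y x' y' h h'

/-- The action of `U` on `N`. -/
def actU (_Y : YetterDrinfeldAlgebra B N) :
    (regularComoduleAlgebra B).Action (ofAction B.η N) where
  act := (Algebra.lsmul k k N : U →ₐ[k] Module.End k N).toLinearMap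
  one_act x := @one_smul U N _ _ x
  mul_act u u' x := @mul_smul U N _ _ u u' x
  smul_act a u x := @mul_smul U N _ _ (src B.η a) u x

/-- The action of `N` on itself by left multiplication. -/
def actN (Y : YetterDrinfeldAlgebra B N) : Y.toComoduleAlgebra.Action (ofAction B.η N) where
  act := LinearMap.mul k N
  one_act x := @one_mul N _ x
  mul_act n n' x := @mul_assoc N _ n n' x
  smul_act a n x := Y.src_smul_mul a n x

end YetterDrinfeldAlgebra

end ComoduleAlgebra

end

end BialgebroidCohomology

namespace BialgebroidCohomology

noncomputable section

/-! # The total cochain space -/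

section CoassocLemmas

variable {k : Type v} {A U : Type u} [CommRing k] [Ring A] [Algebra k A] [Ring U] [Algebra k U]
variable {B : LeftBialgebroid k A U}

lemma LeftBialgebroid.exists_comul_rep (B : LeftBialgebroid k A U) (u : U) :
    ∃ (r : ℕ) (x y : Fin r → U), IsRep (B.comul u) x y :=
  exists_rep (B.comul u)

/-- Sweedler notation made usable: for balanced F the expression F(m₍₋₂₎, m₍₋₁₎, m₍₀₎) may be
computed from any representatives, splitting either the first or the second factor. F descends to U
⊗ (U ⊗ M) in two stages and is applied to coassociativity. -/
lemma LeftComodule.coassoc_apply (M : LeftComodule B) {P : Type*} [AddCommGroup P] [Module k P]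
    (F : U →ₗ[k] U →ₗ[k] M.toMod →ₗ[k] P)
    (h₁ : ∀ a x y m, F (tgt B.η a * x) y m = F x (src B.η a * y) m)
    (h₂ : ∀ a x y m, F x (tgt B.η a * y) m = F x y (a • m))
    {m : M.toMod} {r : ℕ} {x : Fin r → U} {y : Fin r → M.toMod} (h : IsRep (M.coact m) x y)
    {l : Fin r → ℕ} {p q : ∀ i, Fin (l i) → U} (hx : ∀ i, IsRep (B.comul (x i)) (p i) (q i))
    {l' : Fin r → ℕ} {p' : ∀ i, Fin (l' i) → U} {q' : ∀ i, Fin (l' i) → M.toMod}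
    (hy : ∀ i, IsRep (M.coact (y i)) (p' i) (q' i)) :
    ∑ i, ∑ j, F (p i j) (q i j) (y i) = ∑ i, ∑ j, F (x i) (p' i j) (q' i j) := by
  let I : U →ₗ[k] tens B.η M.toMod →ₗ[k] P :=
    { toFun := fun x => tensLiftK (F x) (fun a y m => h₂ a x y m)
      map_add' := fun x x' => by
        ext w
        exact tens_hom_ext (tensLiftK _ _) (tensLiftK _ _ + tensLiftK _ _)
          (fun u x => by simp [tensLiftK_tmul]) w
      map_smul' := fun c x => by
        ext w
        exact tens_hom_ext (tensLiftK _ _) (c • tensLiftK _ _)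
          (fun u x => by simp [tensLiftK_tmul]) w }
  have hI : ∀ x y m, I x (tmul B.η _ y m) = F x y m := fun x y m =>
    tensLiftK_tmul (F x) (fun a y m => h₂ a x y m) y m
  let G : tens B.η (tens B.η M.toMod) →ₗ[k] P := tensLiftK I (fun a x w => by
    refine tens_hom_ext (I (tgt B.η a * x))
      ((I x).toAddMonoidHom.comp (DistribSMul.toAddMonoidHom (tens B.η M.toMod) a))
      (fun y m => ?_) w
    change _ = I x (a • tmul B.η M.toMod y m)
    rw [smul_tmul, hI, hI, h₁])
  have hG : ∀ x y m, G (tmul B.η _ x (tmul B.η _ y m)) = F x y m := fun x y m =>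
    (tensLiftK_tmul I _ _ _).trans (hI x y m)
  have key := congrArg G (M.coassoc m)
  rw [(tensMap_rep _ h : _ = _)] at key
  rw [(h : _ = _), map_sum, map_sum, map_sum] at key
  refine Eq.trans ?_ (key.trans ?_)
  · refine Finset.sum_congr rfl fun i _ => ?_
    rw [B.comulTens_rep _ _ (hx i), map_sum]
    exact Finset.sum_congr rfl fun j _ => (hG _ _ _).symm
  · refine Finset.sum_congr rfl fun i _ => ?_
    beta_reduce
    rw [(hy i : _ = _), map_sum, map_sum]
    exact Finset.sum_congr rfl fun j _ => hG _ _ _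

end CoassocLemmas

namespace YetterDrinfeldAlgebra

variable {k : Type v} {A U N : Type u} [CommRing k] [Ring A] [Algebra k A] [Ring U] [Algebra k U]
  [Ring N] [Algebra k N] [Module U N] [IsScalarTower k U N] {B : LeftBialgebroid k A U}

/-- The direct sum of all cochain spaces `Cⁿ_co(U, N)`. -/
def Tot (Y : YetterDrinfeldAlgebra B N) : Type u := ⨁ n, Y.toComodule.C n

variable (Y : YetterDrinfeldAlgebra B N)

instance : AddCommGroup Y.Tot := inferInstanceAs (AddCommGroup (⨁ n, Y.toComodule.C n))

instance : Module k Y.Tot := inferInstanceAs (Module k (⨁ n, Y.toComodule.C n))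

/-- The inclusion of the cochains of degree `n`. -/
def inc (n : ℕ) : Y.toComodule.C n →ₗ[k] Y.Tot :=
  DirectSum.lof k ℕ (fun n => (Y.toComodule.C n).carrier) n

/-- The component of degree `n`. -/
def comp (n : ℕ) : Y.Tot →ₗ[k] Y.toComodule.C n :=
  DirectSum.component k ℕ (fun n => (Y.toComodule.C n).carrier) n

lemma comp_inc (n : ℕ) (x : Y.toComodule.C n) : Y.comp n (Y.inc n x) = x :=
  DirectSum.component.lof_self (R := k) (M := fun n => (Y.toComodule.C n).carrier) n x

lemma inc_injective (n : ℕ) : Function.Injective (Y.inc n) :=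
  Function.LeftInverse.injective (Y.comp_inc n)

/-- Maps out of the total cochain space, given in each degree. -/
def totLift {P : Type*} [AddCommGroup P] [Module k P] (f : ∀ n, Y.toComodule.C n →ₗ[k] P) :
    Y.Tot →ₗ[k] P :=
  DirectSum.toModule k ℕ P f

lemma totLift_inc {P : Type*} [AddCommGroup P] [Module k P] (f : ∀ n, Y.toComodule.C n →ₗ[k] P)
    (n : ℕ) (x : Y.toComodule.C n) : Y.totLift f (Y.inc n x) = f n x :=
  DirectSum.toModule_lof (R := k) (M := fun n => (Y.toComodule.C n).carrier) n x

/-- The map `(u, φ) ↦ u ⊗ φ` of degree `1`. -/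
def cons : U →ₗ[k] Y.Tot →ₗ[k] Y.Tot :=
  (Y.totLift fun n => ((tmul B.η (Y.toComodule.C n)).compr₂ (Y.inc (n + 1))).flip).flip

/-- The inclusion of `N`, the cochains of degree `0`. -/
def base : N →ₗ[k] Y.Tot := Y.inc 0

/-- The diagonal action of `U`. -/
def uAct : U →ₗ[k] Y.Tot →ₗ[k] Y.Tot :=
  (Y.totLift fun n => ((Y.actU.cochain n).act.compr₂ (Y.inc n)).flip).flip

/-- The left action of `N`. -/
def nAct : N →ₗ[k] Y.Tot →ₗ[k] Y.Tot :=
  (Y.totLift fun n => ((Y.actN.cochain n).act.compr₂ (Y.inc n)).flip).flip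

variable {Y}

lemma cons_inc (u : U) (n : ℕ) (x : Y.toComodule.C n) :
    Y.cons u (Y.inc n x) = Y.inc (n + 1) (tmul B.η (Y.toComodule.C n) u x) := by
  simp [cons, totLift_inc]

lemma uAct_inc (u : U) (n : ℕ) (x : Y.toComodule.C n) :
    Y.uAct u (Y.inc n x) = Y.inc n ((Y.actU.cochain n).act u x) := by
  simp [uAct, totLift_inc]

lemma nAct_inc (m : N) (n : ℕ) (x : Y.toComodule.C n) :
    Y.nAct m (Y.inc n x) = Y.inc n ((Y.actN.cochain n).act m x) := by
  simp [nAct, totLift_inc]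

lemma tot_induction_inc {P : Y.Tot → Prop} (hadd : ∀ x y, P x → P y → P (x + y))
    (h : ∀ n x, P (Y.inc n x)) (x : Y.Tot) : P x := by
  refine DirectSum.induction_on (motive := P) x ?_ h (fun x y => hadd x y)
  have h0 := h 0 0
  rwa [map_zero] at h0

/-- Induction over `U ⊗ ⋯ ⊗ U ⊗ N`, keeping track of degrees. -/
lemma hom_induction {P : ℕ → Y.Tot → Prop} (hadd : ∀ n x y, P n x → P n y → P n (x + y))
    (hbase : ∀ m, P 0 (Y.base m)) (hcons : ∀ n u x, P n x → P (n + 1) (Y.cons u x)) (n : ℕ)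
    (x : Y.toComodule.C n) : P n (Y.inc n x) := by
  induction n with
  | zero => exact hbase x
  | succ n ih =>
    induction x using tens_induction (η := B.η) (X := Y.toComodule.C n) with
    | ht u x => rw [← cons_inc]; exact hcons n u _ (ih x)
    | ha z z' h h' => rw [map_add]; exact hadd _ _ _ h h'

lemma tot_induction {P : Y.Tot → Prop} (hadd : ∀ x y, P x → P y → P (x + y))
    (hbase : ∀ m, P (Y.base m)) (hcons : ∀ u x, P x → P (Y.cons u x)) (x : Y.Tot) : P x :=
  tot_induction_inc hadd
    (hom_induction (P := fun _ => P) (fun _ => hadd) hbase (fun _ => hcons)) x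

lemma cons_tgt (a : A) (u : U) (φ : Y.Tot) :
    Y.cons (tgt B.η a * u) φ = Y.cons u (Y.uAct (src B.η a) φ) := by
  induction φ using tot_induction_inc with
  | hadd x y hx hy => simp only [map_add, hx, hy]
  | h n x =>
    rw [cons_inc, uAct_inc, cons_inc, tgt_mul_tmul]
    congr 2
    have h1 := (Y.actU.cochain n).smul_act a (1 : U) x
    have h2 := (Y.actU.cochain n).one_act x
    refine (congrArg _ h2.symm).trans (h1.symm.trans ?_)
    exact congrArg (fun v => (Y.actU.cochain n).act v x) (mul_one (src B.η a))

/-- On each cochain space a·x = a·(1x) = (a·1)x = s(a)x for the diagonal U-action, so the A-module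
structures need no separate treatment on `Tot`. -/
lemma inc_smul (a : A) (n : ℕ) (x : Y.toComodule.C n) :
    Y.inc n (a • x) = Y.uAct (src B.η a) (Y.inc n x) := by
  rw [uAct_inc]
  congr 1
  have h1 := (Y.actU.cochain n).smul_act a (1 : U) x
  have h2 := (Y.actU.cochain n).one_act x
  refine (congrArg _ h2.symm).trans (h1.symm.trans ?_)
  exact congrArg (fun v => (Y.actU.cochain n).act v x) (mul_one (src B.η a))

lemma uAct_one (φ : Y.Tot) : Y.uAct 1 φ = φ := by
  induction φ using tot_induction_inc with
  | hadd x y hx hy => simp only [map_add, hx, hy]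
  | h n x => rw [uAct_inc]; exact congrArg _ ((Y.actU.cochain n).one_act x)

lemma uAct_mul (u u' : U) (φ : Y.Tot) : Y.uAct (u * u') φ = Y.uAct u (Y.uAct u' φ) := by
  induction φ using tot_induction_inc with
  | hadd x y hx hy => simp only [map_add, hx, hy]
  | h n x => simp only [uAct_inc]; exact congrArg _ ((Y.actU.cochain n).mul_act u u' x)

lemma nAct_one (φ : Y.Tot) : Y.nAct 1 φ = φ := by
  induction φ using tot_induction_inc with
  | hadd x y hx hy => simp only [map_add, hx, hy]
  | h n x => rw [nAct_inc]; exact congrArg _ ((Y.actN.cochain n).one_act x)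

lemma nAct_mul (m m' : N) (φ : Y.Tot) : Y.nAct (m * m') φ = Y.nAct m (Y.nAct m' φ) := by
  induction φ using tot_induction_inc with
  | hadd x y hx hy => simp only [map_add, hx, hy]
  | h n x => simp only [nAct_inc]; exact congrArg _ ((Y.actN.cochain n).mul_act m m' x)

lemma nAct_src (a : A) (m : N) (φ : Y.Tot) :
    Y.nAct (src B.η a • m) φ = Y.uAct (src B.η a) (Y.nAct m φ) := by
  induction φ using tot_induction_inc with
  | hadd x y hx hy => simp only [map_add, hx, hy]
  | h n x =>
    simp only [nAct_inc]
    rw [← inc_smul]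
    exact congrArg _ ((Y.actN.cochain n).smul_act a m x)

lemma uAct_src_cons (a : A) (u : U) (φ : Y.Tot) :
    Y.uAct (src B.η a) (Y.cons u φ) = Y.cons (src B.η a * u) φ := by
  induction φ using tot_induction_inc with
  | hadd x y hx hy => simp only [map_add, hx, hy]
  | h n x => rw [cons_inc, cons_inc, ← inc_smul, smul_tmul]

/-- t(a)m = (t(a)m)·1 = m·(s(a)1), and s(a)1 acts on `Tot` as s(a). -/
lemma nAct_tgt (a : A) (m : N) (φ : Y.Tot) :
    Y.nAct (tgt B.η a • m) φ = Y.nAct m (Y.uAct (src B.η a) φ) := by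
  rw [← mul_one (tgt B.η a • m), ← Y.balanced, nAct_mul, nAct_src, nAct_one]

lemma uAct_base (u : U) (m : N) : Y.uAct u (Y.base m) = Y.base (u • m) :=
  uAct_inc u 0 m

lemma nAct_base (m m' : N) : Y.nAct m (Y.base m') = Y.base (m * m') :=
  nAct_inc m 0 m'

lemma uAct_cons {w : U} {r : ℕ} {x y : Fin r → U} (h : IsRep (B.comul w) x y) (u : U)
    (φ : Y.Tot) : Y.uAct w (Y.cons u φ) = ∑ i, Y.cons (x i * u) (Y.uAct (y i) φ) := by
  induction φ using tot_induction_inc with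
  | hadd x y hx hy => simp only [map_add, hx, hy, Finset.sum_add_distrib]
  | h n z =>
    simp only [cons_inc, uAct_inc]
    rw [← map_sum]
    exact (uAct_inc _ (n + 1) _).trans (congrArg _ ((Y.actU.cochain n).tens_act_rep h u z))

lemma nAct_cons {m : N} {r : ℕ} {x : Fin r → U} {y : Fin r → N} (h : IsRep (Y.coact m) x y) (u : U)
    (φ : Y.Tot) : Y.nAct m (Y.cons u φ) = ∑ i, Y.cons (x i * u) (Y.nAct (y i) φ) := by
  induction φ using tot_induction_inc with
  | hadd x y hx hy => simp only [map_add, hx, hy, Finset.sum_add_distrib]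
  | h n z =>
    simp only [cons_inc, nAct_inc]
    rw [← map_sum]
    exact (nAct_inc _ (n + 1) _).trans (congrArg _ ((Y.actN.cochain n).tens_act_rep h u z))

variable (Y) in
lemma exists_coact_rep (m : N) : ∃ (r : ℕ) (x : Fin r → U) (y : Fin r → N),
    IsRep (Y.coact m) x y :=
  exists_rep (Y.coact m)

/-- Coassociativity of the coproduct applied to a balanced trilinear map. -/
lemma comul_coassoc_apply {P : Type*} [AddCommGroup P] [Module k P]
    (F : U →ₗ[k] U →ₗ[k] U →ₗ[k] P)
    (h₁ : ∀ a x y z, F (tgt B.η a * x) y z = F x (src B.η a * y) z)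
    (h₂ : ∀ a x y z, F x (tgt B.η a * y) z = F x y (src B.η a * z))
    {w : U} {r : ℕ} {x y : Fin r → U} (h : IsRep (B.comul w) x y)
    {l : Fin r → ℕ} {p q : ∀ i, Fin (l i) → U} (hx : ∀ i, IsRep (B.comul (x i)) (p i) (q i))
    {l' : Fin r → ℕ} {p' q' : ∀ i, Fin (l' i) → U} (hy : ∀ i, IsRep (B.comul (y i)) (p' i) (q' i)) :
    ∑ i, ∑ j, F (p i j) (q i j) (y i) = ∑ i, ∑ j, F (x i) (p' i j) (q' i j) :=
  (regularComodule B).coassoc_apply F h₁ h₂ h hx hy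

/-- Coassociativity of the coaction applied to a balanced trilinear map. -/
lemma coact_coassoc_apply {P : Type*} [AddCommGroup P] [Module k P]
    (F : U →ₗ[k] U →ₗ[k] N →ₗ[k] P)
    (h₁ : ∀ a x y z, F (tgt B.η a * x) y z = F x (src B.η a * y) z)
    (h₂ : ∀ a x y z, F x (tgt B.η a * y) z = F x y (src B.η a • z))
    {m : N} {r : ℕ} {x : Fin r → U} {y : Fin r → N} (h : IsRep (Y.coact m) x y)
    {l : Fin r → ℕ} {p q : ∀ i, Fin (l i) → U} (hx : ∀ i, IsRep (B.comul (x i)) (p i) (q i))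
    {l' : Fin r → ℕ} {p' : ∀ i, Fin (l' i) → U} {q' : ∀ i, Fin (l' i) → N}
    (hy : ∀ i, IsRep (Y.coact (y i)) (p' i) (q' i)) :
    ∑ i, ∑ j, F (p i j) (q i j) (y i) = ∑ i, ∑ j, F (x i) (p' i j) (q' i j) :=
  Y.toComodule.coassoc_apply F h₁ h₂ h hx hy

/-- The Yetter-Drinfeld condition applied to a balanced bilinear map. -/
lemma yetter_drinfeld_apply (Y : YetterDrinfeldAlgebra B N) {P : Type*} [AddCommGroup P]
    [Module k P] (F : U →ₗ[k] N →ₗ[k] P)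
    (hF : ∀ a x m, F (tgt B.η a * x) m = F x (src B.η a • m)) {w : U} {n : N}
    {r r' : ℕ} {x y : Fin r → U} {z : Fin r' → U} {n₀ : Fin r' → N} {l : Fin r → ℕ}
    {p : ∀ i, Fin (l i) → U} {q : ∀ i, Fin (l i) → N} (h : IsRep (B.comul w) x y)
    (h' : IsRep (Y.coact n) z n₀) (h'' : ∀ i, IsRep (Y.coact (x i • n)) (p i) (q i)) :
    ∑ i, ∑ j, F (p i j * y i) (q i j) = ∑ i, ∑ j, F (x i * z j) (y i • n₀ j) := by
  have key := congrArg (tensLiftK (η := B.η) (X := ofAction B.η N) F hF)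
    (Y.yetter_drinfeld w n x y z n₀ l p q h h' h'')
  simp only [map_sum] at key
  have e : ∀ x m, tensLiftK (η := B.η) (X := ofAction B.η N) F hF (tmul B.η _ x m) = F x m :=
    tensLiftK_tmul (X := ofAction B.η N) F hF
  exact (Finset.sum_congr rfl fun i _ => Finset.sum_congr rfl fun j _ => (e _ _).symm).trans
    (key.trans (Finset.sum_congr rfl fun i _ => Finset.sum_congr rfl fun j _ => e _ _))

end YetterDrinfeldAlgebra

end

end BialgebroidCohomology

namespace BialgebroidCohomology

noncomputable section

/-! # Cup product and insertions on the total cochain space -/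

namespace YetterDrinfeldAlgebra

variable {k : Type v} {A U N : Type u} [CommRing k] [Ring A] [Algebra k A] [Ring U] [Algebra k U]
  [Ring N] [Algebra k N] [Module U N] [IsScalarTower k U N] {B : LeftBialgebroid k A U}
  {Y : YetterDrinfeldAlgebra B N}

/-- `w (n φ) = (w₍₁₎ n) (w₍₂₎ φ)`. -/
lemma uAct_nAct {w : U} {r : ℕ} {x y : Fin r → U} (h : IsRep (B.comul w) x y) (n : N)
    (φ : Y.Tot) : Y.uAct w (Y.nAct n φ) = ∑ i, Y.nAct (x i • n) (Y.uAct (y i) φ) := by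
  induction φ using tot_induction generalizing w n r x y with
  | hadd φ φ' hφ hφ' => simp only [map_add, hφ h, hφ' h, Finset.sum_add_distrib]
  | hbase m =>
    simp only [nAct_base, uAct_base, Y.smul_mul w n m x y h, map_sum]
  | hcons u φ ih =>
    obtain ⟨l, z, n₀, hn⟩ := Y.exists_coact_rep n
    choose lx p q hx using fun i => B.exists_comul_rep (x i)
    choose ly p' q' hy using fun i => B.exists_comul_rep (y i)
    choose lc c c₀ hc using fun i j => Y.exists_coact_rep (p i j • n)
    let F : U →ₗ[k] U →ₗ[k] U →ₗ[k] Y.Tot := ∑ j, LinearMap.mk₂ k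
      (fun a b => Y.cons (a * (z j * u)) ∘ₗ Y.nAct (b • n₀ j) ∘ₗ Y.uAct.flip φ)
      (fun a a' b => by ext c; simp [add_mul]) (fun t a b => by ext c; simp)
      (fun a b b' => by ext c; simp [add_smul]) (fun t a b => by ext c; simp)
    have hF : ∀ a b c, F a b c =
        ∑ j, Y.cons (a * (z j * u)) (Y.nAct (b • n₀ j) (Y.uAct c φ)) := fun a b c => by
      simp [F]
    let G : U →ₗ[k] U →ₗ[k] U →ₗ[k] Y.Tot := LinearMap.mk₂ k
      (fun a b => Y.nAct (a • n) ∘ₗ Y.cons (b * u) ∘ₗ Y.uAct.flip φ)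
      (fun a a' b => by ext c; simp [add_smul]) (fun t a b => by ext c; simp)
      (fun a b b' => by ext c; simp [add_mul]) (fun t a b => by ext c; simp)
    have hG : ∀ a b c, G a b c = Y.nAct (a • n) (Y.cons (b * u) (Y.uAct c φ)) := fun a b c => by
      simp [G]
    have h1 := comul_coassoc_apply F
      (fun a x y c => by
        simp only [hF, mul_assoc, cons_tgt, ← nAct_src, mul_smul])
      (fun a x y c => by
        simp only [hF, mul_smul, nAct_tgt, uAct_mul]) h hx hy
    have h2 := comul_coassoc_apply G
      (fun a x y c => by
        simp only [hG, mul_assoc, mul_smul, nAct_tgt, uAct_src_cons])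
      (fun a x y c => by
        simp only [hG, mul_assoc, cons_tgt, uAct_mul]) h hx hy
    -- In Sweedler notation: w(n(u ⊗ φ)) = w₍₁₎n₍₋₁₎u ⊗ (w₍₂₎n₍₀₎)(w₍₃₎φ), which is F; the
    -- Yetter-Drinfeld condition for w₍₁₎, w₍₂₎ turns it into (w₍₁₎n)₍₋₁₎w₍₂₎u ⊗ (w₍₁₎n)₍₀₎(w₍₃₎φ) =
    -- (w₍₁₎n)(w₍₂₎u ⊗ w₍₃₎φ), which is G. `h1` and `h2` regroup the threefold coproduct before and
    -- after.
    calc Y.uAct w (Y.nAct n (Y.cons u φ))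
        = ∑ i, ∑ j, F (x i) (p' i j) (q' i j) := by
          rw [nAct_cons hn, map_sum]
          simp only [uAct_cons h, hF]
          rw [Finset.sum_comm]
          refine Finset.sum_congr rfl fun i _ => ?_
          rw [Finset.sum_comm]
          refine Finset.sum_congr rfl fun j _ => ?_
          rw [ih (hy i), map_sum]
      _ = ∑ i, ∑ j, G (p i j) (q i j) (y i) := by
          rw [← h1]
          refine Finset.sum_congr rfl fun i _ => ?_
          let K : U →ₗ[k] N →ₗ[k] Y.Tot := LinearMap.mk₂ k
            (fun v m => Y.cons (v * u) (Y.nAct m (Y.uAct (y i) φ)))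
            (fun a a' b => by simp [add_mul]) (fun t a b => by simp)
            (fun a b b' => by simp) (fun t a b => by simp)
          have hK := Y.yetter_drinfeld_apply K
            (fun a v m => by simp only [K, LinearMap.mk₂_apply, mul_assoc, cons_tgt, nAct_src])
            (hx i) hn (hc i)
          simp only [K, LinearMap.mk₂_apply] at hK
          simp only [hF, hG, nAct_cons (hc i _), ← mul_assoc]
          exact hK.symm
      _ = ∑ i, Y.nAct (x i • n) (Y.uAct (y i) (Y.cons u φ)) := by
          rw [h2]
          refine Finset.sum_congr rfl fun i _ => ?_
          rw [uAct_cons (hy i), map_sum]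
          simp only [hG]

lemma uAct_tgt_cons (a : A) (u : U) (φ : Y.Tot) :
    Y.uAct (tgt B.η a) (Y.cons u φ) = Y.cons u (Y.uAct (tgt B.η a) φ) := by
  rw [uAct_cons (comul_tgt_one a)]
  simp

/-! ### Recursion along U ⊗ ⋯ ⊗ U ⊗ N. -/

section Recursion

variable {Q : Type w} [AddCommGroup Q] [Module k Q]

/-- The components of a map defined by recursion along `U ⊗ ⋯ ⊗ U ⊗ N`. -/
def recLin (g : N →ₗ[k] Q) (s₁ : U →ₗ[k] Y.Tot →ₗ[k] Q) (s₂ : U →ₗ[k] Q →ₗ[k] Q)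
    (α : A → Q →ₗ[k] Q) (h₀ : ∀ a n, g (src B.η a • n) = α a (g n))
    (h₁ : ∀ a u φ, s₁ (tgt B.η a * u) φ = s₁ u (Y.uAct (src B.η a) φ))
    (h₁' : ∀ a u φ, s₁ (src B.η a * u) φ = α a (s₁ u φ))
    (h₂ : ∀ a u q, s₂ (tgt B.η a * u) q = s₂ u (α a q))
    (h₂' : ∀ a u q, s₂ (src B.η a * u) q = α a (s₂ u q)) :
    (n : ℕ) → {f : Y.toComodule.C n →ₗ[k] Q // ∀ a z, f (a • z) = α a (f z)}
  | 0 => ⟨g, h₀⟩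
  | n + 1 =>
    let f := recLin g s₁ s₂ α h₀ h₁ h₁' h₂ h₂' n
    let F : U →ₗ[k] Y.toComodule.C n →ₗ[k] Q := s₁.compl₂ (Y.inc n) + s₂.compl₂ f.1
    have hF : ∀ u z, F u z = s₁ u (Y.inc n z) + s₂ u (f.1 z) := fun u z => rfl
    have hb : ∀ a u z, F (tgt B.η a * u) z = F u (a • z) := fun a u z => by
      rw [hF, hF, h₁, h₂, inc_smul, f.2]
    ⟨tensLiftK (X := Y.toComodule.C n) F hb, fun a z => by
      refine tens_hom_ext
        ((tensLiftK (X := Y.toComodule.C n) F hb).toAddMonoidHom.comp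
          (DistribSMul.toAddMonoidHom (tens B.η (Y.toComodule.C n)) a))
        ((α a) ∘ₗ tensLiftK (X := Y.toComodule.C n) F hb) (fun u z => ?_) z
      change tensLiftK F hb (a • tmul B.η _ u z) = α a (tensLiftK F hb (tmul B.η _ u z))
      rw [smul_tmul, tensLiftK_tmul, tensLiftK_tmul, hF, hF, h₁', h₂', map_add]⟩

/-- α plays the role of the A-action on the target. `h₀`, `h₁'` and `h₂'` make the map under
construction A-linear; this linearity, with `h₁` and `h₂`, is what makes the next step balanced.
`s₁` may use φ itself and not only the value at φ, as insertions require. -/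
lemma exists_rec (g : N →ₗ[k] Q) (s₁ : U →ₗ[k] Y.Tot →ₗ[k] Q) (s₂ : U →ₗ[k] Q →ₗ[k] Q)
    (α : A → Q →ₗ[k] Q) (h₀ : ∀ a n, g (src B.η a • n) = α a (g n))
    (h₁ : ∀ a u φ, s₁ (tgt B.η a * u) φ = s₁ u (Y.uAct (src B.η a) φ))
    (h₁' : ∀ a u φ, s₁ (src B.η a * u) φ = α a (s₁ u φ))
    (h₂ : ∀ a u q, s₂ (tgt B.η a * u) q = s₂ u (α a q))
    (h₂' : ∀ a u q, s₂ (src B.η a * u) q = α a (s₂ u q)) :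
    ∃ G : Y.Tot →ₗ[k] Q, (∀ n, G (Y.base n) = g n) ∧
      ∀ u φ, G (Y.cons u φ) = s₁ u φ + s₂ u (G φ) := by
  refine ⟨Y.totLift fun n => (recLin g s₁ s₂ α h₀ h₁ h₁' h₂ h₂' n).1,
    fun n => totLift_inc _ _ 0 n, fun u φ => ?_⟩
  induction φ using tot_induction_inc with
  | hadd x y hx hy => simp only [map_add, hx, hy]; abel
  | h n x =>
    rw [cons_inc, totLift_inc, totLift_inc]
    let f := recLin g s₁ s₂ α h₀ h₁ h₁' h₂ h₂' n
    refine tensLiftK_tmul (X := Y.toComodule.C n) (s₁.compl₂ (Y.inc n) + s₂.compl₂ f.1)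
      (fun a u z => ?_) u x
    change s₁ (tgt B.η a * u) (Y.inc n z) + s₂ (tgt B.η a * u) (f.1 z) =
      s₁ u (Y.inc n (a • z)) + s₂ u (f.1 (a • z))
    rw [h₁, h₂, inc_smul, f.2]

end Recursion

/-! ### The cup algebra and its U-action. -/

lemma exists_cup (Y : YetterDrinfeldAlgebra B N) : ∃ G : Y.Tot →ₗ[k] Y.Tot →ₗ[k] Y.Tot,
    (∀ n, G (Y.base n) = Y.nAct n) ∧ ∀ u φ, G (Y.cons u φ) = Y.cons u ∘ₗ G φ := by
  obtain ⟨G, h, h'⟩ := exists_rec (Y := Y) (Q := Y.Tot →ₗ[k] Y.Tot) Y.nAct 0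
    ((LinearMap.llcomp k Y.Tot Y.Tot Y.Tot).comp Y.cons)
    (fun a => LinearMap.llcomp k Y.Tot Y.Tot Y.Tot (Y.uAct (src B.η a)))
    (fun a n => by ext φ; simp [nAct_src])
    (fun a u φ => by simp) (fun a u φ => by simp)
    (fun a u q => by ext φ; simp [cons_tgt])
    (fun a u q => by ext φ; simp [uAct_src_cons])
  exact ⟨G, h, fun u φ => by rw [h']; simp; rfl⟩

/-- The cup product `(u¹, …, uᵖ, n) ⌣ ψ = u¹ ⊗ ⋯ ⊗ uᵖ ⊗ n ψ`. -/
def cup (Y : YetterDrinfeldAlgebra B N) : Y.Tot →ₗ[k] Y.Tot →ₗ[k] Y.Tot :=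
  (exists_cup Y).choose

lemma cup_base (n : N) (ψ : Y.Tot) : Y.cup (Y.base n) ψ = Y.nAct n ψ := by
  rw [cup, (exists_cup Y).choose_spec.1]

lemma cup_cons (u : U) (φ ψ : Y.Tot) : Y.cup (Y.cons u φ) ψ = Y.cons u (Y.cup φ ψ) := by
  rw [cup, (exists_cup Y).choose_spec.2]; rfl

lemma cup_src (a : A) (φ ψ : Y.Tot) :
    Y.cup (Y.uAct (src B.η a) φ) ψ = Y.uAct (src B.η a) (Y.cup φ ψ) := by
  induction φ using tot_induction with
  | hadd φ φ' h h' => simp only [map_add, LinearMap.add_apply, h, h']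
  | hbase m => rw [uAct_base, cup_base, cup_base, nAct_src]
  | hcons u φ ih => rw [uAct_src_cons, cup_cons, cup_cons, uAct_src_cons]

/-- Since Δ(t(a)) = 1 ⊗ t(a), the element t(a) passes through the U-factors of φ down to its
coefficient in N, where `nAct_tgt` moves it across. So ⌣ is balanced over A. -/
lemma cup_tgt (a : A) (φ ψ : Y.Tot) :
    Y.cup (Y.uAct (tgt B.η a) φ) ψ = Y.cup φ (Y.uAct (src B.η a) ψ) := by
  induction φ using tot_induction with
  | hadd φ φ' h h' => simp only [map_add, LinearMap.add_apply, h, h']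
  | hbase m => rw [uAct_base, cup_base, cup_base, nAct_tgt]
  | hcons u φ ih => rw [uAct_tgt_cons, cup_cons, cup_cons, ih]

lemma cup_nAct (n : N) (φ ψ : Y.Tot) : Y.cup (Y.nAct n φ) ψ = Y.nAct n (Y.cup φ ψ) := by
  induction φ using tot_induction generalizing n with
  | hadd φ φ' h h' => simp only [map_add, LinearMap.add_apply, h, h']
  | hbase m => rw [nAct_base, cup_base, cup_base, nAct_mul]
  | hcons u φ ih =>
    obtain ⟨r, x, y, h⟩ := Y.exists_coact_rep n
    rw [nAct_cons h, cup_cons, nAct_cons h, map_sum, LinearMap.sum_apply]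
    simp only [cup_cons, ih]

lemma cup_assoc (φ ψ χ : Y.Tot) : Y.cup (Y.cup φ ψ) χ = Y.cup φ (Y.cup ψ χ) := by
  induction φ using tot_induction with
  | hadd φ φ' h h' => simp only [map_add, LinearMap.add_apply, h, h']
  | hbase m => rw [cup_base, cup_base, cup_nAct]
  | hcons u φ ih => simp only [cup_cons, ih]

lemma cup_one (φ : Y.Tot) : Y.cup φ (Y.base 1) = φ := by
  induction φ using tot_induction with
  | hadd φ φ' h h' => simp only [map_add, LinearMap.add_apply, h, h']
  | hbase m => rw [cup_base, nAct_base, mul_one]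
  | hcons u φ ih => simp only [cup_cons, ih]

lemma one_cup (φ : Y.Tot) : Y.cup (Y.base 1) φ = φ := by
  rw [cup_base, nAct_one]

/-- The cup algebra is a U-module algebra. The case of φ in N is `uAct_nAct`, hence the
Yetter-Drinfeld condition; the inductive step is only coassociativity of Δ. -/
lemma uAct_cup {w : U} {r : ℕ} {x y : Fin r → U} (h : IsRep (B.comul w) x y) (φ ψ : Y.Tot) :
    Y.uAct w (Y.cup φ ψ) = ∑ i, Y.cup (Y.uAct (x i) φ) (Y.uAct (y i) ψ) := by
  induction φ using tot_induction generalizing w r x y with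
  | hadd φ φ' hφ hφ' =>
    simp only [map_add, LinearMap.add_apply, hφ h, hφ' h, Finset.sum_add_distrib]
  | hbase m => simp only [uAct_base, cup_base, uAct_nAct h]
  | hcons u φ ih =>
    choose lx p q hx using fun i => B.exists_comul_rep (x i)
    choose ly p' q' hy using fun i => B.exists_comul_rep (y i)
    let F : U →ₗ[k] U →ₗ[k] U →ₗ[k] Y.Tot := LinearMap.mk₂ k
      (fun a b => Y.cons (a * u) ∘ₗ Y.cup (Y.uAct b φ) ∘ₗ Y.uAct.flip ψ)
      (fun a a' b => by ext c; simp [add_mul]) (fun t a b => by ext c; simp)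
      (fun a b b' => by ext c; simp) (fun t a b => by ext c; simp)
    have hF : ∀ a b c, F a b c = Y.cons (a * u) (Y.cup (Y.uAct b φ) (Y.uAct c ψ)) :=
      fun a b c => by simp [F]
    have h1 := comul_coassoc_apply F
      (fun a x y c => by simp only [hF, mul_assoc, cons_tgt, uAct_mul, cup_src])
      (fun a x y c => by simp only [hF, uAct_mul, cup_tgt]) h hx hy
    simp only [hF] at h1
    rw [cup_cons, uAct_cons h]
    simp only [ih (hy _), map_sum, uAct_cons (hx _), LinearMap.sum_apply, cup_cons]
    exact h1.symm

/-- Braided commutativity: `(n₍₋₁₎ φ) ⌣ (n₍₀₎ ψ) = n (φ ⌣ ψ)`. -/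
lemma cup_braided (hY : Y.IsBraidedCommutative) {n : N} {r : ℕ} {x : Fin r → U} {y : Fin r → N}
    (h : IsRep (Y.coact n) x y) (φ ψ : Y.Tot) :
    ∑ i, Y.cup (Y.uAct (x i) φ) (Y.nAct (y i) ψ) = Y.nAct n (Y.cup φ ψ) := by
  induction φ using tot_induction generalizing n r x y with
  | hadd φ φ' hφ hφ' =>
    simp only [map_add, LinearMap.add_apply, hφ h, hφ' h, Finset.sum_add_distrib]
  | hbase m =>
    simp only [uAct_base, cup_base, ← nAct_mul, hY n m x y h, map_sum, LinearMap.sum_apply]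
  | hcons u φ ih =>
    choose lx p q hx using fun i => B.exists_comul_rep (x i)
    choose ly p' q' hy using fun i => Y.exists_coact_rep (y i)
    let F : U →ₗ[k] U →ₗ[k] N →ₗ[k] Y.Tot := LinearMap.mk₂ k
      (fun a b => Y.cons (a * u) ∘ₗ Y.cup (Y.uAct b φ) ∘ₗ Y.nAct.flip ψ)
      (fun a a' b => by ext c; simp [add_mul]) (fun t a b => by ext c; simp)
      (fun a b b' => by ext c; simp) (fun t a b => by ext c; simp)
    have hF : ∀ a b c, F a b c = Y.cons (a * u) (Y.cup (Y.uAct b φ) (Y.nAct c ψ)) :=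
      fun a b c => by simp [F]
    -- Only coassociativity of the coaction is used here; braided commutativity itself enters in the
    -- base case nm = (n₍₋₁₎m)n₍₀₎.
    have h1 := coact_coassoc_apply F
      (fun a x y c => by simp only [hF, mul_assoc, cons_tgt, uAct_mul, cup_src])
      (fun a x y c => by simp only [hF, uAct_mul, cup_tgt, nAct_src]) h hx hy
    simp only [hF] at h1
    rw [cup_cons, nAct_cons h]
    simp only [← ih (hy _), map_sum, uAct_cons (hx _), LinearMap.sum_apply, cup_cons]
    exact h1

/-! ## Insertions -/

/-- The map `(u, φ) ↦ (ψ ↦ (u ψ) ⌣ φ)`. -/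
def actCup (Y : YetterDrinfeldAlgebra B N) : U →ₗ[k] Y.Tot →ₗ[k] Y.Tot →ₗ[k] Y.Tot :=
  LinearMap.mk₂ k (fun u φ => Y.cup.flip φ ∘ₗ Y.uAct u)
    (fun a a' b => by ext c; simp) (fun t a b => by ext c; simp)
    (fun a b b' => by ext c; simp) (fun t a b => by ext c; simp)

lemma actCup_apply (u : U) (φ ψ : Y.Tot) : Y.actCup u φ ψ = Y.cup (Y.uAct u ψ) φ := rfl

/-- All insertions are built at once, with values in sequences indexed by i, because ∘_{i+1} on u ⊗
φ refers to ∘_i on φ. Balancing of the first slot is exactly `cup_tgt`. -/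
lemma exists_circ (Y : YetterDrinfeldAlgebra B N) :
    ∃ G : Y.Tot →ₗ[k] ℕ → Y.Tot →ₗ[k] Y.Tot, (∀ n, G (Y.base n) = 0) ∧
      ∀ u φ, G (Y.cons u φ) 0 = 0 ∧ G (Y.cons u φ) 1 = Y.actCup u φ ∧
        ∀ i, G (Y.cons u φ) (i + 2) = Y.cons u ∘ₗ G φ (i + 1) := by
  obtain ⟨G, h, h'⟩ := exists_rec (Y := Y) (Q := ℕ → Y.Tot →ₗ[k] Y.Tot) 0
    (LinearMap.mk₂ k (fun u φ => Pi.single 1 (Y.actCup u φ))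
      (fun a a' b => by simp [Pi.single_add]) (fun t a b => by simp [Pi.single_smul])
      (fun a b b' => by simp [Pi.single_add]) (fun t a b => by simp [Pi.single_smul]))
    -- Slot 1 is supplied by the previous argument, and index 0 is kept at the value 0; only from 2
    -- on does the recursion shift.
    (LinearMap.mk₂ k (fun u q i => if 2 ≤ i then Y.cons u ∘ₗ q (i - 1) else 0)
      (fun a a' b => by ext i c; simp only [Pi.add_apply]; split_ifs <;> simp)
      (fun t a b => by ext i c; simp only [Pi.smul_apply]; split_ifs <;> simp)
      (fun a b b' => by ext i c; simp only [Pi.add_apply]; split_ifs <;> simp)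
      (fun t a b => by ext i c; simp only [Pi.smul_apply]; split_ifs <;> simp))
    (fun a => LinearMap.pi fun i =>
      LinearMap.llcomp k Y.Tot Y.Tot Y.Tot (Y.uAct (src B.η a)) ∘ₗ LinearMap.proj i)
    (fun a n => by ext; simp)
    (fun a u φ => by
      simp only [LinearMap.mk₂_apply]
      congr 1; ext ψ
      simp only [actCup_apply, uAct_mul, cup_tgt])
    (fun a u φ => by
      ext i ψ
      by_cases hi : i = 1
      · subst hi; simp [actCup_apply, uAct_mul, cup_src]
      · simp [hi])
    (fun a u q => by
      ext i φ
      simp only [LinearMap.mk₂_apply]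
      split_ifs <;> simp [cons_tgt])
    (fun a u q => by
      ext i φ
      simp only [LinearMap.mk₂_apply, LinearMap.pi_apply, LinearMap.comp_apply,
        LinearMap.proj_apply]
      split_ifs <;> simp [uAct_src_cons])
  refine ⟨G, h, fun u φ => ⟨?_, ?_, fun i => ?_⟩⟩ <;> rw [h'] <;> simp

/-- The insertion `φ ∘_i ψ`. -/
def ins (Y : YetterDrinfeldAlgebra B N) (i : ℕ) : Y.Tot →ₗ[k] Y.Tot →ₗ[k] Y.Tot :=
  LinearMap.proj i ∘ₗ (exists_circ Y).choose

lemma ins_base (i : ℕ) (n : N) (ψ : Y.Tot) : Y.ins i (Y.base n) ψ = 0 := by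
  simp [ins, (exists_circ Y).choose_spec.1]

lemma ins_zero (φ ψ : Y.Tot) : Y.ins 0 φ ψ = 0 := by
  induction φ using tot_induction with
  | hadd φ φ' h h' => simp only [map_add, LinearMap.add_apply, h, h', add_zero]
  | hbase m => rw [ins_base]
  | hcons u φ ih => simp [ins, ((exists_circ Y).choose_spec.2 u φ).1]

lemma ins_one_cons (u : U) (φ ψ : Y.Tot) :
    Y.ins 1 (Y.cons u φ) ψ = Y.cup (Y.uAct u ψ) φ := by
  simp [ins, ((exists_circ Y).choose_spec.2 u φ).2.1, actCup_apply]

lemma ins_succ_cons (i : ℕ) (u : U) (φ ψ : Y.Tot) :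
    Y.ins (i + 2) (Y.cons u φ) ψ = Y.cons u (Y.ins (i + 1) φ ψ) := by
  simp [ins, ((exists_circ Y).choose_spec.2 u φ).2.2 i]

end YetterDrinfeldAlgebra

end

end BialgebroidCohomology

namespace BialgebroidCohomology

noncomputable section

/-! # The operad with multiplication -/

namespace YetterDrinfeldAlgebra

variable {k : Type v} {A U N : Type u} [CommRing k] [Ring A] [Algebra k A] [Ring U] [Algebra k U]
  [Ring N] [Algebra k N] [Module U N] [IsScalarTower k U N] {B : LeftBialgebroid k A U}
  {Y : YetterDrinfeldAlgebra B N}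

variable (Y) in
/-- The cochains of degree `n`, as a submodule of the total cochain space. -/
def deg (n : ℕ) : Submodule k Y.Tot := LinearMap.range (Y.inc n)

lemma inc_mem_deg (n : ℕ) (x : Y.toComodule.C n) : Y.inc n x ∈ Y.deg n := ⟨x, rfl⟩

lemma inc_comp_of_mem {n : ℕ} {φ : Y.Tot} (h : φ ∈ Y.deg n) : Y.inc n (Y.comp n φ) = φ := by
  obtain ⟨x, rfl⟩ := h
  rw [comp_inc]

lemma cons_mem {n : ℕ} (u : U) {φ : Y.Tot} (h : φ ∈ Y.deg n) : Y.cons u φ ∈ Y.deg (n + 1) := by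
  obtain ⟨x, rfl⟩ := h
  rw [cons_inc]
  exact inc_mem_deg _ _

lemma base_mem (m : N) : Y.base m ∈ Y.deg 0 := inc_mem_deg 0 m

lemma uAct_mem {n : ℕ} (u : U) {φ : Y.Tot} (h : φ ∈ Y.deg n) : Y.uAct u φ ∈ Y.deg n := by
  obtain ⟨x, rfl⟩ := h
  rw [uAct_inc]
  exact inc_mem_deg _ _

lemma nAct_mem {n : ℕ} (m : N) {φ : Y.Tot} (h : φ ∈ Y.deg n) : Y.nAct m φ ∈ Y.deg n := by
  obtain ⟨x, rfl⟩ := h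
  rw [nAct_inc]
  exact inc_mem_deg _ _

lemma deg_induction {P : ℕ → Y.Tot → Prop} (hadd : ∀ n x y, P n x → P n y → P n (x + y))
    (hbase : ∀ m, P 0 (Y.base m))
    (hcons : ∀ n u x, x ∈ Y.deg n → P n x → P (n + 1) (Y.cons u x)) {n : ℕ} {φ : Y.Tot}
    (h : φ ∈ Y.deg n) : P n φ := by
  obtain ⟨x, rfl⟩ := h
  exact (hom_induction (P := fun n φ => φ ∈ Y.deg n ∧ P n φ)
    (fun n x y hx hy => ⟨add_mem hx.1 hy.1, hadd n x y hx.2 hy.2⟩)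
    (fun m => ⟨base_mem m, hbase m⟩)
    (fun n u x hx => ⟨cons_mem u hx.1, hcons n u x hx.1 hx.2⟩) n x).2

lemma cup_mem {p q n : ℕ} (hn : p + q = n) {φ ψ : Y.Tot} (hφ : φ ∈ Y.deg p) (hψ : ψ ∈ Y.deg q) :
    Y.cup φ ψ ∈ Y.deg n := by
  refine deg_induction (P := fun p φ => ∀ n, p + q = n → Y.cup φ ψ ∈ Y.deg n) ?_ ?_ ?_ hφ n hn
  · intro p x y hx hy n hn
    rw [map_add, LinearMap.add_apply]
    exact add_mem (hx n hn) (hy n hn)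
  · rintro m n rfl
    rw [zero_add, cup_base]
    exact nAct_mem m hψ
  · rintro p u x - hx n rfl
    rw [cup_cons, add_right_comm]
    exact cons_mem u (hx _ rfl)

lemma ins_of_lt {p i : ℕ} (hi : p < i) {φ : Y.Tot} (hφ : φ ∈ Y.deg p) (ψ : Y.Tot) :
    Y.ins i φ ψ = 0 := by
  refine deg_induction (P := fun p φ => ∀ i, p < i → Y.ins i φ ψ = 0) ?_ ?_ ?_ hφ i hi
  · intro p x y hx hy i hi
    rw [map_add, LinearMap.add_apply, hx i hi, hy i hi, add_zero]
  · intro m i _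
    exact ins_base i m ψ
  · intro p u x _ hx i hi
    obtain ⟨i, rfl⟩ := Nat.exists_eq_add_of_le' (by omega : 2 ≤ i)
    rw [ins_succ_cons, hx (i + 1) (by omega), map_zero]

lemma ins_mem {p q n : ℕ} (hn : p + q = n + 1) (i : ℕ) {φ ψ : Y.Tot} (hφ : φ ∈ Y.deg p)
    (hψ : ψ ∈ Y.deg q) : Y.ins i φ ψ ∈ Y.deg n := by
  refine deg_induction (P := fun p φ => ∀ i n, p + q = n + 1 → Y.ins i φ ψ ∈ Y.deg n)
    ?_ ?_ ?_ hφ i n hn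
  · intro p x y hx hy i n hn
    rw [map_add, LinearMap.add_apply]
    exact add_mem (hx i n hn) (hy i n hn)
  · intro m i n _
    rw [ins_base]
    exact zero_mem _
  · intro p u x hxp hx i n hn
    match i, n with
    | 0, _ => rw [ins_zero]; exact zero_mem _
    | 1, _ => rw [ins_one_cons]; exact cup_mem (by omega) (uAct_mem u hψ) hxp
    -- Total degree 0 forces φ = u ⊗ x with x of degree 0, so the slot index exceeds the length and
    -- the value is zero; a tensor with u could not lie in degree 0 otherwise.
    | i + 2, 0 =>
      obtain rfl : p = 0 := by omega
      rw [ins_succ_cons, ins_of_lt (by omega) hxp, map_zero]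
      exact zero_mem _
    | i + 2, n + 1 =>
      rw [ins_succ_cons]
      exact cons_mem u (hx _ _ (by omega))

/-- On the first slot, w((uψ) ⌣ φ) = (w₍₁₎uψ) ⌣ (w₍₂₎φ), which is the insertion of ψ into w(u ⊗ φ):
the module algebra property says that w never reaches ψ on its own. -/
lemma uAct_ins (w : U) (i : ℕ) (φ ψ : Y.Tot) :
    Y.uAct w (Y.ins i φ ψ) = Y.ins i (Y.uAct w φ) ψ := by
  induction φ using tot_induction generalizing w i with
  | hadd φ φ' h h' => simp only [map_add, LinearMap.add_apply, h, h']
  | hbase m => rw [uAct_base, ins_base, ins_base, map_zero]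
  | hcons u φ ih =>
    obtain ⟨r, x, y, h⟩ := B.exists_comul_rep w
    match i with
    | 0 => rw [ins_zero, ins_zero, map_zero]
    | 1 =>
      rw [ins_one_cons, uAct_cup h, uAct_cons h, map_sum, LinearMap.sum_apply]
      simp only [ins_one_cons, uAct_mul]
    | i + 2 =>
      rw [ins_succ_cons, uAct_cons h, uAct_cons h, map_sum, LinearMap.sum_apply]
      simp only [ins_succ_cons, ih]

/-- On the first slot, n(u ⊗ φ) = n₍₋₁₎u ⊗ n₍₀₎φ inserts to (n₍₋₁₎uψ) ⌣ (n₍₀₎φ), and `cup_braided`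
extracts n. -/
lemma ins_nAct (hY : Y.IsBraidedCommutative) (n : N) (i : ℕ) (φ ψ : Y.Tot) :
    Y.ins i (Y.nAct n φ) ψ = Y.nAct n (Y.ins i φ ψ) := by
  induction φ using tot_induction generalizing n i with
  | hadd φ φ' h h' => simp only [map_add, LinearMap.add_apply, h, h']
  | hbase m => rw [nAct_base, ins_base, ins_base, map_zero]
  | hcons u φ ih =>
    obtain ⟨r, x, y, h⟩ := Y.exists_coact_rep n
    match i with
    | 0 => rw [ins_zero, ins_zero, map_zero]
    | 1 =>
      rw [ins_one_cons, nAct_cons h, ← cup_braided hY h, map_sum, LinearMap.sum_apply]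
      simp only [ins_one_cons, uAct_mul]
    | i + 2 =>
      rw [ins_succ_cons, nAct_cons h, nAct_cons h, map_sum, LinearMap.sum_apply]
      simp only [ins_succ_cons, ih]

/-- The first p slots of φ ⌣ ψ belong to φ, and associativity of ⌣ suffices. -/
lemma ins_cup_left {p i : ℕ} (hi : i ≤ p) {φ : Y.Tot} (hφ : φ ∈ Y.deg p) (ψ χ : Y.Tot) :
    Y.ins i (Y.cup φ ψ) χ = Y.cup (Y.ins i φ χ) ψ := by
  refine deg_induction (P := fun p φ => ∀ i, i ≤ p → Y.ins i (Y.cup φ ψ) χ =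
    Y.cup (Y.ins i φ χ) ψ) ?_ ?_ ?_ hφ i hi
  · intro p x y hx hy i hi
    simp only [map_add, LinearMap.add_apply, hx i hi, hy i hi]
  · intro m i hi
    obtain rfl : i = 0 := by omega
    simp [ins_zero]
  · intro p u x _ hx i hi
    match i with
    | 0 => simp [ins_zero]
    | 1 => rw [cup_cons, ins_one_cons, ins_one_cons, cup_assoc]
    | i + 2 => rw [cup_cons, ins_succ_cons, ins_succ_cons, cup_cons, hx (i + 1) (by omega)]

/-- The slots after the p-th belong to ψ. The coefficient of φ acts on ψ, and pulling it out of the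
insertion costs braided commutativity through `ins_nAct`. -/
lemma ins_cup_right (hY : Y.IsBraidedCommutative) {p i : ℕ} (hi : 1 ≤ i) {φ : Y.Tot}
    (hφ : φ ∈ Y.deg p) (ψ χ : Y.Tot) :
    Y.ins (p + i) (Y.cup φ ψ) χ = Y.cup φ (Y.ins i ψ χ) := by
  refine deg_induction (P := fun p φ => Y.ins (p + i) (Y.cup φ ψ) χ =
    Y.cup φ (Y.ins i ψ χ)) ?_ ?_ ?_ hφ
  · intro p x y hx hy
    simp only [map_add, LinearMap.add_apply, hx, hy]
  · intro m
    rw [zero_add, cup_base, cup_base, ins_nAct hY]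
  · intro p u x _ hx
    obtain ⟨i, rfl⟩ := Nat.exists_eq_add_of_le' hi
    rw [cup_cons, cup_cons, ← hx, show p + 1 + (i + 1) = (p + i) + 2 by omega, ins_succ_cons,
      show p + i + 1 = p + (i + 1) by omega]

/-- After stripping common leading factors the earlier insertion is in slot 1 and produces uχ, of
length r; the other slots are pushed back accordingly and are reached by `ins_cup_right`. -/
lemma ins_ins_lt (hY : Y.IsBraidedCommutative) {r i j : ℕ} (hj : 1 ≤ j) (hij : j < i)
    (φ ψ : Y.Tot) {χ : Y.Tot} (hχ : χ ∈ Y.deg r) :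
    Y.ins j (Y.ins i φ ψ) χ = Y.ins (i + r - 1) (Y.ins j φ χ) ψ := by
  induction φ using tot_induction generalizing i j with
  | hadd φ φ' h h' => simp only [map_add, LinearMap.add_apply, h hj hij, h' hj hij]
  | hbase m => simp [ins_base]
  | hcons u φ ih =>
    obtain ⟨i, rfl⟩ := Nat.exists_eq_add_of_le' (by omega : 2 ≤ i)
    match j with
    | 1 =>
      rw [ins_succ_cons, ins_one_cons, ins_one_cons, show i + 2 + r - 1 = r + (i + 1) by omega,
        ins_cup_right hY (by omega) (uAct_mem u hχ)]
    | j + 2 =>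
      rw [ins_succ_cons, ins_succ_cons, ins_succ_cons, ih (by omega) (by omega),
        show i + 2 + r - 1 = (i + r - 1) + 2 by omega, ins_succ_cons,
        show i + 1 + r - 1 = (i + r - 1) + 1 by omega]

/-- Nested insertion: once ψ sits in the factor u as uψ, the element χ goes into uψ by
`ins_cup_left`, and u then leaves the insertion by `uAct_ins`. -/
lemma ins_ins_mid {q i j : ℕ} (hi : 1 ≤ i) (hij : i ≤ j) (hj : j < q + i) (φ χ : Y.Tot)
    {ψ : Y.Tot} (hψ : ψ ∈ Y.deg q) :
    Y.ins j (Y.ins i φ ψ) χ = Y.ins i φ (Y.ins (j - i + 1) ψ χ) := by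
  induction φ using tot_induction generalizing i j with
  | hadd φ φ' h h' => simp only [map_add, LinearMap.add_apply, h hi hij hj, h' hi hij hj]
  | hbase m => simp [ins_base]
  | hcons u φ ih =>
    match i with
    | 1 =>
      rw [ins_one_cons, ins_one_cons, ins_cup_left (by omega) (uAct_mem u hψ), uAct_ins,
        Nat.sub_add_cancel hij]
    | i + 2 =>
      obtain ⟨j, rfl⟩ := Nat.exists_eq_add_of_le' (by omega : 2 ≤ j)
      rw [ins_succ_cons, ins_succ_cons, ins_succ_cons, ih (by omega) (by omega) (by omega),
        show j + 2 - (i + 2) + 1 = j + 1 - (i + 1) + 1 by omega]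

lemma ins_ins_ge (hY : Y.IsBraidedCommutative) {q i j : ℕ} (hi : 1 ≤ i) (hj : q + i ≤ j)
    (φ χ : Y.Tot) {ψ : Y.Tot} (hψ : ψ ∈ Y.deg q) :
    Y.ins j (Y.ins i φ ψ) χ = Y.ins i (Y.ins (j + 1 - q) φ χ) ψ := by
  induction φ using tot_induction generalizing i j with
  | hadd φ φ' h h' => simp only [map_add, LinearMap.add_apply, h hi hj, h' hi hj]
  | hbase m => simp [ins_base]
  | hcons u φ ih =>
    match i with
    | 1 =>
      obtain ⟨j, rfl⟩ := Nat.exists_eq_add_of_le hj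
      rw [ins_one_cons, show q + 1 + j = q + (j + 1) by omega,
        ins_cup_right hY (by omega) (uAct_mem u hψ),
        show q + (j + 1) + 1 - q = j + 2 by omega, ins_succ_cons, ins_one_cons]
    | i + 2 =>
      obtain ⟨j, rfl⟩ := Nat.exists_eq_add_of_le' (by omega : 2 ≤ j)
      rw [ins_succ_cons, ins_succ_cons, ih (by omega) (by omega),
        show j + 2 + 1 - q = (j + 1 - q) + 2 by omega, ins_succ_cons, ins_succ_cons,
        show j + 1 + 1 - q = j + 1 - q + 1 by omega]

variable (Y) in
/-- The identity element `(1, 1)` of degree `1`. -/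
def idElem : Y.Tot := Y.cons 1 (Y.base 1)

/-- u(1 ⊗ 1) = u₍₁₎ ⊗ ε(u₍₂₎)1 = t(ε(u₍₂₎))u₍₁₎ ⊗ 1 = u ⊗ 1 by the right counit law. -/
lemma uAct_idElem (u : U) : Y.uAct u Y.idElem = Y.cons u (Y.base 1) := by
  obtain ⟨r, x, y, h⟩ := B.exists_comul_rep u
  rw [idElem, uAct_cons h]
  conv_rhs => rw [← B.counit_comul_right u x y h, map_sum, LinearMap.sum_apply]
  refine Finset.sum_congr rfl fun i _ => ?_
  rw [uAct_base, Y.smul_one, cons_tgt, mul_one, uAct_base]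

lemma idElem_mem : Y.idElem ∈ Y.deg 1 := cons_mem _ (base_mem _)

lemma ins_idElem {p i : ℕ} (hi : 1 ≤ i) (hip : i ≤ p) {φ : Y.Tot} (hφ : φ ∈ Y.deg p) :
    Y.ins i φ Y.idElem = φ := by
  refine deg_induction (P := fun p φ => ∀ i, 1 ≤ i → i ≤ p → Y.ins i φ Y.idElem = φ)
    ?_ ?_ ?_ hφ i hi hip
  · intro p x y hx hy i hi hip
    simp only [map_add, LinearMap.add_apply, hx i hi hip, hy i hi hip]
  · intro m i hi hip
    omega
  · intro p u x _ hx i hi hip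
    match i with
    | 1 => rw [ins_one_cons, uAct_idElem, cup_cons, one_cup]
    | i + 2 => rw [ins_succ_cons, hx (i + 1) (by omega) (by omega)]

lemma idElem_ins (φ : Y.Tot) : Y.ins 1 Y.idElem φ = φ := by
  rw [idElem, ins_one_cons, uAct_one, cup_one]

variable (Y) in
/-- The element `(1, 1, 1)` of degree `2`. -/
def mulElem : Y.Tot := Y.cons 1 Y.idElem

lemma mulElem_mem : Y.mulElem ∈ Y.deg 2 := cons_mem _ idElem_mem

lemma idElem_cup (φ : Y.Tot) : Y.cup Y.idElem φ = Y.cons 1 φ := by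
  rw [idElem, cup_cons, one_cup]

/-- With μ = id ⌣ id and the two insertions below, associativity and unitality of μ reduce to those
of ⌣. -/
lemma mulElem_eq_cup : Y.mulElem = Y.cup Y.idElem Y.idElem := by
  rw [idElem_cup, mulElem]

lemma ins_one_mulElem (φ : Y.Tot) : Y.ins 1 Y.mulElem φ = Y.cup φ Y.idElem := by
  rw [mulElem, ins_one_cons, uAct_one]

lemma ins_two_mulElem (φ : Y.Tot) : Y.ins 2 Y.mulElem φ = Y.cup Y.idElem φ := by
  rw [mulElem, ins_succ_cons, idElem_ins, idElem_cup]

variable (Y) in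
/-- The partial compositions on the cochain spaces. -/
def circMap (p q n i : ℕ) :
    Y.toComodule.C p →ₗ[k] Y.toComodule.C q →ₗ[k] Y.toComodule.C n :=
  ((Y.ins i).compl₁₂ (Y.inc p) (Y.inc q)).compr₂ (Y.comp n)

lemma inc_circMap {p q n : ℕ} (h : p + q = n + 1) (i : ℕ) (x : Y.toComodule.C p)
    (y : Y.toComodule.C q) :
    Y.inc n (Y.circMap p q n i x y) = Y.ins i (Y.inc p x) (Y.inc q y) :=
  inc_comp_of_mem (ins_mem h i (inc_mem_deg p x) (inc_mem_deg q y))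

lemma inc_tuple_zero (u : ℕ → U) (m : N) : Y.inc 0 (Y.tuple 0 u m) = Y.base m := rfl

lemma inc_tuple_succ (n : ℕ) (u : ℕ → U) (m : N) : Y.inc (n + 1) (Y.tuple (n + 1) u m) =
    Y.cons (u 0) (Y.inc n (Y.tuple n (fun j => u (j + 1)) m)) :=
  (cons_inc (u 0) n (Y.tuple n (fun j => u (j + 1)) m)).symm

lemma inc_tuple_one : Y.inc 1 (Y.tuple 1 (fun _ => 1) 1) = Y.idElem := by
  rw [inc_tuple_succ, inc_tuple_zero, idElem]

lemma inc_tuple_two : Y.inc 2 (Y.tuple 2 (fun _ => 1) 1) = Y.mulElem := by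
  rw [inc_tuple_succ, inc_tuple_one, mulElem]

variable (Y) in
/-- The operad with multiplication of a braided commutative Yetter-Drinfeld algebra. -/
def operad (hY : Y.IsBraidedCommutative) : OperadWithMul k (fun n => Y.toComodule.C n) where
  one := Y.tuple 1 (fun _ => 1) 1
  circ {p q n} _ i := Y.circMap p q n i
  circ_eq_zero {p q n} h i x y hi := by
    refine Y.inc_injective n ?_
    rw [inc_circMap h, map_zero]
    rcases hi with hi | rfl
    · exact ins_of_lt hi (inc_mem_deg p x) _
    · exact ins_base i x _
  circ_circ_lt h₁ h₂ h₃ h₄ i j x y z _ _ hj hij := by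
    refine Y.inc_injective _ ?_
    rw [inc_circMap h₂, inc_circMap h₁, inc_circMap h₄, inc_circMap h₃]
    exact ins_ins_lt hY hj hij _ _ (inc_mem_deg _ _)
  circ_circ_mid h₁ h₂ h₃ h₄ i j x y z hi _ hij hj := by
    refine Y.inc_injective _ ?_
    rw [inc_circMap h₂, inc_circMap h₁, inc_circMap h₄, inc_circMap h₃]
    exact ins_ins_mid hi hij hj _ _ (inc_mem_deg _ _)
  circ_circ_ge h₁ h₂ h₃ h₄ i j x y z hi _ hj := by
    refine Y.inc_injective _ ?_
    rw [inc_circMap h₂, inc_circMap h₁, inc_circMap h₄, inc_circMap h₃]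
    exact ins_ins_ge hY hi hj _ _ (inc_mem_deg _ _)
  circ_one h i x hi hip := by
    refine Y.inc_injective _ ?_
    rw [inc_circMap h, inc_tuple_one]
    exact ins_idElem hi hip (inc_mem_deg _ _)
  one_circ h x := by
    refine Y.inc_injective _ ?_
    rw [inc_circMap h, inc_tuple_one, idElem_ins]
  mul := Y.tuple 2 (fun _ => 1) 1
  unit := Y.tuple 0 (fun _ => 1) 1
  mul_assoc := by
    refine Y.inc_injective 3 ?_
    rw [inc_circMap (p := 2) (q := 2) (n := 3) rfl, inc_circMap (p := 2) (q := 2) (n := 3) rfl,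
      inc_tuple_two, ins_one_mulElem, ins_two_mulElem,
      mulElem_eq_cup, cup_assoc]
  mul_unit_left := by
    refine Y.inc_injective 1 ?_
    rw [inc_circMap (p := 2) (q := 0) (n := 1) rfl, inc_tuple_two, ins_one_mulElem, inc_tuple_one, inc_tuple_zero,
      one_cup]
  mul_unit_right := by
    refine Y.inc_injective 1 ?_
    rw [inc_circMap (p := 2) (q := 0) (n := 1) rfl, inc_tuple_two, ins_two_mulElem, inc_tuple_one, inc_tuple_zero,
      cup_one]

/-! ## The explicit formula for insertions -/

variable (Y) in
/-- The iterated tensor `u 0 ⊗ ⋯ ⊗ u (p - 1) ⊗ φ`. -/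
def word : (p : ℕ) → (ℕ → U) → Y.Tot → Y.Tot
  | 0, _, φ => φ
  | p + 1, u, φ => Y.cons (u 0) (word p (fun j => u (j + 1)) φ)

lemma inc_tuple (p : ℕ) (u : ℕ → U) (m : N) :
    Y.inc p (Y.tuple p u m) = Y.word p u (Y.base m) := by
  induction p generalizing u with
  | zero => rfl
  | succ p ih => rw [inc_tuple_succ, ih, word]

lemma word_congr {p : ℕ} {u v : ℕ → U} (h : ∀ j < p, u j = v j) (φ : Y.Tot) :
    Y.word p u φ = Y.word p v φ := by
  induction p generalizing u v with
  | zero => rfl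
  | succ p ih =>
    rw [word, word, h 0 (by omega), ih (u := fun j => u (j + 1)) (v := fun j => v (j + 1))
      fun j hj => h (j + 1) (by omega)]

lemma word_add (p q : ℕ) (u : ℕ → U) (φ : Y.Tot) :
    Y.word (p + q) u φ = Y.word p u (Y.word q (fun j => u (p + j)) φ) := by
  induction p generalizing u with
  | zero => simp only [zero_add]; rfl
  | succ p ih =>
    rw [add_right_comm, word, word, ih]
    simp only [add_right_comm]

lemma word_sum {ι : Type*} (s : Finset ι) (p : ℕ) (u : ℕ → U) (φ : ι → Y.Tot) :
    Y.word p u (∑ i ∈ s, φ i) = ∑ i ∈ s, Y.word p u (φ i) := by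
  induction p generalizing u with
  | zero => rfl
  | succ p ih => simp only [word, ih, map_sum]

lemma cup_word (p : ℕ) (u : ℕ → U) (φ ψ : Y.Tot) :
    Y.cup (Y.word p u φ) ψ = Y.word p u (Y.cup φ ψ) := by
  induction p generalizing u with
  | zero => rfl
  | succ p ih => rw [word, word, cup_cons, ih]

lemma ins_word (i d : ℕ) (u : ℕ → U) (φ ψ : Y.Tot) :
    Y.ins (i + 1) (Y.word (i + (d + 1)) u φ) ψ =
      Y.word i u (Y.cup (Y.uAct (u i) ψ) (Y.word d (fun j => u (i + j + 1)) φ)) := by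
  induction i generalizing u with
  | zero =>
    rw [zero_add, zero_add, word, word, ins_one_cons]
    simp only [zero_add]
  | succ i ih =>
    rw [show i + 1 + (d + 1) = i + (d + 1) + 1 by omega, word, ins_succ_cons, ih, word]
    simp only [add_right_comm]

lemma uAct_word {q : ℕ} {w : U} (v : ℕ → U) (m : N) {r : ℕ} {x : Fin r → ℕ → U} {y : Fin r → U}
    (h : (regularComodule B).iterCoact q w = ∑ s, elem B.η (regularMod B.η) q (x s) (y s)) :
    Y.uAct w (Y.word q v (Y.base m)) =
      ∑ s, Y.word q (fun j => x s j * v j) (Y.base (y s • m)) := by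
  rw [← inc_tuple, uAct_inc]
  have h1 := Y.actU.cochain_act_elem w m q v
  rw [h, map_sum] at h1
  refine (congrArg _ h1).trans ((map_sum _ _ _).trans ?_)
  refine Finset.sum_congr rfl fun s _ => ?_
  rw [ComoduleAlgebra.Action.evalWord_elem, ← inc_tuple]
  rfl

lemma nAct_word {q : ℕ} {n : N} (v : ℕ → U) (m : N) {r : ℕ} {x : Fin r → ℕ → U} {y : Fin r → N}
    (h : Y.toComodule.iterCoact q n = ∑ s, Y.tuple q (x s) (y s)) :
    Y.nAct n (Y.word q v (Y.base m)) =
      ∑ s, Y.word q (fun j => x s j * v j) (Y.base (y s * m)) := by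
  rw [← inc_tuple, nAct_inc]
  have h1 := Y.actN.cochain_act_elem n m q v
  rw [h, map_sum] at h1
  refine (congrArg _ h1).trans ((map_sum _ _ _).trans ?_)
  refine Finset.sum_congr rfl fun s _ => ?_
  rw [tuple, ComoduleAlgebra.Action.evalWord_elem, ← inc_tuple]
  rfl

/-- Three blocks arise: the leading factors are untouched, u acting on ψ contributes the iterated
coproduct, and the resulting coefficient acting on the remaining tail contributes the iterated
coaction. -/
lemma operad_isInsertion (hY : Y.IsBraidedCommutative) :
    IsInsertion Y (Y.operad hY).toOperad := by
  intro p q n h i hi hip u v m m' r x y hx l a b ha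
  obtain ⟨i, rfl⟩ := Nat.exists_eq_add_of_le' hi
  obtain ⟨d, rfl⟩ := Nat.exists_eq_add_of_le hip
  obtain rfl : n = i + (q + d) := by omega
  refine Y.inc_injective _ ?_
  refine (inc_circMap h _ _ _).trans ?_
  -- The length p - i of the tail occurs in the types of `ha`, so it is replaced by a variable
  -- before being identified with d.
  generalize hd : i + 1 + d - (i + 1) = e at ha
  obtain rfl : e = d := by omega
  rw [Nat.add_sub_cancel] at hx
  simp only [map_sum, inc_tuple]
  rw [show i + 1 + e = i + (e + 1) by omega, ins_word, uAct_word v m' hx, map_sum,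
    LinearMap.sum_apply, word_sum]
  refine Finset.sum_congr rfl fun s _ => ?_
  rw [cup_word, cup_base, nAct_word _ m (ha s), word_sum, word_sum]
  refine Finset.sum_congr rfl fun j _ => ?_
  -- Lengths i, q and e: in each block a different branch of `insertWord` applies.
  rw [word_add, word_add]
  refine (word_congr (fun t ht => ?_) _).trans (congrArg _ ?_)
  · rw [insertWord, if_pos (by omega)]
  refine (word_congr (fun t ht => ?_) _).trans (congrArg _ ?_)
  · rw [insertWord, if_neg (by omega), if_pos (by omega)]
    simp
  refine word_congr (fun t ht => ?_) _
  rw [insertWord, if_neg (by omega), if_neg (by omega)]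
  congr 2 <;> omega

end YetterDrinfeldAlgebra

end

end BialgebroidCohomology

namespace BialgebroidCohomology

noncomputable section

/-! # Derivations of the cup product and the Gerstenhaber identities on cochains -/

namespace YetterDrinfeldAlgebra

variable {k : Type v} {A U N : Type u} [CommRing k] [Ring A] [Algebra k A] [Ring U] [Algebra k U]
  [Ring N] [Algebra k N] [Module U N] [IsScalarTower k U N] {B : LeftBialgebroid k A U}
  {Y : YetterDrinfeldAlgebra B N}

lemma exists_sg (Y : YetterDrinfeldAlgebra B N) (ε : k) : ∃ G : Y.Tot →ₗ[k] Y.Tot,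
    (∀ n, G (Y.base n) = Y.base n) ∧ ∀ u φ, G (Y.cons u φ) = ε • Y.cons u (G φ) := by
  obtain ⟨G, h, h'⟩ := exists_rec (Y := Y) (Q := Y.Tot) Y.base 0 (ε • Y.cons)
    (fun a => Y.uAct (src B.η a))
    (fun a n => (uAct_base _ _).symm)
    (fun a u φ => by simp) (fun a u φ => by simp)
    (fun a u q => by simp [cons_tgt])
    (fun a u q => by simp [uAct_src_cons])
  exact ⟨G, h, fun u φ => by rw [h']; simp⟩

/-- The automorphism of the cup algebra acting in degree `p` as `εᵖ`. -/
def sg (Y : YetterDrinfeldAlgebra B N) (ε : k) : Y.Tot →ₗ[k] Y.Tot := (exists_sg Y ε).choose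

lemma sg_base (ε : k) (n : N) : Y.sg ε (Y.base n) = Y.base n := (exists_sg Y ε).choose_spec.1 n

lemma sg_cons (ε : k) (u : U) (φ : Y.Tot) :
    Y.sg ε (Y.cons u φ) = ε • Y.cons u (Y.sg ε φ) := (exists_sg Y ε).choose_spec.2 u φ

lemma sg_of_mem (ε : k) {p : ℕ} {φ : Y.Tot} (h : φ ∈ Y.deg p) : Y.sg ε φ = ε ^ p • φ := by
  refine deg_induction (P := fun p φ => Y.sg ε φ = ε ^ p • φ) ?_ ?_ ?_ h
  · intro p x y hx hy
    rw [map_add, hx, hy, smul_add]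
  · intro m
    rw [sg_base, pow_zero, one_smul]
  · intro p u x _ hx
    rw [sg_cons, hx, map_smul, smul_smul, pow_succ']

lemma sg_uAct (ε : k) (w : U) (φ : Y.Tot) : Y.sg ε (Y.uAct w φ) = Y.uAct w (Y.sg ε φ) := by
  induction φ using tot_induction_inc with
  | hadd φ φ' h h' => simp only [map_add, h, h']
  | h n x => rw [sg_of_mem ε (uAct_mem w (inc_mem_deg n x)), sg_of_mem ε (inc_mem_deg n x), map_smul]

lemma sg_cup (ε : k) (φ ψ : Y.Tot) : Y.sg ε (Y.cup φ ψ) = Y.cup (Y.sg ε φ) (Y.sg ε ψ) := by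
  induction φ using tot_induction_inc with
  | hadd φ φ' h h' => simp only [map_add, LinearMap.add_apply, h, h']
  | h n x =>
    induction ψ using tot_induction_inc with
    | hadd φ φ' h h' => simp only [map_add, h, h']
    | h m y =>
      rw [sg_of_mem ε (cup_mem rfl (inc_mem_deg n x) (inc_mem_deg m y)),
        sg_of_mem ε (inc_mem_deg n x), sg_of_mem ε (inc_mem_deg m y)]
      simp [smul_smul, pow_add, mul_comm]

lemma exists_pre (Y : YetterDrinfeldAlgebra B N) (ε : k) :
    ∃ G : Y.Tot →ₗ[k] Y.Tot →ₗ[k] Y.Tot, (∀ n, G (Y.base n) = 0) ∧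
      ∀ u φ, G (Y.cons u φ) = Y.actCup u φ + ε • Y.cons u ∘ₗ G φ := by
  obtain ⟨G, h, h'⟩ := exists_rec (Y := Y) (Q := Y.Tot →ₗ[k] Y.Tot) 0 Y.actCup
    (ε • (LinearMap.llcomp k Y.Tot Y.Tot Y.Tot).comp Y.cons)
    (fun a => LinearMap.llcomp k Y.Tot Y.Tot Y.Tot (Y.uAct (src B.η a)))
    (fun a n => by simp)
    (fun a u φ => by ext ψ; simp [actCup_apply, uAct_mul, cup_tgt])
    (fun a u φ => by ext ψ; simp [actCup_apply, uAct_mul, cup_src])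
    (fun a u q => by ext φ; simp [cons_tgt])
    (fun a u q => by ext φ; simp [uAct_src_cons])
  exact ⟨G, h, fun u φ => by rw [h']; rfl⟩

/-- The sum `∑_i ε^{i-1} φ ∘_i ψ`, a derivation of the cup product in `φ`. -/
def pre (Y : YetterDrinfeldAlgebra B N) (ε : k) : Y.Tot →ₗ[k] Y.Tot →ₗ[k] Y.Tot :=
  (exists_pre Y ε).choose

lemma pre_base (ε : k) (n : N) (ψ : Y.Tot) : Y.pre ε (Y.base n) ψ = 0 := by
  rw [pre, (exists_pre Y ε).choose_spec.1, LinearMap.zero_apply]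

lemma pre_cons (ε : k) (u : U) (φ ψ : Y.Tot) :
    Y.pre ε (Y.cons u φ) ψ = Y.cup (Y.uAct u ψ) φ + ε • Y.cons u (Y.pre ε φ ψ) := by
  rw [pre, (exists_pre Y ε).choose_spec.2]; rfl

lemma pre_eq_sum (ε : k) {p : ℕ} {φ : Y.Tot} (hφ : φ ∈ Y.deg p) (ψ : Y.Tot) :
    Y.pre ε φ ψ = ∑ i ∈ Finset.range p, ε ^ i • Y.ins (i + 1) φ ψ := by
  refine deg_induction (P := fun p φ => Y.pre ε φ ψ =
    ∑ i ∈ Finset.range p, ε ^ i • Y.ins (i + 1) φ ψ) ?_ ?_ ?_ hφ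
  · intro p x y hx hy
    simp only [map_add, LinearMap.add_apply, hx, hy, smul_add, Finset.sum_add_distrib]
  · intro m
    simp [pre_base]
  · intro p u x _ hx
    rw [pre_cons, hx, Finset.sum_range_succ', add_comm]
    simp only [ins_succ_cons, zero_add, ins_one_cons, pow_zero, one_smul, map_sum, map_smul,
      Finset.smul_sum, smul_smul, pow_succ']

lemma pre_mem (ε : k) {p q n : ℕ} (hn : p + q = n + 1) {φ ψ : Y.Tot} (hφ : φ ∈ Y.deg p)
    (hψ : ψ ∈ Y.deg q) : Y.pre ε φ ψ ∈ Y.deg n := by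
  rw [pre_eq_sum ε hφ]
  exact sum_mem fun i _ => Submodule.smul_mem _ _ (ins_mem hn _ hφ hψ)

lemma pre_deg_zero (ε : k) {φ : Y.Tot} (hφ : φ ∈ Y.deg 0) (ψ : Y.Tot) : Y.pre ε φ ψ = 0 := by
  rw [pre_eq_sum ε hφ, Finset.sum_range_zero]

lemma pre_uAct (ε : k) (w : U) (φ ψ : Y.Tot) :
    Y.pre ε (Y.uAct w φ) ψ = Y.uAct w (Y.pre ε φ ψ) := by
  induction φ using tot_induction_inc with
  | hadd φ φ' h h' => simp only [map_add, LinearMap.add_apply, h, h']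
  | h n x =>
    rw [pre_eq_sum ε (uAct_mem w (inc_mem_deg n x)), pre_eq_sum ε (inc_mem_deg n x), map_sum]
    simp only [map_smul, uAct_ins]

lemma pre_nAct (hY : Y.IsBraidedCommutative) (ε : k) (m : N) (φ ψ : Y.Tot) :
    Y.pre ε (Y.nAct m φ) ψ = Y.nAct m (Y.pre ε φ ψ) := by
  induction φ using tot_induction_inc with
  | hadd φ φ' h h' => simp only [map_add, LinearMap.add_apply, h, h']
  | h n x =>
    rw [pre_eq_sum ε (nAct_mem m (inc_mem_deg n x)), pre_eq_sum ε (inc_mem_deg n x), map_sum]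
    simp only [map_smul, ins_nAct hY]

/-- Summing `ins_cup_left` and `ins_cup_right` over all slots gives a skew derivation; passing the p
slots of φ costs the factor εᵖ, carried by `sg`. -/
lemma pre_cup (hY : Y.IsBraidedCommutative) (ε : k) (φ φ' ψ : Y.Tot) :
    Y.pre ε (Y.cup φ φ') ψ =
      Y.cup (Y.pre ε φ ψ) φ' + Y.cup (Y.sg ε φ) (Y.pre ε φ' ψ) := by
  induction φ using tot_induction with
  | hadd φ φ' h h' => simp only [map_add, LinearMap.add_apply, h, h']; abel
  | hbase m => rw [cup_base, pre_nAct hY, pre_base, sg_base, cup_base, map_zero,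
      LinearMap.zero_apply, zero_add]
  | hcons u φ ih =>
    simp only [cup_cons, pre_cons, sg_cons, ih, map_add, map_smul, LinearMap.add_apply,
      LinearMap.smul_apply, smul_add, cup_assoc, add_assoc]

/-- The pre-Lie identity. -/
lemma pre_pre (hY : Y.IsBraidedCommutative) {ε δ s : k} (hs : s * s = 1) {ψ χ : Y.Tot}
    (hψ : Y.sg δ ψ = (s * δ) • ψ) (hχ : Y.sg ε χ = (s * ε) • χ) (φ : Y.Tot) :
    Y.pre δ (Y.pre ε φ ψ) χ - s • Y.pre ε (Y.pre δ φ χ) ψ =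
      Y.pre (ε * δ) φ (Y.pre δ ψ χ) - s • Y.pre (ε * δ) φ (Y.pre ε χ ψ) := by
  induction φ using tot_induction with
  | hadd φ φ' h h' =>
    simp only [map_add, LinearMap.add_apply, smul_add]
    linear_combination (norm := abel) h + h'
  | hbase m => simp [pre_base]
  | hcons u φ ih =>
    -- The terms with both ψ and χ to the right of u, each insertion passing u at the cost of one
    -- sign. Of the others, those with one insertion at u and one in φ cancel because s² = 1, and
    -- those nested at u give the first summands on the right.
    have ih' := congrArg (fun ξ => (ε * δ) • Y.cons u ξ) ih
    simp only [map_sub, map_smul, smul_sub] at ih'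
    simp only [pre_cons, map_add, map_smul, LinearMap.add_apply, LinearMap.smul_apply, pre_cup hY,
      sg_uAct, hψ, hχ, pre_uAct, smul_add, smul_smul]
    have e : s * (s * ε) = ε := by rw [← mul_assoc, hs, one_mul]
    simp only [e, smul_smul] at ih' ⊢
    linear_combination (norm := skip) ih'
    simp only [mul_comm, mul_left_comm]
    abel

/-- Twice this identity is `pre_pre` with χ = ψ and ε = δ = s = -1. Proving it directly avoids
dividing by 2, and it is what gives {φ, {φ, φ}} = 0 over any k. -/
lemma pre_pre_self (hY : Y.IsBraidedCommutative) {ψ : Y.Tot} (hψ : Y.sg (-1 : k) ψ = ψ)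
    (φ : Y.Tot) : Y.pre (-1 : k) (Y.pre (-1 : k) φ ψ) ψ = Y.pre 1 φ (Y.pre (-1 : k) ψ ψ) := by
  induction φ using tot_induction with
  | hadd φ φ' h h' => simp only [map_add, LinearMap.add_apply, h, h']
  | hbase m => simp [pre_base]
  | hcons u φ ih =>
    simp only [pre_cons, map_add, map_neg, neg_smul, one_smul, LinearMap.add_apply,
      LinearMap.neg_apply, pre_cup hY, sg_uAct, hψ, pre_uAct, ih]
    abel

lemma exists_brace (Y : YetterDrinfeldAlgebra B N) (ε δ : k) :
    ∃ G : Y.Tot →ₗ[k] Y.Tot →ₗ[k] Y.Tot →ₗ[k] Y.Tot, (∀ n, G (Y.base n) = 0) ∧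
      ∀ u φ, G (Y.cons u φ) = δ • Y.cup.compl₁₂ (Y.uAct u) (Y.pre δ φ) +
        (ε * δ) • (G φ).compr₂ (Y.cons u) := by
  obtain ⟨G, h, h'⟩ := exists_rec (Y := Y) (Q := Y.Tot →ₗ[k] Y.Tot →ₗ[k] Y.Tot) 0
    (LinearMap.mk₂ k (fun u φ => δ • Y.cup.compl₁₂ (Y.uAct u) (Y.pre δ φ))
      (fun a a' b => by ext c c'; simp) (fun t a b => by ext c c'; simp [smul_comm t δ])
      (fun a b b' => by ext c c'; simp) (fun t a b => by ext c c'; simp [smul_comm t δ]))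
    (LinearMap.mk₂ k (fun u q => (ε * δ) • q.compr₂ (Y.cons u))
      (fun a a' b => by ext c c'; simp) (fun t a b => by ext c c'; simp [smul_comm t (ε * δ)])
      (fun a b b' => by ext c c'; simp) (fun t a b => by ext c c'; simp [smul_comm t (ε * δ)]))
    (fun a => { toFun := fun q => q.compr₂ (Y.uAct (src B.η a))
                map_add' := fun q q' => by ext c c'; simp
                map_smul' := fun t q => by ext c c'; simp })
    (fun a n => by ext c c'; simp)
    (fun a u φ => by ext c c'; simp [uAct_mul, cup_tgt, pre_uAct])
    (fun a u φ => by ext c c'; simp [uAct_mul, cup_src])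
    (fun a u q => by ext c c'; simp [cons_tgt])
    (fun a u q => by ext c c'; simp [uAct_src_cons])
  exact ⟨G, h, fun u φ => by rw [h']; rfl⟩

/-- The brace `∑_{i < j} ± (φ ∘_j β) ∘_i α`. -/
def brace (Y : YetterDrinfeldAlgebra B N) (ε δ : k) :
    Y.Tot →ₗ[k] Y.Tot →ₗ[k] Y.Tot →ₗ[k] Y.Tot :=
  (exists_brace Y ε δ).choose

lemma brace_base (ε δ : k) (n : N) (α β : Y.Tot) : Y.brace ε δ (Y.base n) α β = 0 := by
  rw [brace, (exists_brace Y ε δ).choose_spec.1, LinearMap.zero_apply, LinearMap.zero_apply]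

lemma brace_cons (ε δ : k) (u : U) (φ α β : Y.Tot) : Y.brace ε δ (Y.cons u φ) α β =
    δ • Y.cup (Y.uAct u α) (Y.pre δ φ β) + (ε * δ) • Y.cons u (Y.brace ε δ φ α β) := by
  rw [brace, (exists_brace Y ε δ).choose_spec.2]; rfl

lemma brace_uAct (ε δ : k) (w : U) (φ α β : Y.Tot) :
    Y.brace ε δ (Y.uAct w φ) α β = Y.uAct w (Y.brace ε δ φ α β) := by
  induction φ using tot_induction generalizing w with
  | hadd φ φ' h h' => simp only [map_add, LinearMap.add_apply, h, h']
  | hbase m => simp [uAct_base, brace_base]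
  | hcons u φ ih =>
    obtain ⟨r, x, y, h⟩ := B.exists_comul_rep w
    rw [uAct_cons h, brace_cons, map_add, map_smul, map_smul, uAct_cup h, uAct_cons h, map_sum,
      LinearMap.sum_apply, LinearMap.sum_apply]
    simp only [brace_cons, ih, pre_uAct, uAct_mul, Finset.sum_add_distrib, Finset.smul_sum]

lemma brace_nAct (hY : Y.IsBraidedCommutative) (ε δ : k) (m : N) (φ α β : Y.Tot) :
    Y.brace ε δ (Y.nAct m φ) α β = Y.nAct m (Y.brace ε δ φ α β) := by
  induction φ using tot_induction generalizing m with
  | hadd φ φ' h h' => simp only [map_add, LinearMap.add_apply, h, h']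
  | hbase m => simp [nAct_base, brace_base]
  | hcons u φ ih =>
    obtain ⟨r, x, y, h⟩ := Y.exists_coact_rep m
    rw [nAct_cons h, brace_cons, map_add, map_smul, map_smul, ← cup_braided hY h, nAct_cons h,
      map_sum, LinearMap.sum_apply, LinearMap.sum_apply]
    simp only [brace_cons, ih, pre_nAct hY, uAct_mul, Finset.sum_add_distrib, Finset.smul_sum]

/-- A Leibniz rule of second order: both insertions into φ, α into φ and β into φ', or both into φ'.
The order of α before β excludes the fourth possibility. -/
lemma brace_cup (hY : Y.IsBraidedCommutative) (ε δ : k) (φ φ' α β : Y.Tot) :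
    Y.brace ε δ (Y.cup φ φ') α β =
      Y.cup (Y.brace ε δ φ α β) φ' + Y.cup (Y.pre ε (Y.sg δ φ) α) (Y.pre δ φ' β) +
        Y.cup (Y.sg (ε * δ) φ) (Y.brace ε δ φ' α β) := by
  induction φ using tot_induction with
  | hadd φ φ' h h' => simp only [map_add, LinearMap.add_apply, h, h']; abel
  | hbase m =>
    simp only [cup_base, brace_nAct hY, brace_base, sg_base, pre_base, map_zero,
      LinearMap.zero_apply, zero_add]
  | hcons u φ ih =>
    simp only [cup_cons, brace_cons, sg_cons, ih, map_add, map_smul, LinearMap.add_apply,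
      LinearMap.smul_apply, smul_add, pre_cup hY, pre_cons, cup_assoc, smul_smul, mul_comm ε δ]
    abel

lemma sg_mulElem {δ : k} (hδ : δ * δ = 1) : Y.sg δ Y.mulElem = Y.mulElem := by
  rw [sg_of_mem δ mulElem_mem, pow_two, hδ, one_smul]

lemma pre_idElem (ε : k) (ψ : Y.Tot) : Y.pre ε Y.idElem ψ = ψ := by
  rw [idElem, pre_cons, pre_base, uAct_one, cup_one, map_zero, smul_zero, add_zero]

lemma pre_mulElem (ε : k) (ψ : Y.Tot) :
    Y.pre ε Y.mulElem ψ = Y.cup ψ Y.idElem + ε • Y.cup Y.idElem ψ := by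
  rw [mulElem, pre_cons, uAct_one, pre_idElem, idElem_cup]

lemma brace_idElem (ε δ : k) (α β : Y.Tot) : Y.brace ε δ Y.idElem α β = 0 := by
  simp [idElem, brace_cons, brace_base, pre_base]

lemma brace_mulElem (ε δ : k) (α β : Y.Tot) :
    Y.brace ε δ Y.mulElem α β = δ • Y.cup α β := by
  rw [mulElem, brace_cons, brace_idElem, pre_idElem, uAct_one, map_zero, smul_zero, add_zero]

/-- The homotopy formula behind the Leibniz rule. Up to sign, the differences inside the braces on
the right are βα and ββ (the coboundaries of α and β), so for cocycles only the last term survives,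
and there `brace_mulElem` produces γ-type insertions of ±α ⌣ β. -/
lemma pre_brace (hY : Y.IsBraidedCommutative) {ε δ : k} (hε : ε = 1 ∨ ε = -1)
    (hδ : δ = 1 ∨ δ = -1) {α β : Y.Tot} (hα : Y.sg (-1 : k) α = -ε • α)
    (hβ : Y.sg (-1 : k) β = -δ • β) (φ : Y.Tot) :
    Y.pre (-1 : k) (Y.brace ε δ φ α β) Y.mulElem -
        (ε * δ) • Y.brace ε δ (Y.pre (-1 : k) φ Y.mulElem) α β =
      Y.brace (-ε) δ φ (Y.pre (-1 : k) α Y.mulElem - ε • Y.pre ε Y.mulElem α) β +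
        ε • Y.brace ε (-δ) φ α (Y.pre (-1 : k) β Y.mulElem - δ • Y.pre δ Y.mulElem β) -
        (ε * δ) • Y.pre (-(ε * δ)) φ (Y.brace ε δ Y.mulElem α β) := by
  have hδ' : δ * δ = 1 := by rcases hδ with rfl | rfl <;> simp
  induction φ using tot_induction with
  | hadd φ φ' h h' =>
    simp only [map_add, LinearMap.add_apply, smul_add]
    linear_combination (norm := abel) h + h'
  | hbase m => simp [pre_base, brace_base]
  | hcons u φ ih =>
    have ih' := congrArg (fun ξ => (-(ε * δ)) • Y.cons u ξ) ih
    -- With α already in the factor u, what remains is to compare insertions of β and μ into φ: the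
    -- pre-Lie identity for that pair.
    have hp := pre_pre hY (ε := δ) (δ := -1) (s := δ) hδ' (ψ := β) (χ := Y.mulElem)
      (by rw [hβ, mul_neg_one]) (by rw [sg_mulElem hδ', hδ', one_smul]) φ
    have hp' := congrArg (fun ξ => (-1 : k) • Y.cup (Y.uAct u α) ξ) hp
    have h1 : Y.sg (1 : k) Y.mulElem = Y.mulElem := sg_mulElem (by simp)
    have h2 : Y.sg (-1 : k) Y.mulElem = Y.mulElem := sg_mulElem (by simp)
    simp only [map_sub, map_smul, map_add, smul_sub, smul_add, mul_neg_one] at ih' hp'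
    -- Once both signs are numbers, the identity is a relation in an abelian group.
    rcases hε with rfl | rfl <;> rcases hδ with rfl | rfl <;>
    simp only [pre_cons, brace_cons, map_add, map_sub, LinearMap.add_apply,
      LinearMap.sub_apply, pre_cup hY, brace_cup hY, sg_uAct, hα,
      pre_uAct, brace_uAct, smul_add, smul_sub, one_smul, neg_smul,
      mul_one, neg_neg, mul_neg, map_neg, LinearMap.neg_apply, h1, h2,
      smul_neg] at ih' hp' ⊢
    · linear_combination (norm := abel) ih' + hp'
    · linear_combination (norm := abel) ih' - hp'
    · linear_combination (norm := abel) ih' - hp'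
    · linear_combination (norm := abel) ih' + hp'

end YetterDrinfeldAlgebra

end

end BialgebroidCohomology

namespace BialgebroidCohomology

noncomputable section

/-! # Differential and bracket on the total cochain space -/

namespace YetterDrinfeldAlgebra

variable {k : Type v} {A U N : Type u} [CommRing k] [Ring A] [Algebra k A] [Ring U] [Algebra k U]
  [Ring N] [Algebra k N] [Module U N] [IsScalarTower k U N] {B : LeftBialgebroid k A U}
  {Y : YetterDrinfeldAlgebra B N}

variable (Y) in
/-- The coboundary on the total cochain space. -/
def dTot : Y.Tot →ₗ[k] Y.Tot :=
  Y.cup Y.idElem - Y.cup.flip Y.idElem ∘ₗ Y.sg (-1) - (Y.pre (-1)).flip Y.mulElem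

lemma dTot_apply (φ : Y.Tot) : Y.dTot φ =
    Y.cup Y.idElem φ - Y.cup (Y.sg (-1 : k) φ) Y.idElem - Y.pre (-1 : k) φ Y.mulElem := rfl

lemma uAct_mulElem {w : U} {r : ℕ} {x y : Fin r → U} (h : IsRep (B.comul w) x y) :
    Y.uAct w Y.mulElem = ∑ i, Y.cons (x i) (Y.cons (y i) (Y.base 1)) := by
  rw [mulElem, uAct_cons h]
  simp only [uAct_idElem, mul_one]

/-- Inserting μ at a factor u gives u₍₁₎ ⊗ u₍₂₎ by `uAct_mulElem`, so these insertions are the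
coproduct cofaces; appending id gives n·id = n₍₋₁₎ ⊗ n₍₀₎, the coaction coface. -/
lemma inc_cobar (n : ℕ) (x : Y.toComodule.C n) : Y.inc (n + 1) (Y.toComodule.cobar n x) =
    Y.cup (Y.sg (-1 : k) (Y.inc n x)) Y.idElem + Y.pre (-1 : k) (Y.inc n x) Y.mulElem := by
  induction n with
  | zero =>
    obtain ⟨r, y, z, h⟩ := Y.exists_coact_rep x
    have h0 : Y.inc 0 x = Y.base x := rfl
    rw [h0, sg_base, cup_base, pre_base, add_zero, idElem, nAct_cons h]
    refine (congrArg _ (h : _ = _)).trans ((map_sum _ _ _).trans ?_)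
    refine Finset.sum_congr rfl fun i _ => ?_
    rw [nAct_base, mul_one, mul_one]
    exact (cons_inc (y i) 0 (z i)).symm
  | succ n ih =>
    induction x using tens_induction (η := B.η) (X := Y.toComodule.C n) with
    | ht u x =>
      obtain ⟨r, y, z, h⟩ := B.exists_comul_rep u
      have hx : Y.inc (n + 1) (tmul B.η (Y.toComodule.C n) u x) = Y.cons u (Y.inc n x) :=
        (cons_inc u n x).symm
      have hx' : Y.inc (n + 1 + 1) (tmul B.η (Y.toComodule.C (n + 1)) u (Y.toComodule.cobar n x)) =
          Y.cons u (Y.inc (n + 1) (Y.toComodule.cobar n x)) := (cons_inc u (n + 1) _).symm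
      rw [LeftComodule.cobar_succ_apply, tensMap_tmul, B.comulTens_rep _ _ h, map_sub, map_sum,
        hx, sg_cons, pre_cons, hx', ih, uAct_mulElem h, map_sum, LinearMap.sum_apply]
      simp only [cup_cons, one_cup, neg_smul, one_smul, map_neg, LinearMap.neg_apply, map_add]
      have e : ∀ i, Y.inc (n + 1 + 1) (tmul B.η (tens B.η (Y.toComodule.C n)) (y i)
          (tmul B.η (Y.toComodule.C n) (z i) x)) = Y.cons (y i) (Y.cons (z i) (Y.inc n x)) :=
        fun i => by rw [cons_inc, cons_inc]
      simp only [e]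
      abel
    | ha z z' h h' => simp only [map_add, LinearMap.add_apply, h, h']; abel

lemma inc_diff (n : ℕ) (x : Y.toComodule.C n) :
    Y.inc (n + 1) (Y.toComodule.diff n x) = Y.dTot (Y.inc n x) := by
  rw [LeftComodule.diff_apply, map_sub, inc_cobar, dTot_apply, idElem_cup, cons_inc, sub_sub]

lemma dTot_mem {n : ℕ} {φ : Y.Tot} (h : φ ∈ Y.deg n) : Y.dTot φ ∈ Y.deg (n + 1) := by
  obtain ⟨x, rfl⟩ := h
  rw [← inc_diff]
  exact inc_mem_deg _ _

lemma sg_idElem (ε : k) : Y.sg ε Y.idElem = ε • Y.idElem := by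
  rw [sg_of_mem ε idElem_mem, pow_one]

/-- β is the graded commutator with id minus the skew derivation `pre (-1)` at μ, and both obey this
rule. -/
lemma dTot_cup (hY : Y.IsBraidedCommutative) (φ ψ : Y.Tot) :
    Y.dTot (Y.cup φ ψ) = Y.cup (Y.dTot φ) ψ + Y.cup (Y.sg (-1 : k) φ) (Y.dTot ψ) := by
  simp only [dTot_apply, sg_cup, pre_cup hY, map_sub, LinearMap.sub_apply, cup_assoc]
  abel

lemma dTot_one : Y.dTot (Y.base 1) = 0 := by
  rw [dTot_apply, sg_base, cup_one, one_cup, pre_base, sub_self, sub_zero]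

lemma dTot_sg (φ : Y.Tot) : Y.dTot (Y.sg (-1 : k) φ) = -Y.sg (-1 : k) (Y.dTot φ) := by
  induction φ using tot_induction_inc with
  | hadd φ φ' h h' => simp only [map_add, h, h', neg_add]
  | h n x =>
    rw [sg_of_mem _ (dTot_mem (inc_mem_deg n x)), sg_of_mem _ (inc_mem_deg n x), map_smul,
      pow_succ, mul_neg_one, neg_smul, neg_neg]

/-- Bilinear maps on the total cochain space, given on homogeneous components. -/
def totLift₂ (Y : YetterDrinfeldAlgebra B N) {P : Type*} [AddCommGroup P] [Module k P]
    (f : ∀ p q, Y.toComodule.C p →ₗ[k] Y.toComodule.C q →ₗ[k] P) : Y.Tot →ₗ[k] Y.Tot →ₗ[k] P :=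
  Y.totLift fun p => (Y.totLift fun q => (f p q).flip).flip

lemma totLift₂_inc {P : Type*} [AddCommGroup P] [Module k P]
    (f : ∀ p q, Y.toComodule.C p →ₗ[k] Y.toComodule.C q →ₗ[k] P) {p q : ℕ}
    (x : Y.toComodule.C p) (y : Y.toComodule.C q) :
    Y.totLift₂ f (Y.inc p x) (Y.inc q y) = f p q x y := by
  simp [totLift₂, totLift_inc]

variable (Y) in
/-- The Gerstenhaber bracket on the total cochain space. -/
def brTot : Y.Tot →ₗ[k] Y.Tot →ₗ[k] Y.Tot :=
  Y.totLift₂ fun p q =>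
    (-1 : k) ^ ((p + 1) * (q + 1)) • (Y.pre ((-1) ^ (q + 1))).compl₁₂ (Y.inc p) (Y.inc q) -
      (Y.pre ((-1) ^ (p + 1))).flip.compl₁₂ (Y.inc p) (Y.inc q)

lemma brTot_of_mem {p q : ℕ} {φ ψ : Y.Tot} (hφ : φ ∈ Y.deg p) (hψ : ψ ∈ Y.deg q) :
    Y.brTot φ ψ = (-1 : k) ^ ((p + 1) * (q + 1)) • Y.pre ((-1 : k) ^ (q + 1)) φ ψ -
      Y.pre ((-1 : k) ^ (p + 1)) ψ φ := by
  obtain ⟨x, rfl⟩ := hφ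
  obtain ⟨y, rfl⟩ := hψ
  rw [brTot, totLift₂_inc]
  rfl

lemma brTot_mem {p q n : ℕ} (hn : p + q = n + 1) {φ ψ : Y.Tot} (hφ : φ ∈ Y.deg p)
    (hψ : ψ ∈ Y.deg q) : Y.brTot φ ψ ∈ Y.deg n := by
  rw [brTot_of_mem hφ hψ]
  exact sub_mem (Submodule.smul_mem _ _ (pre_mem _ hn hφ hψ))
    (pre_mem _ ((Nat.add_comm q p).trans hn) hψ hφ)

lemma brTot_deg_zero {φ ψ : Y.Tot} (hφ : φ ∈ Y.deg 0) (hψ : ψ ∈ Y.deg 0) : Y.brTot φ ψ = 0 := by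
  rw [brTot_of_mem hφ hψ, pre_deg_zero _ hφ, pre_deg_zero _ hψ, smul_zero, sub_zero]

/-! ### Parities, the bracket and the Jacobi identity. -/

variable (Y) in
/-- The element is homogeneous of a degree `p` such that `p - 1` has the parity of `m`. -/
def HasParity (m : ℕ) (φ : Y.Tot) : Prop := ∃ p, φ ∈ Y.deg p ∧ Even (p + 1 + m)

lemma hasParity_of_mem {p : ℕ} {φ : Y.Tot} (h : φ ∈ Y.deg p) : Y.HasParity (p + 1) φ :=
  ⟨p, h, ⟨p + 1, rfl⟩⟩

lemma neg_one_pow_congr {m n : ℕ} (h : Even (m + n)) : (-1 : k) ^ m = (-1) ^ n := by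
  rw [Nat.even_add] at h
  rcases Nat.even_or_odd m with hm | hm
  · rw [hm.neg_one_pow, (h.1 hm).neg_one_pow]
  · rw [hm.neg_one_pow, (Nat.not_even_iff_odd.1 fun hn => Nat.not_even_iff_odd.2 hm
      (h.2 hn)).neg_one_pow]

lemma neg_one_pow_mul_self (n : ℕ) : (-1 : k) ^ n * (-1) ^ n = 1 := by
  rw [← mul_pow, neg_one_mul, neg_neg, one_pow]

lemma HasParity.sg {m : ℕ} {φ : Y.Tot} (h : Y.HasParity m φ) (n : ℕ) :
    Y.sg ((-1 : k) ^ n) φ = ((-1 : k) ^ (m * n) * (-1 : k) ^ n) • φ := by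
  obtain ⟨p, hp, h⟩ := h
  rw [sg_of_mem _ hp, ← pow_mul, ← pow_add, neg_one_pow_congr (m := n * p) (n := m * n + n)]
  rw [show n * p + (m * n + n) = n * (p + 1 + m) by ring]
  exact h.mul_left n

lemma brTot_of_parity {a b : ℕ} {φ ψ : Y.Tot} (hφ : Y.HasParity a φ) (hψ : Y.HasParity b ψ) :
    Y.brTot φ ψ = (-1 : k) ^ (a * b) • Y.pre ((-1 : k) ^ b) φ ψ - Y.pre ((-1 : k) ^ a) ψ φ := by
  obtain ⟨p, hp, ha⟩ := hφ
  obtain ⟨q, hq, hb⟩ := hψ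
  rw [brTot_of_mem hp hq, pow_mul, pow_mul, neg_one_pow_congr ha, neg_one_pow_congr hb, ← pow_mul,
    mul_comm a, pow_mul, neg_one_pow_congr hb, ← pow_mul, mul_comm b, pow_mul]

lemma HasParity.brTot {a b : ℕ} {φ ψ : Y.Tot} (hφ : Y.HasParity a φ) (hψ : Y.HasParity b ψ) :
    Y.HasParity (a + b) (Y.brTot φ ψ) := by
  obtain ⟨p, hp, ha⟩ := hφ
  obtain ⟨q, hq, hb⟩ := hψ
  by_cases h : p + q = 0
  · obtain ⟨rfl, rfl⟩ : p = 0 ∧ q = 0 := by omega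
    rw [brTot_deg_zero hp hq]
    -- The bracket of two elements of degree 0 would have degree -1 and is zero, which is
    -- homogeneous of any degree; a + b + 1 has the right parity. Working with parities thus keeps
    -- degree 0 out of the later identities.
    exact ⟨a + b + 1, zero_mem _, ⟨a + b + 1, by ring⟩⟩
  · obtain ⟨n, hn⟩ := Nat.exists_eq_add_of_le' (Nat.one_le_iff_ne_zero.2 h)
    refine ⟨n, brTot_mem hn hp hq, ?_⟩
    rw [← hn]
    have := ha.add hb
    rw [show p + 1 + a + (q + 1 + b) = p + q + (a + b) + 2 by ring] at this
    exact (Nat.even_add.1 this).2 even_two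

lemma hasParity_mulElem : Y.HasParity 1 Y.mulElem := ⟨2, mulElem_mem, by decide⟩

lemma dTot_eq_brTot {a : ℕ} {φ : Y.Tot} (h : Y.HasParity a φ) :
    Y.dTot φ = Y.brTot Y.mulElem φ := by
  have h1 := h.sg 1
  rw [pow_one, mul_one, mul_neg_one, neg_smul] at h1
  rw [brTot_of_parity hasParity_mulElem h, pre_mulElem, dTot_apply, h1, pow_one, one_mul, smul_add,
    smul_smul, neg_one_pow_mul_self, one_smul, map_neg, map_smul, LinearMap.neg_apply,
    LinearMap.smul_apply]
  abel

lemma brTot_antisymm {a b : ℕ} {φ ψ : Y.Tot} (hφ : Y.HasParity a φ) (hψ : Y.HasParity b ψ) :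
    Y.brTot φ ψ = -((-1 : k) ^ (a * b) • Y.brTot ψ φ) := by
  rw [brTot_of_parity hφ hψ, brTot_of_parity hψ hφ, smul_sub, smul_smul, mul_comm b a,
    neg_one_pow_mul_self, one_smul, neg_sub]

lemma brTot_self {a : ℕ} (ha : Even a) {φ : Y.Tot} (hφ : Y.HasParity a φ) : Y.brTot φ φ = 0 := by
  rw [brTot_of_parity hφ hφ, ha.neg_one_pow, (ha.mul_left a).neg_one_pow, one_smul, sub_self]

lemma brTot_brTot_self (hY : Y.IsBraidedCommutative) {a : ℕ} (ha : Odd a) {φ : Y.Tot}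
    (hφ : Y.HasParity a φ) : Y.brTot φ (Y.brTot φ φ) = 0 := by
  have h1 := hφ.sg 1
  rw [mul_one, pow_one, ha.neg_one_pow, neg_one_mul, neg_neg, one_smul] at h1
  rw [brTot_of_parity hφ (hφ.brTot hφ), brTot_of_parity hφ hφ, ha.neg_one_pow,
    (ha.mul ha).neg_one_pow, (ha.add_odd ha).neg_one_pow,
    ((ha.add_odd ha).mul_left a).neg_one_pow]
  simp only [map_sub, map_neg, neg_smul, one_smul, LinearMap.sub_apply, LinearMap.neg_apply,
    pre_pre_self hY h1]
  abel

lemma pre_pre_of_parity (hY : Y.IsBraidedCommutative) {b c : ℕ} {ψ χ : Y.Tot}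
    (hψ : Y.HasParity b ψ) (hχ : Y.HasParity c χ) (φ : Y.Tot) :
    Y.pre ((-1 : k) ^ c) (Y.pre ((-1 : k) ^ b) φ ψ) χ -
        (-1 : k) ^ (b * c) • Y.pre ((-1 : k) ^ b) (Y.pre ((-1 : k) ^ c) φ χ) ψ =
      Y.pre ((-1 : k) ^ (b + c)) φ (Y.pre ((-1 : k) ^ c) ψ χ) -
        (-1 : k) ^ (b * c) • Y.pre ((-1 : k) ^ (b + c)) φ (Y.pre ((-1 : k) ^ b) χ ψ) := by
  rw [pow_add]
  exact pre_pre hY (neg_one_pow_mul_self _) (hψ.sg c) (by rw [hχ.sg b, mul_comm c b]) φ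

/-- The graded commutator of a pre-Lie operation satisfies Jacobi: the three pre-Lie identities with
φ, ψ and χ as outer element account for all terms. -/
lemma brTot_jacobi (hY : Y.IsBraidedCommutative) {a b c : ℕ} {φ ψ χ : Y.Tot}
    (hφ : Y.HasParity a φ) (hψ : Y.HasParity b ψ) (hχ : Y.HasParity c χ) :
    Y.brTot φ (Y.brTot ψ χ) =
      Y.brTot (Y.brTot φ ψ) χ + (-1 : k) ^ (a * b) • Y.brTot ψ (Y.brTot φ χ) := by
  have h1 := pre_pre_of_parity hY hψ hχ φ
  have h2 := pre_pre_of_parity hY hφ hχ ψ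
  have h3 := pre_pre_of_parity hY hφ hψ χ
  rw [brTot_of_parity hφ (hψ.brTot hχ), brTot_of_parity (hφ.brTot hψ) hχ,
    brTot_of_parity hψ (hφ.brTot hχ), brTot_of_parity hψ hχ, brTot_of_parity hφ hψ,
    brTot_of_parity hφ hχ, mul_add, add_mul, mul_add, mul_comm b a]
  simp only [pow_add (-1 : k) (a * b), pow_add (-1 : k) (a * c)]
  linear_combination (norm := skip)
    (-((-1 : k) ^ (a * b) * (-1 : k) ^ (a * c) * (-1 : k) ^ (b * c))) • h1 +
      ((-1 : k) ^ (a * c) * (-1 : k) ^ (b * c)) • h2 - (-1 : k) ^ (a * b) • h3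
  rcases neg_one_pow_eq_or k (a * b) with e1 | e1 <;>
    rcases neg_one_pow_eq_or k (a * c) with e2 | e2 <;>
    rcases neg_one_pow_eq_or k (b * c) with e3 | e3 <;>
    simp only [e1, e2, e3, map_sub, map_neg, neg_smul, one_smul, LinearMap.sub_apply,
      LinearMap.neg_apply, one_mul, neg_mul, neg_neg, smul_neg, smul_sub] <;> abel

/-- Jacobi for μ, φ, ψ, since β = {μ, ·}. -/
lemma dTot_brTot (hY : Y.IsBraidedCommutative) {a b : ℕ} {φ ψ : Y.Tot} (hφ : Y.HasParity a φ)
    (hψ : Y.HasParity b ψ) :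
    Y.dTot (Y.brTot φ ψ) = Y.brTot (Y.dTot φ) ψ + (-1 : k) ^ a • Y.brTot φ (Y.dTot ψ) := by
  rw [dTot_eq_brTot (hφ.brTot hψ), dTot_eq_brTot hφ, dTot_eq_brTot hψ,
    brTot_jacobi hY hasParity_mulElem hφ hψ, one_mul]

/-! ### Homotopies: graded commutativity and the Leibniz rule on cocycles. -/

lemma sg_pre (ε : k) {p q : ℕ} {φ ψ : Y.Tot} (hφ : φ ∈ Y.deg p) (hψ : ψ ∈ Y.deg q) :
    Y.sg (-1 : k) (Y.pre ε φ ψ) = (-1 : k) ^ (p + q + 1) • Y.pre ε φ ψ := by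
  rcases p with _ | p
  · rw [pre_deg_zero _ hφ, map_zero, smul_zero]
  · have hn : p + 1 + q = p + q + 1 := by ring
    rw [sg_of_mem _ (pre_mem ε hn hφ hψ), hn, add_assoc (p + q), pow_add _ _ (1 + 1),
      neg_one_sq, mul_one]

lemma sg_brace (ε δ : k) {p q r : ℕ} {φ α β : Y.Tot} (hφ : φ ∈ Y.deg p) (hα : α ∈ Y.deg q)
    (hβ : β ∈ Y.deg r) : Y.sg (-1 : k) (Y.brace ε δ φ α β) =
      (-1 : k) ^ (p + q + r) • Y.brace ε δ φ α β := by
  refine deg_induction (P := fun p φ => Y.sg (-1 : k) (Y.brace ε δ φ α β) =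
      (-1 : k) ^ (p + q + r) • Y.brace ε δ φ α β) ?_ ?_ ?_ hφ
  · intro p x y hx hy
    simp only [map_add, LinearMap.add_apply, hx, hy, smul_add]
  · intro m
    rw [brace_base, map_zero, smul_zero]
  · intro p u x hx ih
    rw [brace_cons, map_add, map_smul, map_smul, sg_cup, sg_cons, ih, sg_pre _ hx hβ,
      sg_of_mem _ (uAct_mem u hα), map_smul, map_smul, map_smul, LinearMap.smul_apply]
    module

/-- The equation {μ, φ} = 0, used to exchange insertions of μ into φ with insertions of φ into μ. -/
lemma pre_mulElem_of_cocycle {a : ℕ} {φ : Y.Tot}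
    (h : Y.HasParity a φ) (hd : Y.dTot φ = 0) :
    Y.pre (-1 : k) φ Y.mulElem = (-1 : k) ^ a • Y.pre ((-1 : k) ^ a) Y.mulElem φ := by
  rw [dTot_eq_brTot h, brTot_of_parity hasParity_mulElem h, one_mul, pow_one, sub_eq_zero] at hd
  exact hd.symm

lemma cup_comm_of_cocycle (hY : Y.IsBraidedCommutative) {p q : ℕ} {φ ψ : Y.Tot}
    (hφ : φ ∈ Y.deg p) (hψ : ψ ∈ Y.deg q) (hdφ : Y.dTot φ = 0) (hdψ : Y.dTot ψ = 0) :
    Y.cup φ ψ - (-1 : k) ^ (p * q) • Y.cup ψ φ ∈ LinearMap.range Y.dTot := by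
  -- For the pair ψ, μ the right side of the pre-Lie identity vanishes since ψ is a cocycle, so
  -- inserting ψ and inserting μ into φ commute up to sign.
  have h := pre_pre_of_parity hY (hasParity_of_mem hψ) hasParity_mulElem φ
  rw [mul_one, pow_one, pre_mulElem_of_cocycle (hasParity_of_mem hψ) hdψ, map_smul,
    sub_self, sub_eq_zero] at h
  rw [dTot_apply, sub_eq_zero, sg_of_mem _ hφ, map_smul, LinearMap.smul_apply] at hdφ
  -- The primitive is the signed sum of all φ ∘_i ψ. As φ is a cocycle, φ with μ inserted is id ⌣ φ
  -- - (-1)^p φ ⌣ id; inserting ψ into id there yields ψ ⌣ φ and φ ⌣ ψ, the remaining terms being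
  -- cancelled by the rest of β.
  refine ⟨((-1 : k) ^ (p * q) * (-1 : k) ^ (q + 1)) •
    Y.pre ((-1 : k) ^ (q + 1)) φ ψ, ?_⟩
  rw [map_smul, dTot_apply, h, ← hdφ, map_sub, LinearMap.sub_apply, map_smul,
    LinearMap.smul_apply, pre_cup hY, pre_cup hY, pre_idElem, sg_idElem, sg_pre _ hφ hψ,
    sg_of_mem _ hφ, ← pow_mul, map_smul, map_smul, map_smul, LinearMap.smul_apply,
    LinearMap.smul_apply, LinearMap.smul_apply, add_mul, one_mul, mul_comm q p]
  simp only [pow_add, pow_one]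
  rcases neg_one_pow_eq_or k (p * q) with e1 | e1 <;>
    rcases neg_one_pow_eq_or k p with e2 | e2 <;>
    rcases neg_one_pow_eq_or k q with e3 | e3 <;>
    simp only [e1, e2, e3, neg_smul, one_smul,
      mul_one, mul_neg, neg_neg, smul_neg, smul_sub] <;> abel

lemma pre_cup_right_of_cocycle (hY : Y.IsBraidedCommutative) {p q r : ℕ} {γ α β : Y.Tot}
    (hγ : γ ∈ Y.deg p) (hα : α ∈ Y.deg q) (hβ : β ∈ Y.deg r) (hdγ : Y.dTot γ = 0)
    (hdα : Y.dTot α = 0) (hdβ : Y.dTot β = 0) :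
    Y.pre ((-1 : k) ^ (q + r + 1)) γ (Y.cup α β) =
      Y.cup α (Y.pre ((-1 : k) ^ (r + 1)) γ β) +
        (-1 : k) ^ ((p + 1) * r) • Y.cup (Y.pre ((-1 : k) ^ (q + 1)) γ α) β +
        (-1 : k) ^ (q + 1) • Y.dTot
          (Y.brace ((-1 : k) ^ (q + 1)) ((-1 : k) ^ (r + 1)) γ α β) := by
  have sgn : ∀ {n : ℕ} {x : Y.Tot}, x ∈ Y.deg n →
      Y.sg (-1 : k) x = -(-1 : k) ^ (n + 1) • x := fun hx => by
    rw [sg_of_mem _ hx, pow_succ, mul_neg_one, neg_neg]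
  have h := pre_brace hY (neg_one_pow_eq_or k (q + 1)) (neg_one_pow_eq_or k (r + 1)) (sgn hα)
    (sgn hβ) γ
  -- The braces containing coboundaries of α and β drop out, and the brace of μ becomes a multiple
  -- of α ⌣ β.
  rw [← pre_mulElem_of_cocycle (hasParity_of_mem hα) hdα,
    ← pre_mulElem_of_cocycle (hasParity_of_mem hβ) hdβ, sub_self, sub_self, map_zero, map_zero,
    LinearMap.zero_apply, smul_zero, add_zero, zero_sub, brace_mulElem,
    sub_eq_iff_eq_add] at h
  rw [dTot_apply, sub_eq_zero, sg_of_mem _ hγ, map_smul, LinearMap.smul_apply] at hdγ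
  -- γ with μ inserted is replaced by its graded commutator with id. In the brace of that commutator
  -- the mixed terms of `brace_cup` put α or β in place of id, which gives the two cup products.
  rw [dTot_apply, h, ← hdγ, sg_brace _ _ hγ hα hβ]
  simp only [map_sub, map_smul, LinearMap.sub_apply, LinearMap.smul_apply, brace_cup hY,
    brace_idElem, sg_idElem, sg_of_mem _ hγ, ← pow_mul, pre_idElem, map_zero, LinearMap.zero_apply]
  simp only [add_mul, one_mul, pow_add, pow_one, mul_comm r p]
  rcases neg_one_pow_eq_or k (p * r) with e1 | e1 <;>
    rcases neg_one_pow_eq_or k p with e2 | e2 <;>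
    rcases neg_one_pow_eq_or k q with e3 | e3 <;>
    rcases neg_one_pow_eq_or k r with e4 | e4 <;>
    simp only [e1, e2, e3, e4, neg_smul, one_smul, smul_add,
      mul_one, mul_neg, neg_neg, smul_neg, smul_sub] <;> abel

/-- Inserting γ into α ⌣ β is a skew derivation already on cochains; only the other half of the
bracket, α ⌣ β inserted into γ, needs the brace as homotopy. -/
lemma brTot_cup (hY : Y.IsBraidedCommutative) {p q r : ℕ} {γ α β : Y.Tot}
    (hγ : γ ∈ Y.deg p) (hα : α ∈ Y.deg q) (hβ : β ∈ Y.deg r) (hdγ : Y.dTot γ = 0)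
    (hdα : Y.dTot α = 0) (hdβ : Y.dTot β = 0) :
    Y.brTot γ (Y.cup α β) - (Y.cup (Y.brTot γ α) β +
      (-1 : k) ^ ((p + 1) * q) • Y.cup α (Y.brTot γ β)) ∈ LinearMap.range Y.dTot := by
  refine ⟨(-1 : k) ^ ((p + 1) * (q + r + 1) + (q + 1)) •
    Y.brace ((-1 : k) ^ (q + 1)) ((-1 : k) ^ (r + 1)) γ α β, ?_⟩
  rw [brTot_of_mem hγ (cup_mem rfl hα hβ), brTot_of_mem hγ hα, brTot_of_mem hγ hβ,
    pre_cup_right_of_cocycle hY hγ hα hβ hdγ hdα hdβ, pre_cup hY, sg_of_mem _ hα, map_smul,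
    ← pow_mul]
  simp only [mul_add, mul_one, pow_add _ ((p + 1) * q + (p + 1) * r), pow_add _ ((p + 1) * q),
    pow_add _ ((p + 1) * r), pow_add _ ((p + 1) * q + (p + 1) * r + (p + 1))]
  rcases neg_one_pow_eq_or k ((p + 1) * r) with e1 | e1 <;>
    rcases neg_one_pow_eq_or k (p + 1) with e2 | e2 <;>
    rcases neg_one_pow_eq_or k ((p + 1) * q) with e3 | e3 <;>
    rcases neg_one_pow_eq_or k (q + 1) with e4 | e4 <;>
    simp only [e1, e2, e3, e4, map_sub, map_neg, neg_smul, one_smul, LinearMap.sub_apply, smul_add,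
      LinearMap.neg_apply, mul_one, mul_neg, neg_neg, smul_neg, smul_sub] <;> abel

end YetterDrinfeldAlgebra

end

end BialgebroidCohomology

namespace BialgebroidCohomology

noncomputable section

/-! # Bilinear operations on the homology of a module with differential -/

section Homology

variable {k : Type*} [CommRing k] {V : Type*} [AddCommGroup V] [Module k V] (d : V →ₗ[k] V)

/-- Cycles modulo those cycles that are boundaries. -/
abbrev Homology : Type _ := LinearMap.ker d ⧸ (LinearMap.range d).submoduleOf (LinearMap.ker d)

/-- The homology class of a cycle. -/
def homologyCls (x : V) (hx : d x = 0) : Homology d := Submodule.Quotient.mk ⟨x, hx⟩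

variable {d}

lemma homologyCls_eq {x y : V} {hx : d x = 0} {hy : d y = 0} (h : x - y ∈ LinearMap.range d) :
    homologyCls d x hx = homologyCls d y hy :=
  (Submodule.Quotient.eq _).2 h

lemma homologyCls_eq_zero {x : V} {hx : d x = 0} (h : x ∈ LinearMap.range d) :
    homologyCls d x hx = 0 :=
  (Submodule.Quotient.mk_eq_zero _).2 h

/-- A bilinear map preserving cycles, and sending boundaries to boundaries in each variable,
descends to homology. -/
def homologyMap₂ (f : V →ₗ[k] V →ₗ[k] V) (hf : ∀ x y, d x = 0 → d y = 0 → d (f x y) = 0)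
    (hl : ∀ x y, d y = 0 → f (d x) y ∈ LinearMap.range d)
    (hr : ∀ x y, d x = 0 → f x (d y) ∈ LinearMap.range d) :
    Homology d →ₗ[k] Homology d →ₗ[k] Homology d :=
  let g : LinearMap.ker d →ₗ[k] LinearMap.ker d →ₗ[k] Homology d :=
    LinearMap.mk₂ k (fun x y => homologyCls d (f x y) (hf x y x.2 y.2))
      (fun x x' y => homologyCls_eq (d := d) (hy := by simp [hf _ _ x.2 y.2, hf _ _ x'.2 y.2])
        (by simp))
      (fun c x y => homologyCls_eq (d := d) (hy := by simp [hf _ _ x.2 y.2]) (by simp))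
      (fun x y y' => homologyCls_eq (d := d) (hy := by simp [hf _ _ x.2 y.2, hf _ _ x.2 y'.2])
        (by simp))
      (fun c x y => homologyCls_eq (d := d) (hy := by simp [hf _ _ x.2 y.2]) (by simp))
  Submodule.liftQ _ (Submodule.liftQ _ g.flip (by
    rintro ⟨_, hy⟩ ⟨y, rfl⟩
    refine LinearMap.mem_ker.2 (LinearMap.ext fun x => homologyCls_eq_zero (hr x y x.2)))).flip (by
    rintro ⟨_, hx⟩ ⟨x, rfl⟩
    refine LinearMap.mem_ker.2 (LinearMap.ext fun y => ?_)
    obtain ⟨y, rfl⟩ := Submodule.mkQ_surjective _ y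
    exact homologyCls_eq_zero (hl x y y.2))

lemma homologyCls_surjective (x : Homology d) : ∃ z hz, homologyCls d z hz = x := by
  obtain ⟨⟨z, hz⟩, rfl⟩ := Submodule.mkQ_surjective _ x
  exact ⟨z, hz, rfl⟩

end Homology

/-! # The Gerstenhaber algebra structure on the coring cohomology -/

namespace YetterDrinfeldAlgebra

variable {k : Type v} {A U N : Type u} [CommRing k] [Ring A] [Algebra k A] [Ring U] [Algebra k U]
  [Ring N] [Algebra k N] [Module U N] [IsScalarTower k U N] {B : LeftBialgebroid k A U}
  {Y : YetterDrinfeldAlgebra B N}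

lemma inc_circBar (hY : Y.IsBraidedCommutative) {p q n : ℕ} (h : p + q = n + 1)
    (x : Y.toComodule.C p) (y : Y.toComodule.C q) :
    Y.inc n ((Y.operad hY).circBar h x y) =
      (-1 : k) ^ ((p + 1) * (q + 1)) • Y.pre ((-1 : k) ^ (q + 1)) (Y.inc p x) (Y.inc q y) := by
  have hI : Finset.Icc 1 p = (Finset.range p).image (· + 1) := by
    ext i
    simp only [Finset.mem_Icc, Finset.mem_image, Finset.mem_range]
    exact ⟨fun hi => ⟨i - 1, by omega, by omega⟩, by rintro ⟨j, hj, rfl⟩; omega⟩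
  rw [OperadWithMul.circBar, map_smul, map_sum, hI,
    Finset.sum_image fun i _ j _ hij => Nat.succ_injective hij, pre_eq_sum _ (inc_mem_deg p x)]
  congr 1
  refine Finset.sum_congr rfl fun i _ => ?_
  -- The exponents (q + 1)(i + 2) and (q + 1)i have the same parity: slots are counted from 1 in
  -- `circBar` and from 0 in `pre`.
  rw [map_smul, ← pow_mul, neg_one_pow_congr (m := (q + 1) * (i + 1 + 1)) (n := (q + 1) * i)
    ⟨(q + 1) * (i + 1), by ring⟩]
  exact congrArg _ (inc_circMap h _ x y)

lemma inc_bracket (hY : Y.IsBraidedCommutative) {p q n : ℕ} (h : p + q = n + 1)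
    (x : Y.toComodule.C p) (y : Y.toComodule.C q) :
    Y.inc n ((Y.operad hY).bracket h x y) = Y.brTot (Y.inc p x) (Y.inc q y) := by
  rw [OperadWithMul.bracket, map_sub, map_smul, inc_circBar, inc_circBar,
    brTot_of_mem (inc_mem_deg p x) (inc_mem_deg q y), smul_smul, mul_comm (q + 1),
    neg_one_pow_mul_self, one_smul]

lemma inc_operad_mul (hY : Y.IsBraidedCommutative) : Y.inc 2 (Y.operad hY).mul = Y.mulElem :=
  inc_tuple_two

lemma inc_operad_cup (hY : Y.IsBraidedCommutative) {p q : ℕ} (x : Y.toComodule.C p)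
    (y : Y.toComodule.C q) :
    Y.inc (p + q) ((Y.operad hY).cup x y) = Y.cup (Y.inc p x) (Y.inc q y) := by
  have h1 : 2 + p = p + 1 + 1 := by omega
  have h2 : p + 1 + q = p + q + 1 := by omega
  refine (inc_circMap h2 (p + 1) ((Y.operad hY).circ h1 1 (Y.operad hY).mul x) y).trans ?_
  have h3 : Y.inc (p + 1) ((Y.operad hY).circ h1 1 (Y.operad hY).mul x) =
      Y.cup (Y.inc p x) Y.idElem := by
    refine (inc_circMap h1 1 (Y.operad hY).mul x).trans ?_
    rw [inc_operad_mul, ins_one_mulElem]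
  rw [h3, ins_cup_right hY le_rfl (inc_mem_deg p x), idElem_ins]

lemma diff_eq_bracket (hY : Y.IsBraidedCommutative) (n : ℕ) (x : Y.toComodule.C n)
    (h : 2 + n = n + 1 + 1) :
    Y.toComodule.diff n x = (Y.operad hY).bracket h (Y.operad hY).mul x := by
  refine Y.inc_injective (n + 1) ?_
  rw [inc_diff, inc_bracket, inc_operad_mul, dTot_eq_brTot (hasParity_of_mem (inc_mem_deg n x))]

/-! ### Cohomology degree by degree and homology of the total cochain space. -/

lemma comp_inc_of_ne {m n : ℕ} (h : n ≠ m) (x : Y.toComodule.C n) : Y.comp m (Y.inc n x) = 0 :=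
  DirectSum.of_eq_of_ne (β := fun n => Y.toComodule.C n) n m x h.symm

lemma comp_succ_dTot (n : ℕ) (z : Y.Tot) :
    Y.comp (n + 1) (Y.dTot z) = Y.toComodule.diff n (Y.comp n z) := by
  induction z using tot_induction_inc with
  | hadd x y hx hy => simp only [map_add, hx, hy]
  | h m x =>
    rw [← inc_diff]
    by_cases h : m = n
    · subst h
      rw [comp_inc, comp_inc]
    · rw [comp_inc_of_ne h, comp_inc_of_ne (by omega), map_zero]

lemma comp_zero_dTot (z : Y.Tot) : Y.comp 0 (Y.dTot z) = 0 := by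
  induction z using tot_induction_inc with
  | hadd x y hx hy => rw [map_add, map_add, hx, hy, add_zero]
  | h m x => rw [← inc_diff, comp_inc_of_ne (by omega)]

lemma inc_mem_ker {n : ℕ} {x : Y.toComodule.C n} (hx : x ∈ Y.toComodule.cocycles n) :
    Y.dTot (Y.inc n x) = 0 := by
  rw [← inc_diff, LinearMap.mem_ker.1 hx, map_zero]

lemma mem_cocycles_of_inc {n : ℕ} {x : Y.toComodule.C n} (hx : Y.dTot (Y.inc n x) = 0) :
    x ∈ Y.toComodule.cocycles n :=
  LinearMap.mem_ker.2 (Y.inc_injective _ (by rw [inc_diff, hx, map_zero]))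

lemma comp_mem_cocycles (n : ℕ) {z : Y.Tot} (hz : Y.dTot z = 0) :
    Y.comp n z ∈ Y.toComodule.cocycles n :=
  LinearMap.mem_ker.2 (by rw [← comp_succ_dTot, hz, map_zero])

variable (Y) in
/-- The map from cohomology in degree `n` to the homology of the total cochain space. -/
def toHomology (n : ℕ) : Y.toComodule.H n →ₗ[k] Homology Y.dTot :=
  Submodule.mapQ _ _ ((Y.inc n).restrict fun _ hx => inc_mem_ker hx) (by
    rintro ⟨x, hx⟩ h
    rcases n with _ | n
    · obtain rfl : x = 0 := (Submodule.mem_bot k).1 h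
      exact ⟨0, by rw [map_zero]; exact (map_zero (Y.inc 0)).symm⟩
    · obtain ⟨y, rfl⟩ := h
      exact ⟨Y.inc n y, (inc_diff n y).symm⟩)

lemma toHomology_cls {n : ℕ} {x : Y.toComodule.C n} (hx : x ∈ Y.toComodule.cocycles n) :
    Y.toHomology n (Y.toComodule.cls n x hx) = homologyCls Y.dTot (Y.inc n x) (inc_mem_ker hx) :=
  rfl

variable (Y) in
/-- The component of degree `n` of a class of the total cochain space. -/
def ofHomology (n : ℕ) : Homology Y.dTot →ₗ[k] Y.toComodule.H n :=
  Submodule.mapQ _ _ ((Y.comp n).restrict fun _ hx => comp_mem_cocycles n hx) (by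
    rintro ⟨_, hx⟩ ⟨z, rfl⟩
    rcases n with _ | n
    · exact (Submodule.mem_bot k).2 (comp_zero_dTot z)
    · exact ⟨Y.comp n z, (comp_succ_dTot n z).symm⟩)

lemma ofHomology_cls (n : ℕ) {z : Y.Tot} (hz : Y.dTot z = 0) :
    Y.ofHomology n (homologyCls Y.dTot z hz) =
      Y.toComodule.cls n (Y.comp n z) (comp_mem_cocycles n hz) := rfl

lemma cls_congr {n : ℕ} {x y : Y.toComodule.C n} (h : x = y) (hx : x ∈ Y.toComodule.cocycles n)
    (hy : y ∈ Y.toComodule.cocycles n) : Y.toComodule.cls n x hx = Y.toComodule.cls n y hy := by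
  subst h; rfl

lemma cls_surjective {n : ℕ} (a : Y.toComodule.H n) :
    ∃ x hx, Y.toComodule.cls n x hx = a := by
  obtain ⟨⟨z, hz⟩, rfl⟩ := Submodule.mkQ_surjective _ a
  exact ⟨z, hz, rfl⟩

variable (Y) in
/-- The map from the total cohomology to the homology of the total cochain space. -/
def sumToHomology : (⨁ n, Y.toComodule.H n) →ₗ[k] Homology Y.dTot :=
  DirectSum.toModule k ℕ _ Y.toHomology

lemma sumToHomology_lof (n : ℕ) (a : Y.toComodule.H n) :
    Y.sumToHomology (DirectSum.lof k ℕ Y.toComodule.H n a) = Y.toHomology n a :=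
  DirectSum.toModule_lof k n a

lemma ofHomology_sumToHomology (n : ℕ) (X : ⨁ n, Y.toComodule.H n) :
    Y.ofHomology n (Y.sumToHomology X) = X n := by
  induction X using DirectSum.induction_on with
  | zero => simp
  | add x y hx hy => rw [map_add, map_add, hx, hy]; rfl
  | of m a =>
    change Y.ofHomology n (Y.sumToHomology (DirectSum.lof k ℕ Y.toComodule.H m a)) = _
    rw [sumToHomology_lof]
    obtain ⟨x, hx, rfl⟩ := cls_surjective a
    rw [toHomology_cls, ofHomology_cls]
    by_cases h : m = n
    · subst h
      rw [DirectSum.of_eq_same]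
      exact cls_congr (Y.comp_inc m x) _ _
    · rw [DirectSum.of_eq_of_ne _ _ _ (Ne.symm h)]
      exact (cls_congr (comp_inc_of_ne h x) _ (zero_mem _)).trans
        (Submodule.Quotient.mk_zero _)

lemma exists_sum_inc (z : Y.Tot) :
    ∃ s : Finset ℕ, z = ∑ n ∈ s, Y.inc n (Y.comp n z) := by
  classical
  exact ⟨DFinsupp.support z, (DirectSum.sum_support_of z).symm⟩

/-- The differential is homogeneous of degree 1, so components of cycles and boundaries are cycles
and boundaries. Taking components proves injectivity, and writing a cycle as the sum of its
components proves surjectivity. -/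
lemma sumToHomology_bijective : Function.Bijective Y.sumToHomology := by
  constructor
  · refine (injective_iff_map_eq_zero _).2 fun X hX => ?_
    refine DFinsupp.ext fun n => ?_
    rw [← ofHomology_sumToHomology, hX, map_zero]; rfl
  · intro x
    obtain ⟨z, hz, rfl⟩ := homologyCls_surjective x
    obtain ⟨s, hs⟩ := exists_sum_inc z
    refine ⟨∑ n ∈ s, DirectSum.lof k ℕ Y.toComodule.H n
      (Y.toComodule.cls n (Y.comp n z) (comp_mem_cocycles n hz)), ?_⟩
    rw [map_sum]
    simp only [sumToHomology_lof, toHomology_cls]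
    have : (⟨z, hz⟩ : LinearMap.ker Y.dTot) =
        ∑ n ∈ s, ⟨Y.inc n (Y.comp n z), inc_mem_ker (comp_mem_cocycles n hz)⟩ :=
      Subtype.ext (hs.trans (by simp))
    refine Eq.trans ?_ (congrArg (Submodule.mkQ _) this).symm
    rw [map_sum]
    rfl

variable (Y) in
/-- The total cohomology is the homology of the total cochain space. -/
def sumEquivHomology : (⨁ n, Y.toComodule.H n) ≃ₗ[k] Homology Y.dTot :=
  LinearEquiv.ofBijective Y.sumToHomology sumToHomology_bijective

/-- The sign of the homogeneous formula is absorbed into `sg`, so that it holds for all elements and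
can be fed to `homologyMap₂`. -/
lemma dTot_brTot_of_ker (hY : Y.IsBraidedCommutative) (φ ψ : Y.Tot) :
    Y.dTot (Y.brTot φ ψ) = Y.brTot (Y.dTot φ) ψ - Y.brTot (Y.sg (-1 : k) φ) (Y.dTot ψ) := by
  induction φ using tot_induction_inc with
  | hadd φ φ' h h' => simp only [map_add, LinearMap.add_apply, h, h']; abel
  | h n x =>
    induction ψ using tot_induction_inc with
    | hadd φ φ' h h' => simp only [map_add, h, h']; abel
    | h m y =>
      rw [dTot_brTot hY (hasParity_of_mem (inc_mem_deg n x)) (hasParity_of_mem (inc_mem_deg m y)),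
        sg_of_mem _ (inc_mem_deg n x), map_smul, LinearMap.smul_apply, pow_succ, mul_neg_one,
        neg_smul, sub_eq_add_neg]

lemma sg_mem_ker {φ : Y.Tot} (h : Y.dTot φ = 0) : Y.dTot (Y.sg (-1 : k) φ) = 0 := by
  rw [dTot_sg, h, map_zero, neg_zero]

lemma sg_sg (φ : Y.Tot) : Y.sg (-1 : k) (Y.sg (-1 : k) φ) = φ := by
  induction φ using tot_induction_inc with
  | hadd φ φ' h h' => simp only [map_add, h, h']
  | h n x =>
    rw [sg_of_mem _ (inc_mem_deg n x), map_smul, sg_of_mem _ (inc_mem_deg n x), smul_smul,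
      neg_one_pow_mul_self, one_smul]

/-- The cup product on homology. -/
def cupHomology (hY : Y.IsBraidedCommutative) :
    Homology Y.dTot →ₗ[k] Homology Y.dTot →ₗ[k] Homology Y.dTot :=
  homologyMap₂ Y.cup
    (fun φ ψ h h' => by rw [dTot_cup hY, h, h', map_zero, map_zero, LinearMap.zero_apply, add_zero])
    (fun φ ψ h => ⟨Y.cup φ ψ, by rw [dTot_cup hY, h, map_zero, add_zero]⟩)
    -- Applying `sg` to the cycle φ beforehand cancels the sign in the derivation rule.
    (fun φ ψ h => ⟨Y.cup (Y.sg (-1 : k) φ) ψ, by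
      rw [dTot_cup hY, sg_mem_ker h, map_zero, LinearMap.zero_apply, zero_add, sg_sg]⟩)

/-- The bracket on homology. -/
def bracketHomology (hY : Y.IsBraidedCommutative) :
    Homology Y.dTot →ₗ[k] Homology Y.dTot →ₗ[k] Homology Y.dTot :=
  homologyMap₂ Y.brTot
    (fun φ ψ h h' => by
      rw [dTot_brTot_of_ker hY, h, h', map_zero, map_zero, LinearMap.zero_apply, sub_zero])
    (fun φ ψ h => ⟨Y.brTot φ ψ, by rw [dTot_brTot_of_ker hY, h, map_zero, sub_zero]⟩)
    (fun φ ψ h => ⟨-Y.brTot (Y.sg (-1 : k) φ) ψ, by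
      rw [map_neg, dTot_brTot_of_ker hY, sg_mem_ker h, map_zero, LinearMap.zero_apply, sg_sg,
        zero_sub, neg_neg]⟩)

/-- A bilinear operation on homology, transported to the total cohomology. -/
def transport (Y : YetterDrinfeldAlgebra B N)
    (f : Homology Y.dTot →ₗ[k] Homology Y.dTot →ₗ[k] Homology Y.dTot) :
    (⨁ n, Y.toComodule.H n) →ₗ[k] (⨁ n, Y.toComodule.H n) →ₗ[k] ⨁ n, Y.toComodule.H n :=
  (f.compl₁₂ Y.sumToHomology Y.sumToHomology).compr₂ Y.sumEquivHomology.symm.toLinearMap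

lemma sumToHomology_transport
    (f : Homology Y.dTot →ₗ[k] Homology Y.dTot →ₗ[k] Homology Y.dTot) (X X') :
    Y.sumToHomology (Y.transport f X X') = f (Y.sumToHomology X) (Y.sumToHomology X') :=
  Y.sumEquivHomology.apply_symm_apply _

lemma unit_mem_cocycles (hY : Y.IsBraidedCommutative) :
    (Y.operad hY).unit ∈ Y.toComodule.cocycles 0 :=
  mem_cocycles_of_inc (dTot_one (Y := Y))

lemma cup_mem_cocycles (hY : Y.IsBraidedCommutative) {p q : ℕ} {x : Y.toComodule.C p}
    {y : Y.toComodule.C q} (hx : x ∈ Y.toComodule.cocycles p) (hy : y ∈ Y.toComodule.cocycles q) :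
    (Y.operad hY).cup x y ∈ Y.toComodule.cocycles (p + q) :=
  mem_cocycles_of_inc (by
    rw [inc_operad_cup, dTot_cup hY, inc_mem_ker hx, inc_mem_ker hy, map_zero, map_zero,
      LinearMap.zero_apply, add_zero])

lemma bracket_mem_cocycles (hY : Y.IsBraidedCommutative) {p q n : ℕ} (h : p + q = n + 1)
    {x : Y.toComodule.C p} {y : Y.toComodule.C q} (hx : x ∈ Y.toComodule.cocycles p)
    (hy : y ∈ Y.toComodule.cocycles q) :
    (Y.operad hY).bracket h x y ∈ Y.toComodule.cocycles n :=
  mem_cocycles_of_inc (by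
    rw [inc_bracket, dTot_brTot_of_ker hY, inc_mem_ker hx, inc_mem_ker hy, map_zero, map_zero,
      LinearMap.zero_apply, sub_zero])

lemma homologyCls_congr {z z' : Y.Tot} (h : z = z') (hz : Y.dTot z = 0) (hz' : Y.dTot z' = 0) :
    homologyCls Y.dTot z hz = homologyCls Y.dTot z' hz' := by
  subst h; rfl

lemma transport_cup (hY : Y.IsBraidedCommutative) {p q : ℕ} {x : Y.toComodule.C p}
    {y : Y.toComodule.C q} (hx : x ∈ Y.toComodule.cocycles p) (hy : y ∈ Y.toComodule.cocycles q) :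
    Y.transport (cupHomology hY) (DirectSum.lof k ℕ Y.toComodule.H p (Y.toComodule.cls p x hx))
      (DirectSum.lof k ℕ Y.toComodule.H q (Y.toComodule.cls q y hy)) =
        DirectSum.lof k ℕ Y.toComodule.H (p + q)
          (Y.toComodule.cls (p + q) _ (cup_mem_cocycles hY hx hy)) := by
  refine sumToHomology_bijective.1 ?_
  rw [sumToHomology_transport, sumToHomology_lof, sumToHomology_lof, sumToHomology_lof]
  exact homologyCls_congr (inc_operad_cup hY x y).symm _ _

lemma transport_bracket (hY : Y.IsBraidedCommutative) {p q n : ℕ} (h : p + q = n + 1)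
    {x : Y.toComodule.C p} {y : Y.toComodule.C q} (hx : x ∈ Y.toComodule.cocycles p)
    (hy : y ∈ Y.toComodule.cocycles q) :
    Y.transport (bracketHomology hY)
      (DirectSum.lof k ℕ Y.toComodule.H p (Y.toComodule.cls p x hx))
      (DirectSum.lof k ℕ Y.toComodule.H q (Y.toComodule.cls q y hy)) =
        DirectSum.lof k ℕ Y.toComodule.H n
          (Y.toComodule.cls n _ (bracket_mem_cocycles hY h hx hy)) := by
  refine sumToHomology_bijective.1 ?_
  rw [sumToHomology_transport, sumToHomology_lof, sumToHomology_lof, sumToHomology_lof]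
  exact homologyCls_congr (inc_bracket hY h x y).symm _ _

/-- The Gerstenhaber algebra of a braided commutative Yetter-Drinfeld algebra. -/
def gerstenhaber (hY : Y.IsBraidedCommutative) : GerstenhaberAlgebra k Y.toComodule.H where
  one := Y.toComodule.cls 0 _ (unit_mem_cocycles hY)
  mul := Y.transport (cupHomology hY)
  bracket := Y.transport (bracketHomology hY)
  mul_deg p q a b := by
    obtain ⟨x, hx, rfl⟩ := cls_surjective a
    obtain ⟨y, hy, rfl⟩ := cls_surjective b
    exact ⟨_, transport_cup hY hx hy⟩
  bracket_deg p q n h a b := by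
    obtain ⟨x, hx, rfl⟩ := cls_surjective a
    obtain ⟨y, hy, rfl⟩ := cls_surjective b
    exact ⟨_, transport_bracket hY h hx hy⟩
  bracket_deg_zero a b := by
    obtain ⟨x, hx, rfl⟩ := cls_surjective a
    obtain ⟨y, hy, rfl⟩ := cls_surjective b
    refine sumToHomology_bijective.1 ?_
    rw [sumToHomology_transport, sumToHomology_lof, sumToHomology_lof, map_zero]
    refine homologyCls_eq_zero ⟨0, ?_⟩
    rw [map_zero]
    exact (brTot_deg_zero (inc_mem_deg 0 x) (inc_mem_deg 0 y)).symm
  one_mul X := by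
    refine sumToHomology_bijective.1 ?_
    rw [sumToHomology_transport, sumToHomology_lof]
    obtain ⟨z, hz, h⟩ := homologyCls_surjective (Y.sumToHomology X)
    rw [← h]
    exact homologyCls_congr (one_cup z) _ _
  mul_one X := by
    refine sumToHomology_bijective.1 ?_
    rw [sumToHomology_transport, sumToHomology_lof]
    obtain ⟨z, hz, h⟩ := homologyCls_surjective (Y.sumToHomology X)
    rw [← h]
    exact homologyCls_congr (cup_one z) _ _
  mul_assoc X X' X'' := by
    refine sumToHomology_bijective.1 ?_
    simp only [sumToHomology_transport]
    obtain ⟨x, hx, h⟩ := homologyCls_surjective (Y.sumToHomology X)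
    obtain ⟨y, hy, h'⟩ := homologyCls_surjective (Y.sumToHomology X')
    obtain ⟨z, hz, h''⟩ := homologyCls_surjective (Y.sumToHomology X'')
    rw [← h, ← h', ← h'']
    exact homologyCls_congr (cup_assoc x y z) _ _
  mul_comm p q a b := by
    obtain ⟨x, hx, rfl⟩ := cls_surjective a
    obtain ⟨y, hy, rfl⟩ := cls_surjective b
    refine sumToHomology_bijective.1 ?_
    rw [map_smul, sumToHomology_transport, sumToHomology_transport, sumToHomology_lof,
      sumToHomology_lof]
    -- Here, and in the Leibniz rule, the identity holds only up to a boundary; the other axioms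
    -- already hold on representatives.
    exact (Submodule.Quotient.eq _).2 (cup_comm_of_cocycle hY (inc_mem_deg p x) (inc_mem_deg q y)
      (inc_mem_ker hx) (inc_mem_ker hy))
  bracket_antisymm p q a b := by
    obtain ⟨x, hx, rfl⟩ := cls_surjective a
    obtain ⟨y, hy, rfl⟩ := cls_surjective b
    refine sumToHomology_bijective.1 ?_
    rw [map_neg, map_smul, sumToHomology_transport, sumToHomology_transport, sumToHomology_lof,
      sumToHomology_lof]
    exact congrArg (Submodule.mkQ _) (Subtype.ext (brTot_antisymm
      (hasParity_of_mem (inc_mem_deg p x)) (hasParity_of_mem (inc_mem_deg q y))))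
  bracket_self p hp a := by
    obtain ⟨x, hx, rfl⟩ := cls_surjective a
    refine sumToHomology_bijective.1 ?_
    rw [sumToHomology_transport, sumToHomology_lof, map_zero]
    refine homologyCls_eq_zero ⟨0, ?_⟩
    rw [map_zero]
    exact (brTot_self (hp.add_odd odd_one) (hasParity_of_mem (inc_mem_deg p x))).symm
  bracket_bracket_self p hp a := by
    obtain ⟨x, hx, rfl⟩ := cls_surjective a
    refine sumToHomology_bijective.1 ?_
    rw [sumToHomology_transport, sumToHomology_transport, sumToHomology_lof, map_zero]
    refine homologyCls_eq_zero ⟨0, ?_⟩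
    rw [map_zero]
    exact (brTot_brTot_self hY hp.add_one (hasParity_of_mem (inc_mem_deg p x))).symm
  jacobi p q r a b c := by
    obtain ⟨x, hx, rfl⟩ := cls_surjective a
    obtain ⟨y, hy, rfl⟩ := cls_surjective b
    obtain ⟨z, hz, rfl⟩ := cls_surjective c
    refine sumToHomology_bijective.1 ?_
    simp only [map_add, map_smul, sumToHomology_transport, sumToHomology_lof]
    exact congrArg (Submodule.mkQ _) (Subtype.ext (brTot_jacobi hY
      (hasParity_of_mem (inc_mem_deg p x)) (hasParity_of_mem (inc_mem_deg q y))
      (hasParity_of_mem (inc_mem_deg r z))))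
  leibniz p q r c a b := by
    obtain ⟨x, hx, rfl⟩ := cls_surjective a
    obtain ⟨y, hy, rfl⟩ := cls_surjective b
    obtain ⟨z, hz, rfl⟩ := cls_surjective c
    refine sumToHomology_bijective.1 ?_
    simp only [map_add, map_smul, sumToHomology_transport, sumToHomology_lof]
    exact (Submodule.Quotient.eq _).2 (brTot_cup hY (inc_mem_deg p z) (inc_mem_deg q x)
      (inc_mem_deg r y) (inc_mem_ker hz) (inc_mem_ker hx) (inc_mem_ker hy))

lemma gerstenhaber_isInducedBy (hY : Y.IsBraidedCommutative) :
    IsInducedBy Y.toComodule (Y.operad hY) (gerstenhaber hY) where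
  one := ⟨_, rfl⟩
  mul _ _ _ _ hx hy := ⟨_, transport_cup hY hx hy⟩
  bracket _ _ _ h _ _ hx hy := ⟨_, transport_bracket hY h hx hy⟩

end YetterDrinfeldAlgebra

end

end BialgebroidCohomology

namespace BialgebroidCohomology

noncomputable section

variable {k : Type v} {A U : Type u} [CommRing k] [Ring A] [Algebra k A] [Ring U] [Algebra k U]

/-! # Exactness of `U ⊗_A -` -/

section Exact

variable {η : A ⊗[k] Aᵐᵒᵖ →ₐ[k] U}

lemma tensMap_mk {X Y : LeftMod k A} (g : X →ₗ[A] Y) (w : U ⊗[k] X) :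
    tensMap (η := η) g ((tensRel η X).mkQ w) =
      (tensRel η Y).mkQ (LinearMap.lTensor U (g.restrictScalars k) w) := by
  induction w using TensorProduct.induction_on with
  | zero => simp only [map_zero]; exact map_zero (tensMap (η := η) g)
  | tmul u x => exact tensMap_tmul g u x
  | add z z' h h' =>
    rw [map_add, map_add, map_add, ← h, ← h']
    exact map_add (tensMap (η := η) g) _ _

/-- Right exactness over k passes to the quotients: since g is surjective, the relations defining U
⊗ Z lift to relations in U ⊗ Y, so a kernel element can be corrected by a relation before exactness
over k is used. -/
lemma tensMap_exact_of_surjective {X Y Z : LeftMod k A} {f : X →ₗ[A] Y} {g : Y →ₗ[A] Z}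
    (h : Function.Exact f g) (hg : Function.Surjective g) :
    Function.Exact (tensMap (η := η) f) (tensMap (η := η) g) := by
  intro w
  constructor
  · intro hw
    obtain ⟨w, rfl⟩ := (tensRel η Y).mkQ_surjective w
    rw [tensMap_mk] at hw
    have hw' : LinearMap.lTensor U (g.restrictScalars k) w ∈ tensRel η Z :=
      (Submodule.Quotient.mk_eq_zero _).1 hw
    have hrel : tensRel η Z ≤ (tensRel η Y).map (LinearMap.lTensor U (g.restrictScalars k)) := by
      refine Submodule.span_le.2 ?_
      rintro _ ⟨a, u, z, rfl⟩
      obtain ⟨y, rfl⟩ := hg z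
      refine ⟨_, Submodule.subset_span ⟨a, u, y, rfl⟩, ?_⟩
      rw [map_sub, LinearMap.lTensor_tmul, LinearMap.lTensor_tmul]
      exact congrArg (fun t => _ - u ⊗ₜ[k] t) (map_smul g a y)
    obtain ⟨w', hw1, hw2⟩ := hrel hw'
    have hex : Function.Exact (f.restrictScalars k) (g.restrictScalars k) := h
    have h3 := (lTensor_exact U hex hg (w - w')).1 (by rw [map_sub, hw2, sub_self])
    obtain ⟨v, hv⟩ := h3
    refine ⟨(tensRel η X).mkQ v, ?_⟩
    rw [tensMap_mk, hv, map_sub]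
    have h0 : (tensRel η Y).mkQ w' = 0 := (Submodule.Quotient.mk_eq_zero _).2 hw1
    rw [h0, sub_zero]
  · rintro ⟨w, rfl⟩
    rw [← tensMap_comp]
    have h0 : g.comp f = 0 := LinearMap.ext fun x => h.apply_apply_eq_zero x
    rw [h0, tensMap_zero]

/-- The image of a morphism of left `A`-modules. -/
def imageMod {X Y : LeftMod k A} (g : X →ₗ[A] Y) : LeftMod k A where
  carrier := LinearMap.range g

/-- Factor g through its image: right exactness handles the surjection onto the image, flatness the
inclusion of the image into Z. -/
lemma LeftBialgebroid.IsFlatRight.exact {B : LeftBialgebroid k A U} (hB : B.IsFlatRight)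
    {X Y Z : LeftMod k A} {f : X →ₗ[A] Y} {g : Y →ₗ[A] Z} (h : Function.Exact f g) :
    Function.Exact (tensMap (η := B.η) f) (tensMap (η := B.η) g) := by
  let i : imageMod g →ₗ[A] Z := (LinearMap.range g).subtype
  let π : Y →ₗ[A] imageMod g := g.rangeRestrict
  have hi : Function.Injective i := Subtype.val_injective
  have hπ : Function.Surjective π := g.surjective_rangeRestrict
  have hf : Function.Exact f π := fun y =>
    Iff.trans ⟨fun hy => congrArg Subtype.val hy, fun hy => Subtype.ext hy⟩ (h y)
  have hg : ∀ w, tensMap (η := B.η) g w = tensMap i (tensMap π w) := fun w =>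
    tensMap_comp i π w
  intro w
  rw [← tensMap_exact_of_surjective hf hπ w, hg]
  exact ⟨fun hw => hB _ _ i hi (hw.trans (map_zero _).symm), fun hw => by rw [hw, map_zero]⟩

/-- Functoriality of the cochain spaces in the coefficients. -/
def cochainMap {X Y : LeftMod k A} (f : X →ₗ[A] Y) : ∀ n, cochain η X n →ₗ[A] cochain η Y n
  | 0 => f
  | n + 1 => tensMap (cochainMap f n)

lemma LeftBialgebroid.IsFlatRight.cochainMap_injective {B : LeftBialgebroid k A U}
    (hB : B.IsFlatRight) {X Y : LeftMod k A} {f : X →ₗ[A] Y} (h : Function.Injective f) (n : ℕ) :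
    Function.Injective (cochainMap (η := B.η) f n) := by
  induction n with
  | zero => exact h
  | succ n ih => exact hB _ _ _ ih

lemma LeftBialgebroid.IsFlatRight.cochainMap_exact {B : LeftBialgebroid k A U}
    (hB : B.IsFlatRight) {X Y Z : LeftMod k A} {f : X →ₗ[A] Y} {g : Y →ₗ[A] Z}
    (h : Function.Exact f g) (n : ℕ) :
    Function.Exact (cochainMap (η := B.η) f n) (cochainMap (η := B.η) g n) := by
  induction n with
  | zero => exact h
  | succ n ih => exact hB.exact ih

end Exact

variable {B : LeftBialgebroid k A U}

/-! # Morphisms of comodules -/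

namespace ComoduleHom

variable {M M' M'' : LeftComodule B}

/-- The composition of morphisms of comodules. -/
def comp (g : ComoduleHom M' M'') (f : ComoduleHom M M') : ComoduleHom M M'' where
  toLin := g.toLin.comp f.toLin
  comm m := by rw [LinearMap.comp_apply, g.comm, f.comm, tensMap_comp]

/-- The identity morphism of a comodule. -/
def id (M : LeftComodule B) : ComoduleHom M M where
  toLin := LinearMap.id
  comm _ := (tensMap_id _).symm

lemma cobar_cochainMap (f : ComoduleHom M M') (n : ℕ) (z : M.C n) :
    M'.cobar n (cochainMap f.toLin n z) = cochainMap f.toLin (n + 1) (M.cobar n z) := by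
  induction n with
  | zero => exact f.comm z
  | succ n ih =>
    rw [LeftComodule.cobar_succ_apply, LeftComodule.cobar_succ_apply, map_sub]
    refine congrArg₂ _ (B.comulTens_natural _ z) ?_
    change tensMap _ (tensMap _ z) = tensMap (tensMap _) (tensMap _ z)
    rw [← tensMap_comp, ← tensMap_comp]
    exact congrArg (fun t => tensMap t z) (LinearMap.ext ih)

lemma diff_cochainMap (f : ComoduleHom M M') (n : ℕ) (z : M.C n) :
    M'.diff n (cochainMap f.toLin n z) = cochainMap f.toLin (n + 1) (M.diff n z) := by
  rw [LeftComodule.diff_apply, LeftComodule.diff_apply, map_sub, cobar_cochainMap]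
  exact congrArg (fun t => t - _) (tensMap_tmul _ _ _).symm

end ComoduleHom

/-! # Cofree comodules -/

/-- The cofree comodule `U ⊗_A X`. -/
@[reducible] def cofree (B : LeftBialgebroid k A U) (X : LeftMod k A) : LeftComodule B where
  toMod := tens B.η X
  coact := B.comulTens X
  coassoc := B.comulTens_comulTens X
  counit_coact z r x y h := by
    have h' := B.counitTens_comulTens X z
    rw [(h : _ = _), map_sum] at h'
    simp only [B.counitTens_tmul] at h'
    exact h'

/-- The morphism into a cofree comodule given by a map of left `A`-modules. -/
def cofreeLift {M : LeftComodule B} {X : LeftMod k A} (f : M.toMod →ₗ[A] X) :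
    ComoduleHom M (cofree B X) where
  toLin := (tensMap f).comp M.coact
  comm m := by
    change B.comulTens X (tensMap f (M.coact m)) = _
    rw [B.comulTens_natural, M.coassoc, ← tensMap_comp]

/-- A morphism into a cofree comodule is recovered from its composite with ε ⊗ id; this is the
uniqueness half of the cofree adjunction. -/
lemma counitTens_hom {M : LeftComodule B} {X : LeftMod k A} (g : ComoduleHom M (cofree B X))
    (m : M.toMod) :
    tensMap ((B.counitTens X).comp g.toLin) (M.coact m) = g.toLin m := by
  rw [tensMap_comp, ← g.comm]
  exact B.tensMap_counitTens_comulTens X _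

/-- Morphisms into U ⊗ E correspond to A-linear maps into E, and the latter extend along injections
because E is injective over A. -/
lemma cofree_isInjective {E : LeftMod k A} (hE : Module.Injective A E) :
    (cofree B E).IsInjective := by
  intro X X' i g hi
  obtain ⟨h, hh⟩ := hE.out i.toLin hi ((B.counitTens E).comp g.toLin)
  refine ⟨cofreeLift h, fun x => ?_⟩
  change tensMap h (X'.coact (i.toLin x)) = _
  rw [i.comm, ← tensMap_comp, show h.comp i.toLin = _ from LinearMap.ext hh, counitTens_hom]

namespace LeftComodule

variable {M I : LeftComodule B}

lemma coact_injective (M : LeftComodule B) : Function.Injective M.coact :=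
  Function.LeftInverse.injective (g := B.counitTens M.toMod) M.counitTens_coact

/-- The coaction is an injective morphism into a cofree comodule, so the identity of an injective
comodule extends along it. -/
lemma IsInjective.exists_retraction (hI : I.IsInjective) :
    ∃ r : ComoduleHom (cofree B I.toMod) I, ∀ x, r.toLin (I.coact x) = x :=
  hI I (cofree B I.toMod) ⟨I.coact, I.coassoc⟩ (ComoduleHom.id I) I.coact_injective

/-- The maps contracting the cochain complex, induced by a retraction of the coaction. -/
def contraction (r : tens B.η M.toMod →ₗ[A] M.toMod) : ∀ n, M.C (n + 1) →ₗ[A] M.C n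
  | 0 => r
  | n + 1 => tensMap (contraction r n)

/-- The maps id^{⊗n} ⊗ r commute with ∂ up to a signed identity: colinearity of r moves it past the
first coproduct, and r ∘ coaction = id gives the extra term. -/
lemma contraction_cobar {r : ComoduleHom (cofree B M.toMod) M} (hr : ∀ x, r.toLin (M.coact x) = x)
    (n : ℕ) (z : M.C (n + 1)) : contraction r.toLin (n + 1) (M.cobar (n + 1) z) =
      M.cobar n (contraction r.toLin n z) + (-1 : ℤ) ^ (n + 1) • z := by
  induction n with
  | zero =>
    rw [cobar_succ_apply, map_sub]
    have h1 : contraction r.toLin 1 (B.comulTens (M.C 0) z) =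
      M.cobar 0 (contraction r.toLin 0 z) := (r.comm z).symm
    have h2 : contraction r.toLin 1 (tensMap (M.cobar 0) z) = z := by
      change tensMap r.toLin (tensMap M.coact z) = z
      rw [← tensMap_comp, show r.toLin.comp M.coact = LinearMap.id from LinearMap.ext hr,
        tensMap_id]
    rw [h1, h2, sub_eq_add_neg, show (-1 : ℤ) ^ (0 + 1) = -1 from rfl, neg_smul, one_smul]
  | succ n ih =>
    rw [cobar_succ_apply, map_sub]
    have h1 : contraction r.toLin (n + 2) (B.comulTens (M.C (n + 1)) z) =
      B.comulTens (M.C n) (contraction r.toLin (n + 1) z) := (B.comulTens_natural _ z).symm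
    have h2 : contraction r.toLin (n + 2) (tensMap (M.cobar (n + 1)) z) =
        tensMap (M.cobar n) (contraction r.toLin (n + 1) z) + (-1 : ℤ) ^ (n + 1) • z := by
      change tensMap _ (tensMap _ z) = tensMap _ (tensMap _ z) + _
      rw [← tensMap_comp, show (contraction r.toLin (n + 1)).comp (M.cobar (n + 1)) =
        (M.cobar n).comp (contraction r.toLin n) + (-1 : ℤ) ^ (n + 1) • LinearMap.id from
        LinearMap.ext ih, tensMap_add, tensMap_zsmul, tensMap_id, tensMap_comp]
    rw [h1, h2, cobar_succ_apply, pow_succ (-1 : ℤ) (n + 1), mul_neg_one, neg_smul]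
    abel

/-- The cochain complex of an injective comodule is exact in positive degrees. -/
lemma IsInjective.exact_diff (hI : I.IsInjective) (n : ℕ) :
    Function.Exact (I.diff n) (I.diff (n + 1)) := by
  obtain ⟨r, hr⟩ := hI.exists_retraction
  intro z
  constructor
  · intro hz
    -- The contraction acts from the second factor on and so commutes with prepending 1; the
    -- homotopy for ∂ is therefore also one for β = δ₀ - ∂.
    have h1 : contraction r.toLin (n + 1) (I.diff (n + 1) z) =
        I.diff n (contraction r.toLin n z) - (-1 : ℤ) ^ (n + 1) • z := by
      rw [diff_apply, diff_apply, map_sub, contraction_cobar hr]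
      have h2 : contraction r.toLin (n + 1) (tmul B.η (I.C (n + 1)) 1 z) =
        tmul B.η (I.C n) 1 (contraction r.toLin n z) := tensMap_tmul _ _ _
      rw [h2, sub_sub]
    rw [hz, map_zero, eq_comm, sub_eq_zero, ← neg_one_pow_smul_eq (k := k)] at h1
    refine ⟨(-1 : k) ^ (n + 1) • contraction r.toLin n z, ?_⟩
    rw [map_smul, h1, smul_smul, ← mul_pow, neg_one_mul, neg_neg, one_pow, one_smul]
  · rintro ⟨y, rfl⟩
    exact I.diff_diff n y

/-! # Injective resolutions -/

/-- A left `A`-module, with the `k`-module structure coming from that of `A`. -/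
def _root_.BialgebroidCohomology.LeftMod.ofModule (k : Type v) [CommRing k] [Algebra k A]
    (E : Type u) [AddCommGroup E] [Module A E] : LeftMod k A :=
  letI : Module k E := Module.compHom E (algebraMap k A)
  { carrier := E
    tower := ⟨fun c a x => by
      change (c • a) • x = algebraMap k A c • a • x
      rw [Algebra.smul_def, mul_smul]⟩ }

lemma exists_injective_mod (X : LeftMod k A) :
    ∃ (E : LeftMod k A) (i : X →ₗ[A] E), Function.Injective i ∧ Module.Injective A E := by
  let X' : ModuleCat.{u} A := ModuleCat.of A X
  let E' := CategoryTheory.Injective.under X'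
  let i := CategoryTheory.Injective.ι X'
  refine ⟨LeftMod.ofModule k E', i.hom, (ModuleCat.mono_iff_injective i).1 inferInstance, ?_⟩
  exact (Module.injective_iff_injective_object A E').2
    (CategoryTheory.Injective.injective_under X')

/-- The quotient of a comodule by the image of a morphism. -/
def quotientMod {M M' : LeftComodule B} (f : ComoduleHom M M') : LeftMod k A where
  carrier := M'.toMod ⧸ LinearMap.range f.toLin

/-- The projection onto the quotient. -/
def quotientMk {M M' : LeftComodule B} (f : ComoduleHom M M') :
    M'.toMod →ₗ[A] quotientMod f :=
  (LinearMap.range f.toLin).mkQ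

lemma quotientMk_surjective {M M' : LeftComodule B} (f : ComoduleHom M M') :
    Function.Surjective (quotientMk f) := (LinearMap.range f.toLin).mkQ_surjective

lemma quotientMk_exact {M M' : LeftComodule B} (f : ComoduleHom M M') :
    Function.Exact f.toLin (quotientMk f) := fun _ => Submodule.Quotient.mk_eq_zero _

/-- The induced coaction on the quotient. -/
def quotientCoact {M M' : LeftComodule B} (f : ComoduleHom M M') :
    quotientMod f →ₗ[A] tens B.η (quotientMod f) :=
  (LinearMap.range f.toLin).liftQ ((tensMap (quotientMk f)).comp M'.coact) (by
    rintro _ ⟨x, rfl⟩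
    rw [LinearMap.mem_ker, LinearMap.comp_apply, f.comm, ← tensMap_comp,
      show (quotientMk f).comp f.toLin = 0 from
        LinearMap.ext fun x => (quotientMk_exact f).apply_apply_eq_zero x, tensMap_zero])

lemma quotientCoact_mk {M M' : LeftComodule B} (f : ComoduleHom M M') (x : M'.toMod) :
    quotientCoact f (quotientMk f x) = tensMap (quotientMk f) (M'.coact x) := rfl

/-- The cokernel of a morphism of comodules. -/
def quotient {M M' : LeftComodule B} (f : ComoduleHom M M') : LeftComodule B where
  toMod := quotientMod f
  coact := quotientCoact f
  coassoc m := by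
    obtain ⟨x, rfl⟩ := quotientMk_surjective f m
    rw [quotientCoact_mk, B.comulTens_natural, M'.coassoc, ← tensMap_comp, ← tensMap_comp]
    rfl
  counit_coact m r x y h := by
    have h' : B.counitTens (quotientMod f) (quotientCoact f m) = m := by
      obtain ⟨x, rfl⟩ := quotientMk_surjective f m
      rw [quotientCoact_mk, B.counitTens_natural, M'.counitTens_coact]
    rw [(h : _ = _), map_sum] at h'
    simp only [B.counitTens_tmul] at h'
    exact h'

/-- The projection onto the cokernel. -/
def quotientHom {M M' : LeftComodule B} (f : ComoduleHom M M') : ComoduleHom M' (quotient f) where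
  toLin := quotientMk f
  comm m := quotientCoact_mk f m

/-- Embed M as A-module in an injective E; then M → U ⊗ M → U ⊗ E is injective, the second map by
flatness. -/
lemma exists_injective_hom (hB : B.IsFlatRight) (M : LeftComodule B) :
    ∃ (I : LeftComodule B) (i : ComoduleHom M I), Function.Injective i.toLin ∧ I.IsInjective := by
  obtain ⟨E, i, hi, hE⟩ := exists_injective_mod M.toMod
  exact ⟨cofree B E, cofreeLift i, (hB _ _ i hi).comp M.coact_injective, cofree_isInjective hE⟩

/-- An injective comodule containing the given one. -/
def hull (hB : B.IsFlatRight) (M : LeftComodule B) : LeftComodule B :=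
  (exists_injective_hom hB M).choose

/-- The embedding into an injective comodule. -/
def toHull (hB : B.IsFlatRight) (M : LeftComodule B) : ComoduleHom M (hull hB M) :=
  (exists_injective_hom hB M).choose_spec.choose

lemma toHull_injective (hB : B.IsFlatRight) (M : LeftComodule B) :
    Function.Injective (toHull hB M).toLin :=
  (exists_injective_hom hB M).choose_spec.choose_spec.1

lemma hull_isInjective (hB : B.IsFlatRight) (M : LeftComodule B) : (hull hB M).IsInjective :=
  (exists_injective_hom hB M).choose_spec.choose_spec.2

/-- The cosyzygies of a comodule. -/
def cosyzygy (hB : B.IsFlatRight) (M : LeftComodule B) : ℕ → LeftComodule B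
  | 0 => M
  | n + 1 => quotient (toHull hB (cosyzygy hB M n))

/-- The injective resolution built from the cosyzygies. -/
def injectiveResolution (hB : B.IsFlatRight) (M : LeftComodule B) : InjectiveResolution M where
  I n := hull hB (cosyzygy hB M n)
  d n := (toHull hB (cosyzygy hB M (n + 1))).comp (quotientHom (toHull hB (cosyzygy hB M n)))
  aug := toHull hB M
  injective n := hull_isInjective hB _
  aug_injective := toHull_injective hB M
  exact_zero y := Iff.trans
    ⟨fun h => toHull_injective hB _ (h.trans (map_zero _).symm),
      fun h => (congrArg (toHull hB _).toLin h).trans (map_zero _)⟩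
    (quotientMk_exact (toHull hB (cosyzygy hB M 0)) y)
  exact_succ n y := by
    refine Iff.trans
      ⟨fun h => toHull_injective hB _ (h.trans (map_zero _).symm),
        fun h => (congrArg (toHull hB _).toLin h).trans (map_zero _)⟩
      ((quotientMk_exact (toHull hB (cosyzygy hB M (n + 1))) y).trans ?_)
    constructor
    · rintro ⟨x, rfl⟩
      obtain ⟨z, rfl⟩ := quotientMk_surjective (toHull hB (cosyzygy hB M n)) x
      exact ⟨z, rfl⟩
    · rintro ⟨z, rfl⟩
      exact ⟨_, rfl⟩

/-! # The cobar resolution and its comparison with injective resolutions -/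

lemma comulTens_cobar (M : LeftComodule B) (n : ℕ) (z : M.C (n + 1)) :
    B.comulTens (M.C (n + 1)) (M.cobar (n + 1) z) =
      tensMap (M.cobar (n + 1)) (B.comulTens (M.C n) z) := by
  rw [show M.cobar (n + 1) = B.comulTens (M.C n) - tensMap (M.cobar n) from rfl, tensMap_sub,
    LinearMap.sub_apply, map_sub, B.comulTens_comulTens, B.comulTens_natural]

/-- ε ⊗ id is an A-linear contracting homotopy of the cobar resolution; it need not be colinear. -/
lemma counitTens_cobar (M : LeftComodule B) (n : ℕ) (z : M.C (n + 1)) :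
    B.counitTens (M.C (n + 1)) (M.cobar (n + 1) z) =
      z - M.cobar n (B.counitTens (M.C n) z) := by
  rw [cobar_succ_apply, map_sub, B.counitTens_comulTens, B.counitTens_natural]

/-- Colinear maps on the cobar resolution into injective comodules extend along the
differential. -/
lemma IsInjective.exists_extension (hI : I.IsInjective) (n : ℕ) (g : M.C (n + 1) →ₗ[A] I.toMod)
    (hg : ∀ z, I.coact (g z) = tensMap g (B.comulTens (M.C n) z))
    (h0 : ∀ z, g (M.cobar n z) = 0) :
    ∃ g' : M.C (n + 2) →ₗ[A] I.toMod,
      (∀ z, I.coact (g' z) = tensMap g' (B.comulTens (M.C (n + 1)) z)) ∧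
      ∀ z, g' (M.cobar (n + 1) z) = g z := by
  obtain ⟨r, hr⟩ := hI.exists_retraction
  -- g ∘ (ε ⊗ id) already extends g along ∂, as g kills the image of ∂, but only A-linearly. Lifting
  -- it to U ⊗ I and applying the retraction r makes it colinear.
  let f : ComoduleHom (cofree B (M.C (n + 1))) I :=
    r.comp (cofreeLift (g.comp (B.counitTens (M.C (n + 1)))))
  refine ⟨f.toLin, f.comm, fun z => ?_⟩
  change r.toLin (tensMap (g.comp (B.counitTens (M.C (n + 1))))
    (B.comulTens (M.C (n + 1)) (M.cobar (n + 1) z))) = _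
  have h1 : (g.comp (B.counitTens (M.C (n + 1)))).comp (M.cobar (n + 1)) = g :=
    LinearMap.ext fun z => by
      rw [LinearMap.comp_apply, LinearMap.comp_apply, counitTens_cobar, map_sub, h0, sub_zero]
  rw [comulTens_cobar, ← tensMap_comp, h1, ← hg, hr]

variable (R : InjectiveResolution M)

/-- The components of a comparison morphism, together with the property needed to continue. -/
def PartialComparison (n : ℕ) : Type u :=
  {f : M.C (n + 1) →ₗ[A] (R.I n).toMod //
    (∀ z, (R.I n).coact (f z) = tensMap f (B.comulTens (M.C n) z)) ∧
      ∀ z, (R.d n).toLin (f (M.cobar n z)) = 0}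

lemma exists_partialComparison_zero :
    ∃ f : PartialComparison R 0, ∀ m, f.1 (M.coact m) = R.aug.toLin m := by
  obtain ⟨f, hf⟩ := R.injective 0 M (cofree B M.toMod) ⟨M.coact, M.coassoc⟩ R.aug
    M.coact_injective
  refine ⟨⟨f.toLin, f.comm, fun z => ?_⟩, hf⟩
  refine (congrArg (R.d 0).toLin (hf z)).trans ?_
  exact R.exact_zero.apply_apply_eq_zero z

lemma exists_partialComparison_succ (n : ℕ) (f : PartialComparison R n) :
    ∃ f' : PartialComparison R (n + 1),
      ∀ z, f'.1 (M.cobar (n + 1) z) = (R.d n).toLin (f.1 z) := by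
  obtain ⟨g, hg, hg'⟩ := (R.injective (n + 1)).exists_extension n ((R.d n).toLin.comp f.1)
    (fun z => by rw [LinearMap.comp_apply, (R.d n).comm, f.2.1, tensMap_comp]) f.2.2
  refine ⟨⟨g, hg, fun z => ?_⟩, hg'⟩
  rw [hg']
  exact (R.exact_succ n).apply_apply_eq_zero _

/-- The components of a comparison morphism. -/
def partialComparison : ∀ n, PartialComparison R n
  | 0 => (exists_partialComparison_zero R).choose
  | n + 1 => (exists_partialComparison_succ R n (partialComparison n)).choose

/-- A comparison morphism from the cobar resolution to an injective resolution. -/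
def comparison : R.Comparison where
  f n := (partialComparison R n).1
  colinear n z := (partialComparison R n).2.1 z
  aug := (exists_partialComparison_zero R).choose_spec
  comm n z := by
    have h := (exists_partialComparison_succ R n (partialComparison R n)).choose_spec z
    refine h.symm.trans (congrArg (partialComparison R (n + 1)).1 ?_)
    rw [diff_apply]
    exact (sub_sub_cancel _ _).symm

end LeftComodule

end

end BialgebroidCohomology

namespace BialgebroidCohomology

noncomputable section

/-! # Double complexes with exact rows and columns -/

section DoubleComplex

variable {k : Type v} [CommRing k]

/-- A linear relation that is total on both sides and relates elements of `S` exactly to elements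
of `S'` induces an isomorphism of quotients. -/
lemma exists_equiv_of_rel {V V' : Type*} [AddCommGroup V] [Module k V] [AddCommGroup V']
    [Module k V'] {Z S : Submodule k V} {Z' S' : Submodule k V'} (R : Submodule k (V × V'))
    (hl : ∀ z ∈ Z, ∃ x ∈ Z', (z, x) ∈ R) (hr : ∀ x ∈ Z', ∃ z ∈ Z, (z, x) ∈ R)
    (hS : ∀ z x, (z, x) ∈ R → (z ∈ S ↔ x ∈ S')) :
    ∃ φ : (Z ⧸ S.submoduleOf Z) ≃ₗ[k] (Z' ⧸ S'.submoduleOf Z'), ∀ z x (hz : z ∈ Z) (hx : x ∈ Z'),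
      (z, x) ∈ R → φ (Submodule.Quotient.mk ⟨z, hz⟩) = Submodule.Quotient.mk ⟨x, hx⟩ := by
  choose c hc hcR using hl
  -- Two partners of the same z differ by a partner of 0, which lies in `S'`; so the class is
  -- independent of the choice, and linearity follows from the same argument.
  have key : ∀ (z : V) (x x' : V') (hx : x ∈ Z') (hx' : x' ∈ Z'), (z, x) ∈ R → (z, x') ∈ R →
      (Submodule.Quotient.mk ⟨x, hx⟩ : Z' ⧸ S'.submoduleOf Z') = Submodule.Quotient.mk ⟨x', hx'⟩ := by
    intro z x x' hx hx' h h'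
    refine (Submodule.Quotient.eq _).2 ((hS (z - z) (x - x') (sub_mem h h')).1 ?_)
    rw [sub_self]
    exact zero_mem _
  let g : Z →ₗ[k] Z' ⧸ S'.submoduleOf Z' :=
    { toFun := fun z => Submodule.Quotient.mk ⟨c z z.2, hc z z.2⟩
      map_add' := fun z z' => key _ _ _ _ (add_mem (hc z z.2) (hc z' z'.2)) (hcR _ (z + z').2)
        (add_mem (hcR z z.2) (hcR z' z'.2))
      map_smul' := fun a z => key _ _ _ _ (Submodule.smul_mem _ a (hc z z.2)) (hcR _ (a • z).2)
        (Submodule.smul_mem _ a (hcR z z.2)) }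
  have hg : Function.Surjective g := by
    intro x
    obtain ⟨⟨x, hx⟩, rfl⟩ := Submodule.mkQ_surjective _ x
    obtain ⟨z, hz, h⟩ := hr x hx
    exact ⟨⟨z, hz⟩, key z _ _ _ _ (hcR z hz) h⟩
  have hker : S.submoduleOf Z = LinearMap.ker g := by
    ext z
    have hz : g z = 0 ↔ c z z.2 ∈ S' := Submodule.Quotient.mk_eq_zero (S'.submoduleOf Z')
    exact (hS z _ (hcR z z.2)).trans hz.symm
  refine ⟨(Submodule.quotEquivOfEq _ _ hker).trans (g.quotKerEquivOfSurjective hg), ?_⟩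
  intro z x hz hx h
  exact key z _ _ _ _ (hcR z hz) h

/-- A double complex in the first quadrant, with commuting differentials and with rows and columns
exact in positive degrees. -/
structure ExactGrid (k : Type v) [CommRing k] (E : ℕ → ℕ → Type w) [∀ p q, AddCommGroup (E p q)]
    [∀ p q, Module k (E p q)] where
  b : ∀ p q, E p q →ₗ[k] E (p + 1) q
  d : ∀ p q, E p q →ₗ[k] E p (q + 1)
  comm : ∀ p q z, d (p + 1) q (b p q z) = b p (q + 1) (d p q z)
  exact_b : ∀ p q, Function.Exact (b p q) (b (p + 1) q)
  exact_d : ∀ p q, Function.Exact (d p q) (d p (q + 1))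

namespace ExactGrid

variable {E : ℕ → ℕ → Type w} [∀ p q, AddCommGroup (E p q)] [∀ p q, Module k (E p q)]
variable (D : ExactGrid k E)

/-- The elements annihilated by both differentials. -/
def cyc (p q : ℕ) : Submodule k (E p q) := LinearMap.ker (D.b p q) ⊓ LinearMap.ker (D.d p q)

/-- The image under `b` of the kernel of `d`. -/
def bdyLeft : ∀ p q, Submodule k (E p q)
  | 0, _ => ⊥
  | p + 1, q => (LinearMap.ker (D.d p q)).map (D.b p q)

/-- The image under `d` of the kernel of `b`. -/
def bdyRight : ∀ p q, Submodule k (E p q)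
  | _, 0 => ⊥
  | p, q + 1 => (LinearMap.ker (D.b p q)).map (D.d p q)

/-- The sum of both kinds of boundaries. -/
def bdy (p q : ℕ) : Submodule k (E p q) := D.bdyLeft p q ⊔ D.bdyRight p q

/-- Away from the edges the two kinds of boundaries agree: if bx = 0 then x = bw and dx = b(dw).
Taking their sum gives one definition which is also right on the edges p = 0 and q = 0. -/
lemma bdy_succ_left (p q : ℕ) : D.bdy (p + 1) q = (LinearMap.ker (D.d p q)).map (D.b p q) := by
  refine sup_eq_left.2 ?_
  rcases q with _ | q
  · exact bot_le
  · rintro _ ⟨x, hx, rfl⟩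
    obtain ⟨w, rfl⟩ := (D.exact_b p q x).1 hx
    exact ⟨D.d p q w, (D.exact_d p q).apply_apply_eq_zero w, (D.comm p q w).symm⟩

lemma bdy_succ_right (p q : ℕ) : D.bdy p (q + 1) = (LinearMap.ker (D.b p q)).map (D.d p q) := by
  refine sup_eq_right.2 ?_
  rcases p with _ | p
  · exact bot_le
  · rintro _ ⟨x, hx, rfl⟩
    obtain ⟨w, rfl⟩ := (D.exact_d p q x).1 hx
    exact ⟨D.b p q w, (D.exact_b p q).apply_apply_eq_zero w, D.comm p q w⟩

lemma bdy_zero_zero : D.bdy 0 0 = ⊥ := sup_bot_eq _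

/-- The cohomology at a position of the grid. -/
abbrev Coh (p q : ℕ) : Type w := D.cyc p q ⧸ (D.bdy p q).submoduleOf (D.cyc p q)

/-- One step of the chase: y = ±bx is related to y' = dx. Such an x exists on either side by
exactness, and its ambiguity lies in the boundaries. The sign (-1)^{p+1} is the one produced by the
cochains of `diff_tensFamily`. -/
lemma exists_equiv_step (p q : ℕ) : ∃ Φ : D.Coh (p + 1) q ≃ₗ[k] D.Coh p (q + 1),
    ∀ (x : E p q) (y : E (p + 1) q) (y' : E p (q + 1)), (-1 : k) ^ (p + 1) • D.b p q x = y →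
      D.d p q x = y' → ∀ hy : y ∈ D.cyc (p + 1) q, ∃ hy' : y' ∈ D.cyc p (q + 1),
        Φ (Submodule.Quotient.mk ⟨y, hy⟩) = Submodule.Quotient.mk ⟨y', hy'⟩ := by
  have hs : (-1 : k) ^ (p + 1) * (-1) ^ (p + 1) = 1 := by
    rw [← mul_pow, neg_one_mul, neg_neg, one_pow]
  have hcyc : ∀ (x : E p q) (y : E (p + 1) q), (-1 : k) ^ (p + 1) • D.b p q x = y →
      y ∈ D.cyc (p + 1) q → D.d p q x ∈ D.cyc p (q + 1) := by
    rintro x _ rfl ⟨_, hy⟩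
    refine ⟨LinearMap.mem_ker.2 ?_, LinearMap.mem_ker.2 ((D.exact_d p q).apply_apply_eq_zero x)⟩
    have h := congrArg (fun t => (-1 : k) ^ (p + 1) • t) (LinearMap.mem_ker.1 hy)
    simp only [map_smul, smul_smul, hs, one_smul, smul_zero] at h
    rw [← D.comm, h]
  obtain ⟨Φ, hΦ⟩ := exists_equiv_of_rel (Z := D.cyc (p + 1) q) (S := D.bdy (p + 1) q)
    (Z' := D.cyc p (q + 1)) (S' := D.bdy p (q + 1))
    (LinearMap.range (((-1 : k) ^ (p + 1) • D.b p q).prod (D.d p q)))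
    (by
      intro y hy
      obtain ⟨x, rfl⟩ := (D.exact_b p q y).1 hy.1
      have hx : (-1 : k) ^ (p + 1) • D.b p q ((-1 : k) ^ (p + 1) • x) = D.b p q x := by
        rw [map_smul, smul_smul, hs, one_smul]
      exact ⟨_, hcyc _ _ hx hy, (-1 : k) ^ (p + 1) • x, Prod.ext hx rfl⟩)
    (by
      intro y hy
      obtain ⟨x, rfl⟩ := (D.exact_d p q y).1 hy.2
      refine ⟨(-1 : k) ^ (p + 1) • D.b p q x, Submodule.smul_mem _ _ ⟨?_, ?_⟩, x, rfl⟩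
      · exact (D.exact_b p q).apply_apply_eq_zero x
      · exact LinearMap.mem_ker.2 ((D.comm p q x).trans hy.1))
    (by
      rintro _ _ ⟨x, hx⟩
      obtain ⟨rfl, rfl⟩ := Prod.mk.inj hx
      rw [bdy_succ_left, bdy_succ_right]
      constructor
      · rintro ⟨x₀, h0, h1⟩
        -- If ±bx is already b of some x₀ in the kernel of d, the corrected x lies in the kernel of
        -- b and has the same image under d.
        refine ⟨x - (-1 : k) ^ (p + 1) • x₀, LinearMap.mem_ker.2 ?_, ?_⟩
        · rw [map_sub, map_smul, h1]
          change D.b p q x - (-1 : k) ^ (p + 1) • (-1 : k) ^ (p + 1) • D.b p q x = 0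
          rw [smul_smul, hs, one_smul, sub_self]
        · rw [map_sub, map_smul, LinearMap.mem_ker.1 h0, smul_zero, sub_zero]
      · rintro ⟨x₀, h0, h1⟩
        refine ⟨(-1 : k) ^ (p + 1) • (x - x₀), LinearMap.mem_ker.2 ?_, ?_⟩
        · rw [map_smul, map_sub, h1, sub_self, smul_zero]
        · rw [map_smul, map_sub, LinearMap.mem_ker.1 h0, sub_zero]
          rfl)
  refine ⟨Φ, fun x y y' hxy hxy' hy => ?_⟩
  subst hxy'
  exact ⟨hcyc x y hxy hy, hΦ _ _ _ _ ⟨x, Prod.ext hxy rfl⟩⟩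

/-- The isomorphism is evaluated on every staircase y running from (p, q) to (0, n): consecutive
entries only have to be linked by some x, so any explicit zigzag computes it. -/
lemma exists_equiv_of_add_eq (p q n : ℕ) (h : p + q = n) :
    ∃ Φ : D.Coh p q ≃ₗ[k] D.Coh 0 n, ∀ y : ∀ i j, E i j,
      (∀ i j, i + 1 + j = n → ∃ x, (-1 : k) ^ (i + 1) • D.b i j x = y (i + 1) j ∧
        D.d i j x = y i (j + 1)) → ∀ hy : y p q ∈ D.cyc p q, ∃ hy' : y 0 n ∈ D.cyc 0 n,
        Φ (Submodule.Quotient.mk ⟨y p q, hy⟩) = Submodule.Quotient.mk ⟨y 0 n, hy'⟩ := by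
  induction p generalizing q with
  | zero =>
    obtain rfl : q = n := by omega
    exact ⟨LinearEquiv.refl k _, fun y _ hy => ⟨hy, rfl⟩⟩
  | succ p ih =>
    obtain ⟨Φ, hΦ⟩ := ih (q + 1) (by omega)
    obtain ⟨Ψ, hΨ⟩ := D.exists_equiv_step p q
    refine ⟨Ψ.trans Φ, fun y H hy => ?_⟩
    obtain ⟨x, hx, hx'⟩ := H p q h
    obtain ⟨hy1, h1⟩ := hΨ x _ _ hx hx' hy
    obtain ⟨hy2, h2⟩ := hΦ y H hy1
    exact ⟨hy2, (congrArg Φ h1).trans h2⟩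

end ExactGrid

end DoubleComplex

/-! # The cotensor product with the base algebra -/

section Cotor

variable {k : Type v} {A U : Type u} [CommRing k] [Ring A] [Algebra k A] [Ring U] [Algebra k U]
variable {B : LeftBialgebroid k A U}

lemma baseLift_mk {Y : Type u} [AddCommGroup Y] [Module k Y] (X : LeftMod k A)
    (f : A →ₗ[k] X →ₗ[k] Y) (hf) (a : A) (x : X) : baseLift X f hf (baseMk X a x) = f a x := by
  change TensorProduct.lift f (a ⊗ₜ[k] x) = _
  rw [TensorProduct.lift.tmul]

lemma baseMk_one_bijective (X : LeftMod k A) : Function.Bijective (baseMk X 1) := by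
  let g : BaseTens X →ₗ[k] X :=
    baseLift X (Algebra.lsmul k k X.carrier : A →ₐ[k] Module.End k X.carrier).toLinearMap
      (fun a' a x => mul_smul a' a x)
  have hg : ∀ a x, g (baseMk X a x) = a • x := fun a x => baseLift_mk X _ _ a x
  refine ⟨Function.LeftInverse.injective (g := g) fun x => by rw [hg, one_smul], fun w => ?_⟩
  obtain ⟨w, rfl⟩ := (baseRel X).mkQ_surjective w
  induction w using TensorProduct.induction_on with
  | zero => exact ⟨0, by rw [map_zero, map_zero]; rfl⟩
  | tmul a x =>
    refine ⟨a • x, ?_⟩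
    rw [← baseMk_mul, one_mul]
    rfl
  | add z z' h h' =>
    obtain ⟨x, hx⟩ := h
    obtain ⟨x', hx'⟩ := h'
    exact ⟨x + x', by rw [map_add, hx, hx', map_add]; rfl⟩

lemma baseMap_mk {X X' : LeftMod k A} (f : X →ₗ[A] X') (a : A) (x : X) :
    baseMap f (baseMk X a x) = baseMk X' a (f x) :=
  baseLift_mk X _ _ a x

lemma baseCoact_mk_one (X : LeftMod k A) (x : X) :
    baseCoact B.η X (baseMk X 1 x) = baseMk (tens B.η X) 1 (tmul B.η X 1 x) := by
  refine (baseLift_mk X _ _ 1 x).trans ?_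
  change baseMk (tens B.η X) 1 (tmul B.η X (tgtOp B.η (MulOpposite.op 1)) x) = _
  rw [MulOpposite.op_one, map_one (tgtOp B.η)]

/-- Identifying A ⊗_A M with M, the cotensor product is the set of m with coaction 1 ⊗ m, that is,
the kernel of β in degree 0. -/
lemma baseMk_mem_cotensor {M : LeftComodule B} {m : M.toMod} :
    baseMk M.toMod 1 m ∈ cotensor M ↔ M.diff 0 m = 0 := by
  rw [cotensor, LinearMap.mem_eqLocus, baseCoact_mk_one, baseMap_mk, LeftComodule.diff_apply,
    sub_eq_zero]
  exact (baseMk_one_bijective _).1.eq_iff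

namespace InjectiveResolution

variable {M : LeftComodule B} (R : InjectiveResolution M)

/-- The double complex of cochains with coefficients in an injective resolution. -/
def grid (hB : B.IsFlatRight) : ExactGrid k (fun p q => (R.I q).C p) where
  b p q := (R.I q).diff p
  d p q := (cochainMap (R.d q).toLin p).restrictScalars k
  comm p q z := ((R.d q).diff_cochainMap p z).symm
  exact_b p q := (R.injective q).exact_diff p
  exact_d p q := hB.cochainMap_exact (R.exact_succ q) p

/-- The augmentation identifies Cⁿ(U, M) with the kernel of Cⁿ(U, I⁰) → Cⁿ(U, I¹), because U^{⊗n} ⊗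
- is exact under flatness. -/
lemma exists_equiv_left (hB : B.IsFlatRight) (n : ℕ) :
    ∃ Φ : M.H n ≃ₗ[k] (R.grid hB).Coh n 0, ∀ z (hz : z ∈ M.cocycles n),
      ∃ hy : cochainMap R.aug.toLin n z ∈ (R.grid hB).cyc n 0,
        Φ (M.cls n z hz) = Submodule.Quotient.mk ⟨cochainMap R.aug.toLin n z, hy⟩ := by
  have hinj := fun n => hB.cochainMap_injective R.aug_injective n
  have hex := hB.cochainMap_exact R.exact_zero
  have hcyc : ∀ z ∈ M.cocycles n, cochainMap R.aug.toLin n z ∈ (R.grid hB).cyc n 0 := by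
    intro z hz
    refine ⟨LinearMap.mem_ker.2 ((R.aug.diff_cochainMap n z).trans ?_),
      LinearMap.mem_ker.2 ((hex n).apply_apply_eq_zero z)⟩
    rw [LinearMap.mem_ker.1 hz, map_zero]
  obtain ⟨Φ, hΦ⟩ := exists_equiv_of_rel (Z := M.cocycles n) (S := M.coboundaries n)
    (Z' := (R.grid hB).cyc n 0) (S' := (R.grid hB).bdy n 0)
    (LinearMap.graph ((cochainMap R.aug.toLin n).restrictScalars k))
    (fun z hz => ⟨_, hcyc z hz, (LinearMap.mem_graph_iff _ _).2 rfl⟩)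
    (by
      intro y hy
      obtain ⟨z, rfl⟩ := (hex n y).1 hy.2
      refine ⟨z, LinearMap.mem_ker.2 (hinj (n + 1) ?_), (LinearMap.mem_graph_iff _ _).2 rfl⟩
      rw [← R.aug.diff_cochainMap, map_zero]
      exact hy.1)
    (by
      intro z y hzy
      obtain rfl : y = cochainMap R.aug.toLin n z := (LinearMap.mem_graph_iff _ _).1 hzy
      rcases n with _ | n
      · rw [ExactGrid.bdy_zero_zero, Submodule.mem_bot]
        refine Iff.trans (Submodule.mem_bot k) ?_
        exact (map_eq_zero_iff _ (hinj 0)).symm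
      · rw [ExactGrid.bdy_succ_left]
        constructor
        · rintro ⟨z, rfl⟩
          exact ⟨cochainMap R.aug.toLin n z, (hex n).apply_apply_eq_zero z,
            R.aug.diff_cochainMap n z⟩
        · rintro ⟨x, hx, h⟩
          obtain ⟨z', rfl⟩ := (hex n x).1 hx
          exact ⟨z', hinj (n + 1) ((R.aug.diff_cochainMap n z').symm.trans h)⟩)
  exact ⟨Φ, fun z hz => ⟨hcyc z hz, hΦ _ _ _ _ ((LinearMap.mem_graph_iff _ _).2 rfl)⟩⟩

/-- On the edge p = 0 the kernel of β is the cotensor product, so the cohomology there is that of A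
□ I. -/
lemma exists_equiv_right (hB : B.IsFlatRight) (n : ℕ) :
    ∃ Φ : (R.grid hB).Coh 0 n ≃ₗ[k] R.Cotor n, ∀ y (hy : y ∈ (R.grid hB).cyc 0 n),
      ∃ hw : baseMk (R.I n).toMod 1 y ∈ R.cocycles n,
        Φ (Submodule.Quotient.mk ⟨y, hy⟩) = Submodule.Quotient.mk ⟨_, hw⟩ := by
  have hinj := fun n => (baseMk_one_bijective (R.I n).toMod).1
  have hcyc : ∀ y, baseMk (R.I n).toMod 1 y ∈ R.cocycles n ↔ y ∈ (R.grid hB).cyc 0 n := by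
    intro y
    refine and_congr baseMk_mem_cotensor ?_
    change baseMap (R.d n).toLin (baseMk (R.I n).toMod 1 y) = 0 ↔ (R.d n).toLin y = 0
    rw [baseMap_mk]
    exact map_eq_zero_iff _ (hinj (n + 1))
  obtain ⟨Φ, hΦ⟩ := exists_equiv_of_rel (Z := (R.grid hB).cyc 0 n) (S := (R.grid hB).bdy 0 n)
    (Z' := R.cocycles n) (S' := R.coboundaries n)
    (LinearMap.graph (baseMk (R.I n).toMod 1))
    (fun y hy => ⟨_, (hcyc y).2 hy, (LinearMap.mem_graph_iff _ _).2 rfl⟩)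
    (by
      intro w hw
      obtain ⟨y, rfl⟩ := (baseMk_one_bijective (R.I n).toMod).2 w
      exact ⟨y, (hcyc y).1 hw, (LinearMap.mem_graph_iff _ _).2 rfl⟩)
    (by
      intro y w hyw
      obtain rfl : w = baseMk (R.I n).toMod 1 y := (LinearMap.mem_graph_iff _ _).1 hyw
      rcases n with _ | n
      · rw [ExactGrid.bdy_zero_zero, Submodule.mem_bot]
        refine Iff.trans ?_ (Submodule.mem_bot k).symm
        exact (map_eq_zero_iff _ (hinj 0)).symm
      · rw [ExactGrid.bdy_succ_right]
        constructor
        · rintro ⟨x, hx, rfl⟩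
          exact ⟨baseMk (R.I n).toMod 1 x, baseMk_mem_cotensor.2 hx, baseMap_mk _ _ _⟩
        · rintro ⟨w, hw, h⟩
          obtain ⟨x, rfl⟩ := (baseMk_one_bijective (R.I n).toMod).2 w
          exact ⟨x, baseMk_mem_cotensor.1 hw,
            hinj (n + 1) ((baseMap_mk _ _ _).symm.trans h)⟩)
  exact ⟨Φ, fun y hy => ⟨(hcyc y).2 hy, hΦ _ _ _ _ ((LinearMap.mem_graph_iff _ _).2 rfl)⟩⟩

end InjectiveResolution

/-! ### The staircase attached to a comparison morphism. -/

namespace LeftComodule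

variable (M : LeftComodule B)

/-- Given maps `g m : C^m → X` for all `m`, the map `id ⊗ g (m - p) : C^m → U^{⊗ p} ⊗ X`, zero for
`m < p`. -/
def tensFamily {X : LeftMod k A} (g : ∀ m, M.C m →ₗ[A] X) :
    ∀ p m, M.C m →ₗ[A] cochain B.η X p
  | 0, m => g m
  | _ + 1, 0 => 0
  | p + 1, m + 1 => tensMap (tensFamily g p m)

variable {M}

lemma tensFamily_self {X : LeftMod k A} (g : ∀ m, M.C m →ₗ[A] X) (n : ℕ) :
    M.tensFamily g n n = cochainMap (g 0) n := by
  induction n with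
  | zero => rfl
  | succ n ih => exact congrArg tensMap ih

lemma cochainMap_tensFamily {X X' : LeftMod k A} (f : X →ₗ[A] X') (g : ∀ m, M.C m →ₗ[A] X)
    (p m : ℕ) (z : M.C m) : cochainMap f p (M.tensFamily g p m z) =
      M.tensFamily (fun m => f.comp (g m)) p m z := by
  induction p generalizing m with
  | zero => rfl
  | succ p ih =>
    rcases m with _ | m
    · exact map_zero _
    · change tensMap _ (tensMap _ z) = tensMap _ z
      rw [← tensMap_comp]
      exact congrArg (fun t => tensMap t z) (LinearMap.ext (ih m))

/-- Applying id^{⊗(p+1)} ⊗ g after ∂, the cofaces on the first p factors and, by colinearity of g,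
the one on factor p + 1 form ∂ of the coefficient comodule; the remaining cofaces lie inside the
argument of g and form the last term. `h0` covers m = 0, where there is no coproduct to commute with
g. -/
lemma tensFamily_cobar {I : LeftComodule B} (g : ∀ m, M.C m →ₗ[A] I.toMod) (h0 : g 0 = 0)
    (hg : ∀ m z, I.coact (g (m + 1) z) = tensMap (g (m + 1)) (B.comulTens (M.C m) z))
    (p m : ℕ) (z : M.C m) :
    M.tensFamily g (p + 1) (m + 1) (M.cobar m z) =
      I.cobar p (M.tensFamily g p m z) + (-1 : ℤ) ^ (p + 1) •
        M.tensFamily (fun m => (g (m + 1)).comp (M.cobar m)) (p + 1) m z := by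
  induction p generalizing m with
  | zero =>
    rcases m with _ | m
    · change tensMap (g 0) (M.coact z) = I.coact (g 0 z) + (-1 : ℤ) ^ 1 • 0
      rw [h0, tensMap_zero, LinearMap.zero_apply, map_zero, smul_zero, add_zero]
    · change tensMap (g (m + 1)) (B.comulTens (M.C m) z - tensMap (M.cobar m) z) =
        I.coact (g (m + 1) z) + (-1 : ℤ) ^ 1 • tensMap ((g (m + 1)).comp (M.cobar m)) z
      rw [map_sub, hg, tensMap_comp, pow_one, neg_smul, one_smul, sub_eq_add_neg]
  | succ p ih =>
    rcases m with _ | m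
    · change tensMap (0 : M.C 0 →ₗ[A] cochain B.η I.toMod (p + 1)) (M.coact z) =
        I.cobar (p + 1) 0 + (-1 : ℤ) ^ (p + 2) • 0
      rw [tensMap_zero, map_zero, smul_zero, add_zero]
    · change tensMap (M.tensFamily g (p + 1) (m + 1))
          (B.comulTens (M.C m) z - tensMap (M.cobar m) z) =
        B.comulTens (I.C p) (tensMap (M.tensFamily g p m) z) -
          tensMap (I.cobar p) (tensMap (M.tensFamily g p m) z) + (-1 : ℤ) ^ (p + 2) •
            tensMap (M.tensFamily (fun m => (g (m + 1)).comp (M.cobar m)) (p + 1) m) z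
      have h : (M.tensFamily g (p + 1) (m + 1)).comp (M.cobar m) =
          (I.cobar p).comp (M.tensFamily g p m) + (-1 : ℤ) ^ (p + 1) •
            M.tensFamily (fun m => (g (m + 1)).comp (M.cobar m)) (p + 1) m :=
        LinearMap.ext (ih m)
      rw [map_sub, ← tensMap_comp, h, tensMap_add, tensMap_zsmul, tensMap_comp,
        B.comulTens_natural, pow_succ (-1 : ℤ) (p + 1), mul_neg_one, neg_smul]
      change tensMap (tensMap (M.tensFamily g p m)) _ - _ = _
      abel

end LeftComodule

namespace InjectiveResolution

variable {M : LeftComodule B} {R : InjectiveResolution M}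

/-- The component of a comparison morphism in degree `q`, extended by zero to all cochains. -/
def Comparison.family (F : R.Comparison) (q m : ℕ) : M.C m →ₗ[A] (R.I q).toMod :=
  if h : m = q + 1 then h ▸ F.f q else 0

lemma Comparison.family_self (F : R.Comparison) (q : ℕ) : F.family q (q + 1) = F.f q :=
  dif_pos rfl

lemma Comparison.family_of_ne (F : R.Comparison) {q m : ℕ} (h : m ≠ q + 1) :
    F.family q m = 0 := dif_neg h

lemma Comparison.family_colinear (F : R.Comparison) (q m : ℕ) (z : M.C (m + 1)) :
    (R.I q).coact (F.family q (m + 1) z) =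
      tensMap (F.family q (m + 1)) (B.comulTens (M.C m) z) := by
  by_cases h : m = q
  · subst h
    rw [family_self, F.colinear]
  · rw [F.family_of_ne (by omega), LinearMap.zero_apply, map_zero, tensMap_zero]

lemma Comparison.d_family (F : R.Comparison) (q m : ℕ) : (R.d q).toLin.comp (F.family q m) =
    (F.family (q + 1) (m + 1)).comp (M.cobar m) := by
  by_cases h : m = q + 1
  · subst h
    rw [family_self, family_self]
    refine LinearMap.ext fun z => (F.comm q z).trans (congrArg (F.f (q + 1)) ?_)
    rw [LeftComodule.diff_apply]
    exact sub_sub_cancel _ _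
  · rw [F.family_of_ne h, F.family_of_ne (by omega), LinearMap.comp_zero, LinearMap.zero_comp]

/-- For a cocycle ∂z = 1 ⊗ z, so the term ∂ on the left of `tensFamily_cobar` is the δ₀ part of β
and only the signed last term remains. -/
lemma Comparison.diff_tensFamily (F : R.Comparison) (p q m : ℕ) {z : M.C m}
    (hz : z ∈ M.cocycles m) :
    (R.I q).diff p (M.tensFamily (F.family q) p m z) = (-1 : k) ^ (p + 1) •
      M.tensFamily (fun m => (F.family q (m + 1)).comp (M.cobar m)) (p + 1) m z := by
  have h := LeftComodule.tensFamily_cobar (F.family q) (F.family_of_ne (by omega))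
    (F.family_colinear q) p m z
  have hz' := LinearMap.mem_ker.1 hz
  rw [LeftComodule.diff_apply, sub_eq_zero] at hz'
  rw [← hz'] at h
  rw [LeftComodule.diff_apply, LeftComodule.neg_one_pow_smul_eq]
  have h1 : M.tensFamily (F.family q) (p + 1) (m + 1) (tmul B.η (M.C m) 1 z) =
      tmul B.η ((R.I q).C p) 1 (M.tensFamily (F.family q) p m z) := tensMap_tmul _ _ _
  rw [h1] at h
  rw [h, add_sub_cancel_left]

/-- The canonical isomorphisms from the coring cohomology to `Cotor`. -/
theorem exists_isCanonical (hB : B.IsFlatRight) (R : InjectiveResolution M) :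
    ∃ φ : ∀ n, M.H n ≃ₗ[k] R.Cotor n, R.IsCanonical φ := by
  choose Φ hΦ using R.exists_equiv_left hB
  choose Ψ hΨ using fun n => (R.grid hB).exists_equiv_of_add_eq n 0 n rfl
  choose Θ hΘ using R.exists_equiv_right hB
  refine ⟨fun n => (Φ n).trans ((Ψ n).trans (Θ n)), ⟨LeftComodule.comparison R⟩, ?_⟩
  intro F n z hz
  obtain ⟨hy, h1⟩ := hΦ n z hz
  -- The staircase id^{⊗i} ⊗ f_j∂ applied to z; consecutive entries are linked by id^{⊗i} ⊗ f_j
  -- applied to z.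
  let y : ∀ i j, (R.I j).C i := fun i j =>
    M.tensFamily (fun m => (F.family j (m + 1)).comp (M.cobar m)) i n z
  -- At this end f₀∂ on coefficients is f₀ after the coaction, which is the augmentation.
  have hy0 : y n 0 = cochainMap R.aug.toLin n z := by
    change M.tensFamily _ n n z = _
    rw [LeftComodule.tensFamily_self]
    refine congrArg (fun t => cochainMap t n z) (LinearMap.ext fun m => ?_)
    rw [LinearMap.comp_apply, F.family_self]
    exact F.aug m
  -- At the other end ∂z = 1 ⊗ z, as z is a cocycle.
  have hyn : y 0 n = F.f n (M.coface n 0 z) := by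
    change F.family n (n + 1) (M.cobar n z) = _
    have hz' := LinearMap.mem_ker.1 hz
    rw [LeftComodule.diff_apply, sub_eq_zero] at hz'
    rw [F.family_self, ← hz']
    rfl
  obtain ⟨hy', h2⟩ := hΨ n y (fun i j _ => ⟨M.tensFamily (F.family j) i n z, by
      change (-1 : k) ^ (i + 1) • (R.I j).diff i _ = _
      rw [F.diff_tensFamily i j n hz, smul_smul, ← mul_pow, neg_one_mul, neg_neg, one_pow,
        one_smul], by
      change cochainMap _ i _ = _
      rw [LeftComodule.cochainMap_tensFamily]
      simp only [F.d_family]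
      rfl⟩) (hy0 ▸ hy)
  obtain ⟨hw, h3⟩ := hΘ n _ hy'
  refine ⟨hyn ▸ hw, ?_⟩
  have h0 : (Submodule.Quotient.mk ⟨_, hy⟩ : (R.grid hB).Coh n 0) =
      Submodule.Quotient.mk ⟨y n 0, hy0 ▸ hy⟩ := congrArg (Submodule.mkQ _) (Subtype.ext hy0.symm)
  refine (congrArg (fun t => Θ n (Ψ n t)) (h1.trans h0)).trans ?_
  refine (congrArg (Θ n) h2).trans (h3.trans ?_)
  exact congrArg (Submodule.mkQ _) (Subtype.ext (congrArg (baseMk (R.I n).toMod 1) hyn))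

end InjectiveResolution

end Cotor

/-! # Transport of Gerstenhaber algebras -/

section Transport

variable {k : Type v} [CommRing k]

variable {V W : ℕ → Type w} [∀ n, AddCommGroup (V n)] [∀ n, Module k (V n)]
    [∀ n, AddCommGroup (W n)] [∀ n, Module k (W n)]

/-- A bilinear operation transported along isomorphisms in each degree. -/
def transportMap₂ (φ : ∀ n, V n ≃ₗ[k] W n)
    (f : (⨁ n, V n) →ₗ[k] (⨁ n, V n) →ₗ[k] ⨁ n, V n) :
    (⨁ n, W n) →ₗ[k] (⨁ n, W n) →ₗ[k] ⨁ n, W n :=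
  (f.compl₁₂ (DirectSum.lmap fun n => (φ n).symm.toLinearMap)
    (DirectSum.lmap fun n => (φ n).symm.toLinearMap)).compr₂
      (DirectSum.lmap fun n => (φ n).toLinearMap)

lemma lmap_symm_lmap (φ : ∀ n, V n ≃ₗ[k] W n) (x : ⨁ n, V n) :
    DirectSum.lmap (fun n => (φ n).symm.toLinearMap)
      (DirectSum.lmap (fun n => (φ n).toLinearMap) x) = x :=
  DFinsupp.ext fun n => (φ n).symm_apply_apply (x n)

lemma lmap_lmap_symm (φ : ∀ n, V n ≃ₗ[k] W n) (x : ⨁ n, W n) :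
    DirectSum.lmap (fun n => (φ n).toLinearMap)
      (DirectSum.lmap (fun n => (φ n).symm.toLinearMap) x) = x :=
  DFinsupp.ext fun n => (φ n).apply_symm_apply (x n)

lemma transportMap₂_lmap (φ : ∀ n, V n ≃ₗ[k] W n)
    (f : (⨁ n, V n) →ₗ[k] (⨁ n, V n) →ₗ[k] ⨁ n, V n) (x y : ⨁ n, V n) :
    transportMap₂ φ f (DirectSum.lmap (fun n => (φ n).toLinearMap) x)
      (DirectSum.lmap (fun n => (φ n).toLinearMap) y) =
        DirectSum.lmap (fun n => (φ n).toLinearMap) (f x y) := by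
  change DirectSum.lmap (fun n => (φ n).toLinearMap) (f _ _) = _
  rw [lmap_symm_lmap, lmap_symm_lmap]

lemma lof_apply_equiv (φ : ∀ n, V n ≃ₗ[k] W n) (n : ℕ) (a : V n) :
    DirectSum.lof k ℕ W n (φ n a) =
      DirectSum.lmap (fun n => (φ n).toLinearMap) (DirectSum.lof k ℕ V n a) :=
  (DirectSum.lmap_lof (fun n => (φ n).toLinearMap) n a).symm

/-- A Gerstenhaber algebra structure transported along isomorphisms in each degree. -/
def GerstenhaberAlgebra.transport (G : GerstenhaberAlgebra k V) (φ : ∀ n, V n ≃ₗ[k] W n) :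
    GerstenhaberAlgebra k W where
  one := φ 0 G.one
  mul := transportMap₂ φ G.mul
  bracket := transportMap₂ φ G.bracket
  mul_deg p q a b := by
    obtain ⟨a, rfl⟩ := (φ p).surjective a
    obtain ⟨b, rfl⟩ := (φ q).surjective b
    obtain ⟨c, hc⟩ := G.mul_deg p q a b
    exact ⟨φ _ c, by simp only [lof_apply_equiv, transportMap₂_lmap, hc]⟩
  bracket_deg p q n h a b := by
    obtain ⟨a, rfl⟩ := (φ p).surjective a
    obtain ⟨b, rfl⟩ := (φ q).surjective b
    obtain ⟨c, hc⟩ := G.bracket_deg p q n h a b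
    exact ⟨φ _ c, by simp only [lof_apply_equiv, transportMap₂_lmap, hc]⟩
  bracket_deg_zero a b := by
    obtain ⟨a, rfl⟩ := (φ 0).surjective a
    obtain ⟨b, rfl⟩ := (φ 0).surjective b
    rw [lof_apply_equiv, lof_apply_equiv, transportMap₂_lmap, G.bracket_deg_zero, map_zero]
  one_mul x := by
    rw [← lmap_lmap_symm φ x, lof_apply_equiv, transportMap₂_lmap, G.one_mul]
  mul_one x := by
    rw [← lmap_lmap_symm φ x, lof_apply_equiv, transportMap₂_lmap, G.mul_one]
  mul_assoc x y z := by
    rw [← lmap_lmap_symm φ x, ← lmap_lmap_symm φ y, ← lmap_lmap_symm φ z]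
    simp only [transportMap₂_lmap, G.mul_assoc]
  mul_comm p q a b := by
    obtain ⟨a, rfl⟩ := (φ p).surjective a
    obtain ⟨b, rfl⟩ := (φ q).surjective b
    simp only [lof_apply_equiv, transportMap₂_lmap]
    rw [G.mul_comm p q a b, map_smul]
  bracket_antisymm p q a b := by
    obtain ⟨a, rfl⟩ := (φ p).surjective a
    obtain ⟨b, rfl⟩ := (φ q).surjective b
    simp only [lof_apply_equiv, transportMap₂_lmap]
    rw [G.bracket_antisymm p q a b, map_neg, map_smul]
  bracket_self p hp a := by
    obtain ⟨a, rfl⟩ := (φ p).surjective a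
    rw [lof_apply_equiv, transportMap₂_lmap, G.bracket_self p hp, map_zero]
  bracket_bracket_self p hp a := by
    obtain ⟨a, rfl⟩ := (φ p).surjective a
    rw [lof_apply_equiv, transportMap₂_lmap, transportMap₂_lmap, G.bracket_bracket_self p hp,
      map_zero]
  jacobi p q r a b c := by
    obtain ⟨a, rfl⟩ := (φ p).surjective a
    obtain ⟨b, rfl⟩ := (φ q).surjective b
    obtain ⟨c, rfl⟩ := (φ r).surjective c
    simp only [lof_apply_equiv, transportMap₂_lmap]
    rw [G.jacobi p q r a b c, map_add, map_smul]
  leibniz p q r c a b := by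
    obtain ⟨a, rfl⟩ := (φ q).surjective a
    obtain ⟨b, rfl⟩ := (φ r).surjective b
    obtain ⟨c, rfl⟩ := (φ p).surjective c
    simp only [lof_apply_equiv, transportMap₂_lmap]
    rw [G.leibniz p q r c a b, map_add, map_smul]

lemma GerstenhaberAlgebra.transport_isIso (G : GerstenhaberAlgebra k V)
    (φ : ∀ n, V n ≃ₗ[k] W n) : IsGerstenhaberIso G (G.transport φ) φ where
  map_one := rfl
  map_mul x y := (transportMap₂_lmap φ G.mul x y).symm
  map_bracket x y := (transportMap₂_lmap φ G.bracket x y).symm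

end Transport

end

end BialgebroidCohomology

/-! ### The main theorem. -/

theorem mainTheorem3 {k : Type v} {A U N : Type u} [CommRing k] [Ring A] [Algebra k A]
    [Ring U] [Algebra k U] [Ring N] [Algebra k N] [Module U N] [IsScalarTower k U N]
    (B : LeftBialgebroid k A U) (Y : YetterDrinfeldAlgebra B N) (hY : Y.IsBraidedCommutative) :
    ∃ P : OperadWithMul k (fun n => Y.toComodule.C n),
      IsInsertion Y P.toOperad ∧
      P.mul = Y.tuple 2 (fun _ => 1) 1 ∧
      P.one = Y.tuple 1 (fun _ => 1) 1 ∧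
      P.unit = Y.tuple 0 (fun _ => 1) 1 ∧
      (∀ (n : ℕ) (x : Y.toComodule.C n),
        Y.toComodule.diff n x = P.bracket (n := n + 1) (by omega) P.mul x) ∧
      ∃ G : GerstenhaberAlgebra k Y.toComodule.H,
        IsInducedBy Y.toComodule P G ∧
        (B.IsFlatRight →
          Nonempty (InjectiveResolution Y.toComodule) ∧
          ∀ R : InjectiveResolution Y.toComodule,
            ∃ φ : ∀ n, Y.toComodule.H n ≃ₗ[k] R.Cotor n,
              R.IsCanonical φ ∧
              ∃ G' : GerstenhaberAlgebra k R.Cotor, IsGerstenhaberIso G G' φ) := by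
  refine ⟨Y.operad hY, Y.operad_isInsertion hY, rfl, rfl, rfl,
    fun n x => YetterDrinfeldAlgebra.diff_eq_bracket hY n x _,
    YetterDrinfeldAlgebra.gerstenhaber hY, YetterDrinfeldAlgebra.gerstenhaber_isInducedBy hY,
    fun hB => ⟨⟨LeftComodule.injectiveResolution hB Y.toComodule⟩, fun R => ?_⟩⟩
  obtain ⟨φ, hφ⟩ := InjectiveResolution.exists_isCanonical hB R
  exact ⟨φ, hφ, _, GerstenhaberAlgebra.transport_isIso _ φ⟩
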